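/- Let $\Omega=(0,1)$, $T>2$, $Q_T=\Omega\times(0,T)$, and let $H^1_{(0)}(\Omega)=\{z\in H^1(\Omega):z(0)=0\}$ with norm $\|z'\|_{L^2(\Omega)}$ and dual $H^{-1}_{(0)}(\Omega)$. For $F\in L^2(Q_T)$ and $v\in L^2(0,T)$, a *weak solution* of $\partial_{tt}y-\partial_{xx}y=F$ in $Q_T$, $y(0,\cdot)=0$, $\partial_xy(1,\cdot)=v$ is a function $y\in C^0([0,T];H^1_{(0)}(\Omega))\cap C^1([0,T];L^2(\Omega))\cap H^2(0,T;H^{-1}_{(0)}(\Omega))$ such that for a.e. $t$ and all $z\in H^1_{(0)}(\Omega)$: $\langle\partial_{tt}y(t),z\rangle-v(t)z(1)+\int_\Omega\partial_xy\,z'\,dx=\int_\Omega Fz\,dx$. (Equations with lower-order terms in $y$ are understood by moving these terms into $F$.) Let $\mathcal H$ be the space of pairs $(y,v)$ such that $y$ is such a weak solution for some $F=:\partial_{tt}y-\partial_{xx}y\in L^2(Q_T)$, with the norm $$\|(y,v)\|_{\mathcal H}^2=\|\partial_{tt}y-\partial_{xx}y\|_{L^2(Q_T)}^2+\|y\|_{L^2(Q_T)}^2+\|v\|_{L^2(0,T)}^2+\|y(\cdot,0)\|_{H^1_{(0)}(\Omega)}^2+\|\partial_ty(\cdot,0)\|_{L^2(\Omega)}^2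 .$$ For $(u_0,u_1),(z_0,z_1)\in H^1_{(0)}(\Omega)\times L^2(\Omega)$ let $\mathcal A$ be the set of $(y,v)\in\mathcal H$ with $(y,\partial_ty)(\cdot,0)=(u_0,u_1)$ and $(y,\partial_ty)(\cdot,T)=(z_0,z_1)$, and let $\mathcal A_0$ be the same set for zero data. For $f\in C^1(\mathbb R)$ put $E(y,v)=\frac12\|\partial_{tt}y-\partial_{xx}y+f(y)\|_{L^2(Q_T)}^2$. A *least-squares sequence* is given by $(y_0,v_0)\in\mathcal A$ and, for $k\ge0$, $$(y_{k+1},v_{k+1})=(y_k,v_k)-\lambda_k(Y_k,V_k),\qquad \lambda_k\in\operatorname{argmin}_{\lambda\in[0,1]}E\big((y_k,v_k)-\lambda(Y_k,V_k)\big),\tag{LS}$$ where $(Y_k,V_k)$ minimizes $\|Y\|_{L^2(Q_T)}^2+\|V\|_{L^2(0,T)}^2$ among the $(Y,V)\in\mathcal A_0$ with $\partial_{tt}Y-\partial_{xx}Y+f'(y_k)Y=\partial_{tt}y_k-\partial_{xx}y_k+f(y_k)$ in $Q_T$, $Y(0,\cdot)=0$, $\partial_xY(1,\cdot)=V$. A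 sequence $e_k\ge 0$ is said to converge to $0$ *with order at least $r\ge1$ after finitely many iterations* if there are $k_0$ and $C>0$ with $Ce_{k_0}^{r-1}<1$ and $e_{k+1}\le Ce_k^{\,r}$ for all $k\ge k_0$. **Theorem.** Let $T>2$ and $\alpha\in[0,1]$. There are $\beta^\star>0$ and $\delta>0$, depending only on $T$ and $\alpha$, such that the following holds for every $f\in C^1(\mathbb R)$ with $$\sup_{a\neq b}\frac{|f'(a)-f'(b)|}{|a-b|^\alpha}<\infty,\qquad \limsup_{|r|\to\infty}\frac{|f'(r)|}{\ln^2|r|}<\beta^\star,$$ and, in the case $\alpha=0$, moreover $\|f'\|_{L^\infty(\mathbb R)}\le\delta$, and for all $(u_0,u_1),(z_0,z_1)\in H^1_{(0)}(\Omega)\times L^2(\Omega)$. The set $\mathcal A$ is non-empty, every $(y_0,v_0)\in\mathcal A$ is the first term of a least-squares sequence, and for every least-squares sequence: 1. $E(y_k,v_k)\to0$; there is $c\in(0,1)$ with $E(y_{k+1},v_{k+1})\le c\,E(y_k,v_k)$ for all $k$; and the convergence is of order at least $1+\alpha$ after finitely many iterations. 2. If $E(y_k,v_k)\ne0$ for all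 $k$ (otherwise the algorithm has stopped at a solution and the remaining $\lambda_k$ are arbitrary), then $\lambda_k\to1$. If moreover $\alpha>0$, then $|1-\lambda_k|\le Cc^k$ for all $k$, for some $C$ and some $c\in(0,1)$, and from some rank on $|1-\lambda_k|$ is bounded by a sequence that converges to $0$ with order at least $1+\alpha$. 3. There is $(\bar y,\bar v)\in\mathcal A$ that is a state-control pair of the semilinear equation, i.e. $\bar y$ is a weak solution of $\partial_{tt}\bar y-\partial_{xx}\bar y+f(\bar y)=0$ in $Q_T$, $\bar y(0,\cdot)=0$, $\partial_x\bar y(1,\cdot)=\bar v$, with $(\bar y,\partial_t\bar y)(\cdot,0)=(u_0,u_1)$ and $(\bar y,\partial_t\bar y)(\cdot,T)=(z_0,z_1)$, such that $(y_k,v_k)\to(\bar y,\bar v)$ in $\mathcal H$; there are $C$ and $c\in(0,1)$ with $\|(y_k,v_k)-(\bar y,\bar v)\|_{\mathcal H}\le Cc^k$ for all $k$; and this convergence is of order at least $1+\alpha$ after finitely many iterations. -/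

import Mathlib

open MeasureTheory Filter Topology Set

noncomputable section

namespace NeumannWave

/-- `L²(Ω)` for `Ω = (0,1)` (the endpoints are a null set). -/
abbrev L2 : Type := Lp ℝ 2 (volume : Measure unitInterval)

/-- `H¹₍₀₎(Ω) = {z ∈ H¹(Ω) ; z(0) = 0}`, as the space of pairs `(z, z')` of a continuous function `z`
on `[0,1]` and a class `z' ∈ L²(Ω)` such that `z(x) = ∫₀ˣ z'(s) ds` for every `x`. -/
def H10Sub : Submodule ℝ (C(unitInterval, ℝ) × L2) where
  carrier := {p | ∀ x : unitInterval, p.1 x = ∫ s in Iic x, p.2 s}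
  zero_mem' := by
    intro x
    simp
  add_mem' := by
    intro p q hp hq x
    have hi : ∀ g : L2, Integrable (fun s => g s) (volume.restrict (Iic x)) := fun g =>
      ((Lp.memLp g).integrable (by norm_num)).restrict
    have h : (fun s => ((p.2 + q.2 : L2) : unitInterval → ℝ) s) =ᵐ[volume.restrict (Iic x)]
        fun s => p.2 s + q.2 s := ae_restrict_of_ae (Lp.coeFn_add _ _)
    simp only [Prod.fst_add, Prod.snd_add, ContinuousMap.add_apply]
    rw [integral_congr_ae h, integral_add (hi _) (hi _), hp x, hq x]
  smul_mem' := by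
    intro c p hp x
    have h : (fun s => ((c • p.2 : L2) : unitInterval → ℝ) s) =ᵐ[volume.restrict (Iic x)]
        fun s => c * p.2 s := ae_restrict_of_ae (Lp.coeFn_smul _ _)
    simp only [Prod.smul_fst, Prod.smul_snd, ContinuousMap.smul_apply, smul_eq_mul]
    rw [integral_congr_ae h, integral_const_mul, hp x]

/-- The space `H¹₍₀₎(Ω)`; its norm is `‖z‖ = ‖z'‖_{L²(Ω)}`. -/
def H10 : Type := H10Sub

instance : AddCommGroup H10 := inferInstanceAs (AddCommGroup H10Sub)

instance : Module ℝ H10 := inferInstanceAs (Module ℝ H10Sub)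

/-- The derivative `z ↦ z'`, with values in `L²(Ω)`. -/
def H10.dx : H10 →ₗ[ℝ] L2 := (LinearMap.snd ℝ C(unitInterval, ℝ) L2).comp H10Sub.subtype

/-- The continuous representative of `z`. -/
def H10.val (z : H10) : C(unitInterval, ℝ) := (show H10Sub from z).1.1

instance : CoeFun H10 (fun _ => unitInterval → ℝ) := ⟨fun z => z.val⟩

theorem H10.dx_injective : Function.Injective H10.dx := by
  intro a b h
  apply Subtype.ext
  refine Prod.ext (ContinuousMap.ext fun x => ?_) h
  have h' : a.1.2 = b.1.2 := h
  rw [a.2 x, b.2 x, h']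

instance : NormedAddCommGroup H10 := NormedAddCommGroup.induced H10 L2 H10.dx H10.dx_injective

instance : NormedSpace ℝ H10 := NormedSpace.induced ℝ H10 L2 H10.dx

/-- The class of `z ∈ H¹₍₀₎(Ω)` in `L²(Ω)`. -/
def H10.toL2 (z : H10) : L2 := ContinuousMap.toLp 2 volume ℝ z.val

/-- `y ∈ C⁰([0,T]; H¹₍₀₎(Ω)) ∩ C¹([0,T]; L²(Ω)) ∩ H²(0,T; H⁻¹₍₀₎(Ω))`, with time derivative `yt` and
`v ∈ L²(0,T)`, is a weak solution of `∂ₜₜy - ∂ₓₓy = F` in `Q_T`, `y(0,·) = 0`, `∂ₓy(1,·) = v`.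
`H⁻¹₍₀₎(Ω)` is the dual of `H¹₍₀₎(Ω)` and `ytt` is the derivative of `yt` as an `H⁻¹₍₀₎(Ω)`-valued
function. The values of `y`, `yt`, `v`, `F` at times outside `[0,T]` play no role. -/
structure IsWeakSolution (T : ℝ) (F : ℝ → unitInterval → ℝ)
    (y : ℝ → H10) (yt : ℝ → L2) (v : ℝ → ℝ) : Prop where
  continuousOn_y : ContinuousOn y (Icc 0 T)
  continuousOn_yt : ContinuousOn yt (Icc 0 T)
  hasDeriv : ∀ t ∈ Icc 0 T, HasDerivWithinAt (fun s => (y s).toL2) (yt t) (Icc 0 T) t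
  memLp_v : MemLp v 2 (volume.restrict (Icc 0 T))
  weak : ∃ ytt : ℝ → StrongDual ℝ H10,
    MemLp ytt 2 (volume.restrict (Icc 0 T)) ∧
    (∀ t ∈ Icc 0 T, ∀ z : H10,
      ∫ x, yt t x * z x = (∫ x, yt 0 x * z x) + ∫ s in (0 : ℝ)..t, ytt s z) ∧
    ∀ᵐ t ∂(volume.restrict (Icc 0 T)), ∀ z : H10,
      ytt t z - v t * z 1 + ∫ x, (y t).dx x * z.dx x = ∫ x, F t x * z x

/-- A pair `(y, v)` together with `dt = ∂ₜy` and `box = ∂ₜₜy - ∂ₓₓy`; `L²(Q_T)` is read as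
`L²(0,T; L²(Ω))`. -/
structure Pair where
  y : ℝ → H10
  v : ℝ → ℝ
  dt : ℝ → L2
  box : ℝ → L2

instance : Sub Pair := ⟨fun p q => ⟨p.y - q.y, p.v - q.v, p.dt - q.dt, p.box - q.box⟩⟩

instance : SMul ℝ Pair := ⟨fun c p => ⟨c • p.y, c • p.v, c • p.dt, c • p.box⟩⟩

/-- Membership in the space `ℋ`. -/
structure MemH (T : ℝ) (p : Pair) : Prop where
  memLp_box : MemLp p.box 2 (volume.restrict (Icc 0 T))
  sol : IsWeakSolution T (fun t x => p.box t x) p.y p.dt p.v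

/-- The norm of `ℋ`. -/
def normH (T : ℝ) (p : Pair) : ℝ :=
  Real.sqrt ((∫ t in (0 : ℝ)..T, ‖p.box t‖ ^ 2) + (∫ t in (0 : ℝ)..T, ‖(p.y t).toL2‖ ^ 2)
    + (∫ t in (0 : ℝ)..T, (p.v t) ^ 2) + (‖p.y 0‖ ^ 2 + ‖p.dt 0‖ ^ 2))

/-- Membership in `𝒜`: elements of `ℋ` going from `(u₀, u₁)` at time `0` to `(z₀, z₁)` at time `T`.
All data zero gives `𝒜₀`. -/
structure MemA (T : ℝ) (u₀ : H10) (u₁ : L2) (z₀ : H10) (z₁ : L2) (p : Pair) : Prop where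
  memH : MemH T p
  init : p.y 0 = u₀ ∧ p.dt 0 = u₁
  final : p.y T = z₀ ∧ p.dt T = z₁

/-- `(y, v)` is a state-control pair of the semilinear equation `∂ₜₜy - ∂ₓₓy + f(y) = 0`,
`y(0,·) = 0`, `∂ₓy(1,·) = v`, steering `(u₀, u₁)` to `(z₀, z₁)` in time `T`. -/
structure IsStateControlPair (T : ℝ) (f : ℝ → ℝ) (u₀ : H10) (u₁ : L2) (z₀ : H10) (z₁ : L2)
    (p : Pair) : Prop where
  sol : IsWeakSolution T (fun t x => - f (p.y t x)) p.y p.dt p.v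
  init : p.y 0 = u₀ ∧ p.dt 0 = u₁
  final : p.y T = z₀ ∧ p.dt T = z₁

/-- `E(y,v) = ½ ‖∂ₜₜy - ∂ₓₓy + f(y)‖²_{L²(Q_T)}`. -/
def energy (T : ℝ) (f : ℝ → ℝ) (p : Pair) : ℝ :=
  (1 / 2) * ∫ t in (0 : ℝ)..T, ∫ x, (p.box t x + f (p.y t x)) ^ 2

/-- `𝒥(y,v) = ‖y‖²_{L²(Q_T)} + ‖v‖²_{L²(0,T)}`. -/
def cost (T : ℝ) (p : Pair) : ℝ :=
  (∫ t in (0 : ℝ)..T, ‖(p.y t).toL2‖ ^ 2) + ∫ t in (0 : ℝ)..T, (p.v t) ^ 2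

/-- `q = (Y, V) ∈ 𝒜₀` solves the equation linearized at `p = (y, v)`,
`∂ₜₜY - ∂ₓₓY + f'(y) Y = ∂ₜₜy - ∂ₓₓy + f(y)`, `Y(0,·) = 0`, `∂ₓY(1,·) = V`. -/
structure IsDirection (T : ℝ) (f : ℝ → ℝ) (p q : Pair) : Prop where
  memA₀ : MemA T 0 0 0 0 q
  sol : IsWeakSolution T
    (fun t x => p.box t x + f (p.y t x) - deriv f (p.y t x) * q.y t x) q.y q.dt q.v

/-- The least-squares algorithm: iterates `p k = (y_k, v_k)`, directions `q k = (Y_k, V_k)` of minimal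
cost and optimal steps `lam k` in `[0,1]`. -/
structure IsLeastSquares (T : ℝ) (f : ℝ → ℝ) (u₀ : H10) (u₁ : L2) (z₀ : H10) (z₁ : L2)
    (p q : ℕ → Pair) (lam : ℕ → ℝ) : Prop where
  start : MemA T u₀ u₁ z₀ z₁ (p 0)
  direction : ∀ k, IsDirection T f (p k) (q k)
  minimal : ∀ k, ∀ q' : Pair, IsDirection T f (p k) q' → cost T (q k) ≤ cost T q'
  step_mem : ∀ k, lam k ∈ Icc (0 : ℝ) 1
  step_opt : ∀ k, IsMinOn (fun l : ℝ => energy T f (p k - l • q k)) (Icc 0 1) (lam k)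
  next : ∀ k, p (k + 1) = p k - lam k • q k

/-- `W_α`: `f ∈ C¹(ℝ)` with `[f']_α < ∞`. -/
def MemW (α : ℝ) (f : ℝ → ℝ) : Prop :=
  ContDiff ℝ 1 f ∧ ∃ K : ℝ, ∀ a b : ℝ, a ≠ b → |deriv f a - deriv f b| ≤ K * |a - b| ^ α

/-- The nonnegative sequence `e` tends to zero with order at least `r ≥ 1` from the rank `k₀` on:
`e_{k+1} ≤ C e_k^r`, where `C e_{k₀}^{r-1} < 1` (so that the inequality forces convergence; for
`r = 1` this is linear convergence with ratio `C < 1`). -/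
def HasOrderFrom (r : ℝ) (k₀ : ℕ) (e : ℕ → ℝ) : Prop :=
  ∃ C : ℝ, 0 < C ∧ C * e k₀ ^ (r - 1) < 1 ∧ ∀ k, k₀ ≤ k → e (k + 1) ≤ C * e k ^ r

end NeumannWave

end

noncomputable section

namespace NeumannWave

open scoped unitInterval

section Primitive

/-- Integration by parts against the primitive of an integrable function. -/
theorem integral_mul_eq_sub_primitive {a b : ℝ} {φ φ' k : ℝ → ℝ}
    (hφ : ∀ s, HasDerivAt φ (φ' s) s) (hφ' : Continuous φ')
    (hk : IntervalIntegrable k volume a b) :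
    ∫ s in a..b, φ s * k s
      = φ b * (∫ s in a..b, k s) - ∫ s in a..b, φ' s * ∫ r in a..s, k r := by
  have hK := hk.absolutelyContinuousOnInterval_intervalIntegral (c := a) (by simp)
  have hd : deriv φ = φ' := funext fun s => (hφ s).deriv
  have hφ1 : ContDiff ℝ 1 φ := contDiff_one_iff_deriv.2
    ⟨fun s => (hφ s).differentiableAt, hd ▸ hφ'⟩
  obtain ⟨C, hC⟩ := hφ1.contDiffOn.exists_lipschitzOnWith (s := uIcc a b) (by norm_num)
    (convex_uIcc a b) isCompact_uIcc
  have hΦ : AbsolutelyContinuousOnInterval φ a b := hC.absolutelyContinuousOnInterval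
  have h := hΦ.integral_mul_deriv_eq_deriv_mul hK
  simp only [intervalIntegral.integral_same, mul_zero, sub_zero, hd] at h
  rw [← h]
  apply intervalIntegral.integral_congr_ae
  filter_upwards [hk.ae_hasDerivAt_integral] with s hs hs'
  rw [(hs (uIoc_subset_uIcc hs') a (by simp)).deriv]

end Primitive

section UnitInterval

/-- Extension to the line of a function on the unit interval. -/
def ext01 (g : I → ℝ) : ℝ → ℝ := IccExtend zero_le_one g

theorem ext01_coe (g : I → ℝ) (x : I) : ext01 g x = g x := IccExtend_val _ _ _

theorem ext01_of_mem (g : I → ℝ) {x : ℝ} (hx : x ∈ I) : ext01 g x = g ⟨x, hx⟩ :=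
  IccExtend_of_mem _ _ hx

theorem setIntegral_Iic_eq (g : I → ℝ) (x : I) :
    ∫ s in Iic x, g s = ∫ s in (0 : ℝ)..x, ext01 g s := by
  have h1 : ∀ s : I, g s = ext01 g s := fun s => (ext01_coe g s).symm
  have hpre : (Iic x : Set I) = (Subtype.val : I → ℝ) ⁻¹' (Icc 0 (x : ℝ)) := by
    ext s; simp [s.2.1]
  simp_rw [h1]
  rw [hpre, unitInterval.measurePreserving_coe.setIntegral_preimage_emb
    unitInterval.measurableEmbedding_coe, Measure.restrict_restrict measurableSet_Icc,
    inter_eq_left.2 (Icc_subset_Icc le_rfl x.2.2), intervalIntegral.integral_of_le x.2.1,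
    integral_Icc_eq_integral_Ioc]

theorem integral_unit_eq (g : I → ℝ) : ∫ s, g s = ∫ s in (0 : ℝ)..1, ext01 g s := by
  have h := setIntegral_Iic_eq g 1
  rwa [show (Iic (1 : I)) = univ from by ext s; simp [unitInterval.le_one'],
    Measure.restrict_univ] at h

theorem integral_unit_eq_of_eqOn {g : I → ℝ} {h : ℝ → ℝ} (hg : ∀ x : I, g x = h x) :
    ∫ s, g s = ∫ s in (0 : ℝ)..1, h s := by
  rw [integral_unit_eq]
  refine intervalIntegral.integral_congr fun x hx => ?_
  rw [uIcc_of_le zero_le_one] at hx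
  rw [ext01_of_mem g hx, hg]

theorem integrableOn_ext01 {g : I → ℝ} (hg : Integrable g) :
    IntervalIntegrable (ext01 g) volume 0 1 := by
  rw [intervalIntegrable_iff_integrableOn_Icc_of_le zero_le_one]
  have h := unitInterval.measurePreserving_coe.integrable_comp_emb
    unitInterval.measurableEmbedding_coe (g := ext01 g)
  refine h.1 ?_
  convert hg using 1
  ext s
  exact ext01_coe g s

end UnitInterval

section L2

theorem L2.integrable (g : L2) : Integrable (fun s => g s) :=
  (Lp.memLp g).integrable (by norm_num)

theorem L2.inner_eq (g h : L2) : inner ℝ g h = ∫ x, g x * h x := by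
  rw [MeasureTheory.L2.inner_def]
  refine integral_congr_ae (Eventually.of_forall fun x => ?_)
  simp [mul_comm]

theorem L2.norm_sq_eq (g : L2) : ‖g‖ ^ 2 = ∫ x, g x ^ 2 := by
  rw [← real_inner_self_eq_norm_sq, L2.inner_eq]
  simp only [sq]

/-- The class in `L²(Ω)` of a continuous function. -/
def cL2 : C(I, ℝ) →L[ℝ] L2 := ContinuousMap.toLp 2 volume ℝ

theorem cL2_coe (g : C(I, ℝ)) : (cL2 g : I → ℝ) =ᵐ[volume] g :=
  ContinuousMap.coeFn_toLp volume g

theorem norm_cL2_le (g : C(I, ℝ)) : ‖cL2 g‖ ≤ ‖g‖ := by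
  have h := Lp.norm_le_of_ae_bound (p := 2) (μ := (volume : Measure I)) (f := cL2 g)
    (norm_nonneg g) (by
      filter_upwards [cL2_coe g] with x hx
      rw [hx]; exact g.norm_coe_le_norm x)
  have h1 : measureUnivNNReal (volume : Measure I) = 1 := by simp [measureUnivNNReal]
  simpa [h1] using h

theorem inner_cL2_right (g : L2) (h : C(I, ℝ)) : inner ℝ g (cL2 h) = ∫ x, g x * h x := by
  rw [L2.inner_eq]
  refine integral_congr_ae ?_
  filter_upwards [cL2_coe h] with x hx
  rw [hx]

theorem inner_cL2_cL2 (g h : C(I, ℝ)) : inner ℝ (cL2 g) (cL2 h) = ∫ x, g x * h x := by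
  rw [inner_cL2_right]
  refine integral_congr_ae ?_
  filter_upwards [cL2_coe g] with x hx
  rw [hx]

theorem cL2_dense : DenseRange cL2 :=
  ContinuousMap.toLp_denseRange ℝ volume ℝ (by norm_num)

end L2

section H10

theorem H10.apply_eq (z : H10) (x : I) : z x = ∫ s in Iic x, z.dx s := z.2 x

theorem H10.apply_eq_interval (z : H10) (x : I) :
    z x = ∫ s in (0 : ℝ)..x, ext01 (fun s => z.dx s) s := by
  rw [H10.apply_eq, setIntegral_Iic_eq]

/-- The derivative as a linear isometry. -/
def H10.dxL : H10 →ₗᵢ[ℝ] L2 := ⟨H10.dx, fun _ => rfl⟩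

theorem H10.norm_eq (z : H10) : ‖z‖ = ‖z.dx‖ := rfl

theorem L2.norm_setIntegral_le (g : L2) (s : Set I) : |∫ x in s, g x| ≤ ‖g‖ := by
  have h1 : |∫ x in s, g x| ≤ ∫ x, |g x| := by
    refine (norm_integral_le_integral_norm (fun x => g x)).trans ?_
    exact setIntegral_le_integral (L2.integrable g).norm (Eventually.of_forall fun x => norm_nonneg _)
  refine h1.trans ?_
  have h2 : eLpNorm g 1 volume ≤ eLpNorm g 2 volume :=
    eLpNorm_le_eLpNorm_of_exponent_le (by norm_num) (Lp.aestronglyMeasurable g)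
  have h3 : ∫ x, |g x| = (eLpNorm g 1 volume).toReal := by
    rw [eLpNorm_one_eq_lintegral_enorm]
    exact integral_norm_eq_lintegral_enorm (Lp.aestronglyMeasurable g)
  rw [h3, Lp.norm_def]
  exact ENNReal.toReal_mono (Lp.eLpNorm_ne_top g) h2

theorem H10.abs_apply_le (z : H10) (x : I) : |z x| ≤ ‖z‖ := by
  rw [H10.apply_eq]; exact L2.norm_setIntegral_le _ _

/-- The continuous representative, as a continuous linear map. -/
def H10.valL : H10 →L[ℝ] C(I, ℝ) :=
  LinearMap.mkContinuous
    ((LinearMap.fst ℝ C(unitInterval, ℝ) L2).comp H10Sub.subtype : H10 →ₗ[ℝ] C(I, ℝ)) 1 fun z => by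
    rw [one_mul, ContinuousMap.norm_le _ (norm_nonneg _)]
    exact fun x => H10.abs_apply_le z x

theorem H10.norm_valL_le (z : H10) : ‖H10.valL z‖ ≤ ‖z‖ := by
  rw [ContinuousMap.norm_le _ (norm_nonneg _)]
  exact fun x => H10.abs_apply_le z x

/-- The embedding of `H¹₍₀₎(Ω)` in `L²(Ω)`. -/
def H10.toL2L : H10 →L[ℝ] L2 := cL2.comp H10.valL

theorem H10.toL2_eq (z : H10) : z.toL2 = cL2 z.val := rfl

/-- Evaluation at `x`. -/
def H10.evalL (x : I) : H10 →L[ℝ] ℝ := (ContinuousMap.evalCLM ℝ x).comp H10.valL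

/-- The element of `H¹₍₀₎(Ω)` with given derivative. -/
def H10.ofL2 (g : L2) : H10 :=
  ⟨(⟨fun x => ∫ s in Iic x, g s, by
      have hc := intervalIntegral.continuousOn_primitive_interval (μ := volume)
        (f := ext01 (fun s => g s)) (a := 0) (b := 1) (by
          rw [uIcc_of_le zero_le_one]
          exact (intervalIntegrable_iff_integrableOn_Icc_of_le zero_le_one).1
            (integrableOn_ext01 (L2.integrable g)))
      have h' : (fun x : I => ∫ s in Iic x, g s)
          = (fun x : I => ∫ s in (0 : ℝ)..x, ext01 (fun s => g s) s) := by
        ext x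
        rw [setIntegral_Iic_eq]
      rw [h']
      rw [uIcc_of_le zero_le_one] at hc
      exact continuousOn_iff_continuous_domRestrict.1 hc⟩, g), fun x => rfl⟩

theorem H10.dx_ofL2 (g : L2) : (H10.ofL2 g).dx = g := rfl

/-- `H¹₍₀₎(Ω)` is isometric to `L²(Ω)` through the derivative. -/
def H10.equivL2 : H10 ≃ₗᵢ[ℝ] L2 :=
  LinearIsometryEquiv.ofSurjective H10.dxL fun g => ⟨H10.ofL2 g, H10.dx_ofL2 g⟩

instance : CompleteSpace H10 :=
  (completeSpace_congr (e := H10.equivL2.toEquiv) H10.equivL2.isometry.isUniformEmbedding).2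
    inferInstance

/-- Integration by parts in `H¹₍₀₎(Ω)`. -/
theorem H10.integral_mul_dx (z : H10) {φ φ' : ℝ → ℝ} (hφ : ∀ s, HasDerivAt φ (φ' s) s)
    (hφ' : Continuous φ') :
    ∫ x : I, z.dx x * φ x = z 1 * φ 1 - ∫ x : I, z x * φ' x := by
  have h := integral_mul_eq_sub_primitive hφ hφ' (integrableOn_ext01 (L2.integrable z.dx))
  have h1 : ∫ x : I, z.dx x * φ x = ∫ s in (0 : ℝ)..1, φ s * ext01 (fun s => z.dx s) s := by
    refine integral_unit_eq_of_eqOn (g := fun x => z.dx x * φ x)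
      (h := fun s => φ s * ext01 (fun s => z.dx s) s) fun x => ?_
    rw [ext01_coe, mul_comm]
  have h2 : ∫ x : I, z x * φ' x
      = ∫ s in (0 : ℝ)..1, φ' s * ∫ r in (0 : ℝ)..s, ext01 (fun s => z.dx s) r := by
    refine integral_unit_eq_of_eqOn (g := fun x => z x * φ' x)
      (h := fun s => φ' s * ∫ r in (0 : ℝ)..s, ext01 (fun s => z.dx s) r) fun x => ?_
    rw [← H10.apply_eq_interval, mul_comm]
  have h3 := H10.apply_eq_interval z 1
  rw [h1, h2, h, h3, mul_comm]
  simp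

end H10

/-- Lebesgue measure on the time interval. -/
abbrev timeMeasure (T : ℝ) : Measure ℝ := volume.restrict (Icc 0 T)

/-- `L²(0,T;E)`. -/
abbrev TimeL2 (T : ℝ) (E : Type) [NormedAddCommGroup E] : Type := Lp E 2 (timeMeasure T)

section TimeSpaces

variable {T : ℝ} {E : Type} [NormedAddCommGroup E]

theorem timeMeasure_univ : timeMeasure T univ = ENNReal.ofReal T := by simp

theorem intervalIntegral_eq_timeMeasure [NormedSpace ℝ E] (hT : 0 ≤ T) (g : ℝ → E) :
    ∫ t in (0 : ℝ)..T, g t = ∫ t, g t ∂(timeMeasure T) := by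
  rw [intervalIntegral.integral_of_le hT, integral_Icc_eq_integral_Ioc]

theorem TimeL2.integrable (F : TimeL2 T E) : Integrable (fun s => F s) (timeMeasure T) :=
  (Lp.memLp F).integrable (by norm_num)

theorem TimeL2.intervalIntegrable (F : TimeL2 T E) {t : ℝ} (ht : t ∈ Icc 0 T) :
    IntervalIntegrable (fun s => F s) volume 0 t := by
  rw [intervalIntegrable_iff_integrableOn_Icc_of_le ht.1]
  exact IntegrableOn.mono_set (TimeL2.integrable F) (Icc_subset_Icc le_rfl ht.2)

theorem ae_timeMeasure_restrict_uIoc {t : ℝ} (ht : t ∈ Icc 0 T) {p : ℝ → Prop}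
    (h : ∀ᵐ s ∂(timeMeasure T), p s) : ∀ᵐ s, s ∈ uIoc 0 t → p s := by
  rw [ae_restrict_iff' measurableSet_Icc] at h
  filter_upwards [h] with s hs hs'
  rw [uIoc_of_le ht.1] at hs'
  exact hs ⟨hs'.1.le, hs'.2.trans ht.2⟩

theorem TimeL2.integral_norm_le (F : TimeL2 T E) :
    ∫ s, ‖F s‖ ∂(timeMeasure T) ≤ √T * ‖F‖ := by
  have h1 : ∫ s, ‖F s‖ ∂(timeMeasure T) = (eLpNorm F 1 (timeMeasure T)).toReal := by
    rw [eLpNorm_one_eq_lintegral_enorm]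
    exact integral_norm_eq_lintegral_enorm (Lp.aestronglyMeasurable F)
  have h2 := eLpNorm_le_eLpNorm_mul_rpow_measure_univ (μ := timeMeasure T) (p := 1) (q := 2)
    (by norm_num) (Lp.aestronglyMeasurable F)
  rw [h1, Lp.norm_def, mul_comm]
  refine (ENNReal.toReal_mono ?_ h2).trans (le_of_eq ?_)
  · exact ENNReal.mul_ne_top (Lp.eLpNorm_ne_top F) (by
      rw [timeMeasure_univ]; exact ENNReal.rpow_ne_top_of_nonneg (by norm_num) (by simp))
  · rw [ENNReal.toReal_mul, timeMeasure_univ, ← ENNReal.toReal_rpow]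
    congr 1
    rw [ENNReal.toReal_ofReal', Real.sqrt_eq_rpow]
    rcases le_total 0 T with h | h
    · rw [max_eq_left h]; norm_num
    · rw [max_eq_right h, ← Real.sqrt_eq_rpow, Real.sqrt_eq_zero_of_nonpos h]; norm_num

/-- `F ↦ ∫₀ᵗ F(s) ds` on `L²(0,T;E)`. -/
def itg [NormedSpace ℝ E] (t : ℝ) : TimeL2 T E →L[ℝ] E :=
  LinearMap.mkContinuous
    { toFun := fun F => ∫ s in Iic t, F s ∂(timeMeasure T)
      map_add' := fun F G => by
        rw [← integral_add (TimeL2.integrable F).restrict (TimeL2.integrable G).restrict]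
        exact integral_congr_ae (ae_restrict_of_ae (Lp.coeFn_add F G))
      map_smul' := fun c F => by
        rw [RingHom.id_apply, ← integral_smul]
        exact integral_congr_ae (ae_restrict_of_ae (Lp.coeFn_smul c F)) } (√T) fun F => by
    refine (norm_integral_le_integral_norm (fun s => F s)).trans ?_
    exact (setIntegral_le_integral (TimeL2.integrable F).norm
      (Eventually.of_forall fun x => norm_nonneg _)).trans (TimeL2.integral_norm_le F)

theorem itg_eq [NormedSpace ℝ E] {t : ℝ} (ht : t ∈ Icc 0 T) (F : TimeL2 T E) :
    itg t F = ∫ s in (0 : ℝ)..t, F s := by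
  change ∫ s in Iic t, F s ∂(timeMeasure T) = _
  rw [Measure.restrict_restrict measurableSet_Iic, intervalIntegral.integral_of_le ht.1,
    ← integral_Icc_eq_integral_Ioc]
  congr 2
  ext s
  simp only [mem_inter_iff, mem_Iic, mem_Icc]
  exact ⟨fun h => ⟨h.2.1, h.1⟩, fun h => ⟨h.2, h.1, h.2.trans ht.2⟩⟩

theorem TimeL2.norm_sq_eq [InnerProductSpace ℝ E] (F : TimeL2 T E) :
    ‖F‖ ^ 2 = ∫ s, ‖F s‖ ^ 2 ∂(timeMeasure T) := by
  rw [← real_inner_self_eq_norm_sq, MeasureTheory.L2.inner_def]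
  simp only [real_inner_self_eq_norm_sq]

theorem TimeL2.integrable_norm_sq (F : TimeL2 T E) :
    Integrable (fun s => ‖F s‖ ^ 2) (timeMeasure T) :=
  (Lp.memLp F).integrable_norm_pow (p := 2) (by norm_num)

theorem memLp_of_continuous {g : ℝ → E} (hg : Continuous g) :
    MemLp g 2 (timeMeasure T) := by
  obtain ⟨C, hC⟩ := (isCompact_Icc (a := (0 : ℝ)) (b := T)).exists_bound_of_continuousOn
    hg.continuousOn
  exact MemLp.of_bound hg.aestronglyMeasurable C
    ((ae_restrict_iff' measurableSet_Icc).2 (Eventually.of_forall hC))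

variable [hT : Fact (0 < T)]

/-- Projection to the time interval. -/
def tproj (T : ℝ) [hT : Fact (0 < T)] : ℝ → Icc 0 T := projIcc 0 T hT.out.le

theorem continuous_tproj : Continuous (tproj T) := continuous_projIcc

theorem tproj_of_mem {t : ℝ} (ht : t ∈ Icc 0 T) : tproj T t = ⟨t, ht⟩ := projIcc_of_mem _ ht

theorem tproj_coe (t : Icc 0 T) : tproj T t = t := projIcc_val _ _

/-- The initial and final times. -/
def t0 (T : ℝ) [hT : Fact (0 < T)] : Icc 0 T := ⟨0, le_rfl, hT.out.le⟩

/-- The final time. -/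
def t1 (T : ℝ) [hT : Fact (0 < T)] : Icc 0 T := ⟨T, hT.out.le, le_rfl⟩

/-- The embedding `C⁰([0,T];E) → L²(0,T;E)`. -/
def toTimeL2 [NormedSpace ℝ E] : C(Icc 0 T, E) →L[ℝ] TimeL2 T E :=
  LinearMap.mkContinuous
    { toFun := fun y => (memLp_of_continuous
        (y.continuous.comp continuous_tproj)).toLp (y ∘ tproj T)
      map_add' := fun y z => rfl
      map_smul' := fun c y => rfl } (√T) fun y => by
    have h := Lp.norm_le_of_ae_bound (p := 2) (μ := timeMeasure T)
      (f := (memLp_of_continuous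
        (y.continuous.comp continuous_tproj)).toLp (y ∘ tproj T)) (norm_nonneg y) (by
      filter_upwards [MemLp.coeFn_toLp (memLp_of_continuous (T := T)
        (y.continuous.comp continuous_tproj))] with s hs
      rw [hs]; exact y.norm_coe_le_norm _)
    refine h.trans (le_of_eq ?_)
    congr 1
    rw [Real.sqrt_eq_rpow, measureUnivNNReal, timeMeasure_univ]
    simp [Real.coe_toNNReal _ hT.out.le, ENNReal.ofReal]

theorem toTimeL2_coe [NormedSpace ℝ E] (y : C(Icc 0 T, E)) :
    (toTimeL2 y : ℝ → E) =ᵐ[timeMeasure T] fun s => y (tproj T s) :=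
  MemLp.coeFn_toLp (memLp_of_continuous (y.continuous.comp continuous_tproj))

theorem norm_toTimeL2_le [NormedSpace ℝ E] (y : C(Icc 0 T, E)) : ‖toTimeL2 y‖ ≤ √T * ‖y‖ :=
  LinearMap.mkContinuous_norm_le _ (Real.sqrt_nonneg _) _ |> fun h =>
    (ContinuousLinearMap.le_opNorm _ y).trans (mul_le_mul_of_nonneg_right h (norm_nonneg _))

theorem itg_toTimeL2 [NormedSpace ℝ E] {t : ℝ} (ht : t ∈ Icc 0 T) (y : C(Icc 0 T, E)) :
    itg t (toTimeL2 y) = ∫ s in (0 : ℝ)..t, y (tproj T s) := by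
  rw [itg_eq ht]
  exact intervalIntegral.integral_congr_ae (ae_timeMeasure_restrict_uIoc ht (toTimeL2_coe y))

end TimeSpaces

section StateSpace

variable (T : ℝ) [hT : Fact (0 < T)]

/-- The space in which the quadruples `(y, ∂ₜy, ∂ₜₜy - ∂ₓₓy, v)` live. -/
abbrev Quad : Type := C(Icc 0 T, H10) × C(Icc 0 T, L2) × TimeL2 T L2 × TimeL2 T ℝ

variable {T}

/-- The state, its time derivative, the source and the control, as continuous linear maps. -/
def stateL : Quad T →L[ℝ] C(Icc 0 T, H10) := ContinuousLinearMap.fst ℝ _ _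
/-- The time derivative. -/
def velL : Quad T →L[ℝ] C(Icc 0 T, L2) :=
  (ContinuousLinearMap.fst ℝ _ _).comp (ContinuousLinearMap.snd ℝ _ _)
/-- The source. -/
def boxL : Quad T →L[ℝ] TimeL2 T L2 :=
  (ContinuousLinearMap.fst ℝ _ _).comp
    ((ContinuousLinearMap.snd ℝ _ _).comp (ContinuousLinearMap.snd ℝ _ _))
/-- The control. -/
def ctrlL : Quad T →L[ℝ] TimeL2 T ℝ :=
  (ContinuousLinearMap.snd ℝ _ _).comp
    ((ContinuousLinearMap.snd ℝ _ _).comp (ContinuousLinearMap.snd ℝ _ _))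

/-- `y ↦ y(t) - y(0)`. -/
def increment {E : Type} [NormedAddCommGroup E] [NormedSpace ℝ E] (t : Icc 0 T) :
    C(Icc 0 T, E) →L[ℝ] E :=
  ContinuousMap.evalCLM ℝ t - ContinuousMap.evalCLM ℝ (t0 T)

/-- The defect in `y(t) = y(0) + ∫₀ᵗ ∂ₜy`. -/
def defect₁ (t : Icc 0 T) : Quad T →L[ℝ] L2 :=
  H10.toL2L.comp ((increment t).comp stateL)
    - (itg (t : ℝ)).comp (toTimeL2.comp velL)

/-- The defect in the weak form of the wave equation, integrated in time. -/
def defect₂ (t : Icc 0 T) (z : H10) : Quad T →L[ℝ] ℝ :=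
  (innerSL ℝ z.toL2).comp
      ((increment t).comp velL
        - (itg (t : ℝ)).comp boxL)
    - z 1 • (itg (t : ℝ)).comp ctrlL
    + (innerSL ℝ z.dx).comp
        (H10.dxL.toContinuousLinearMap.comp ((itg (t : ℝ)).comp (toTimeL2.comp stateL)))

/-- The space `ℋ`, as a closed subspace of the space of quadruples. -/
def solSpace (T : ℝ) [Fact (0 < T)] : Submodule ℝ (Quad T) :=
  (⨅ t : Icc 0 T, (defect₁ t).ker) ⊓ ⨅ t : Icc 0 T, ⨅ z : H10, (defect₂ t z).ker

theorem isClosed_solSpace : IsClosed (solSpace T : Set (Quad T)) := by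
  simp only [solSpace, Submodule.coe_inf, Submodule.coe_iInf]
  refine IsClosed.inter (isClosed_iInter fun t => (defect₁ t).isClosed_ker)
    (isClosed_iInter fun t => isClosed_iInter fun z => (defect₂ t z).isClosed_ker)

theorem mem_solSpace_iff {g : Quad T} : g ∈ solSpace T ↔
    (∀ t : Icc 0 T, (g.1 t).toL2 = (g.1 (t0 T)).toL2 + itg (t : ℝ) (toTimeL2 g.2.1)) ∧
    ∀ (t : Icc 0 T) (z : H10),
      inner ℝ z.toL2 (g.2.1 t) = inner ℝ z.toL2 (g.2.1 (t0 T))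
        + inner ℝ z.toL2 (itg (t : ℝ) g.2.2.1) + z 1 * itg (t : ℝ) g.2.2.2
        - inner ℝ z.dx (itg (t : ℝ) (toTimeL2 g.1) : H10).dx := by
  simp only [solSpace, Submodule.mem_inf, Submodule.mem_iInf, LinearMap.mem_ker]
  refine and_congr (forall_congr' fun t => ?_) (forall_congr' fun t => forall_congr' fun z => ?_)
  · have : defect₁ t g = (g.1 t).toL2 - (g.1 (t0 T)).toL2 - itg (t : ℝ) (toTimeL2 g.2.1) := by
      change H10.toL2L (g.1 t - g.1 (t0 T)) - itg (t : ℝ) (toTimeL2 g.2.1) = _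
      rw [map_sub]; rfl
    change defect₁ t g = 0 ↔ _
    rw [this, sub_eq_zero, sub_eq_iff_eq_add']
  · have : defect₂ t z g = inner ℝ z.toL2 (g.2.1 t) - inner ℝ z.toL2 (g.2.1 (t0 T))
        - inner ℝ z.toL2 (itg (t : ℝ) g.2.2.1) - z 1 * itg (t : ℝ) g.2.2.2
        + inner ℝ z.dx (itg (t : ℝ) (toTimeL2 g.1) : H10).dx := by
      change inner ℝ z.toL2 (g.2.1 t - g.2.1 (t0 T) - itg (t : ℝ) g.2.2.1)
        - z 1 * itg (t : ℝ) g.2.2.2 + inner ℝ z.dx (itg (t : ℝ) (toTimeL2 g.1) : H10).dx = _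
      rw [inner_sub_right, inner_sub_right]
    change defect₂ t z g = 0 ↔ _
    rw [this]
    constructor <;> intro h <;> linarith

/-- The weak form with interval integrals. -/
theorem mem_solSpace_iff' {g : Quad T} : g ∈ solSpace T ↔
    (∀ t ∈ Icc 0 T, (g.1 (tproj T t)).toL2
      = (g.1 (t0 T)).toL2 + ∫ s in (0 : ℝ)..t, g.2.1 (tproj T s)) ∧
    ∀ t ∈ Icc 0 T, ∀ z : H10,
      inner ℝ z.toL2 (g.2.1 (tproj T t)) = inner ℝ z.toL2 (g.2.1 (t0 T))
        + ∫ s in (0 : ℝ)..t, (inner ℝ z.toL2 (g.2.2.1 s) + z 1 * g.2.2.2 s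
          - inner ℝ z.dx (g.1 (tproj T s)).dx) := by
  rw [mem_solSpace_iff]
  have key : ∀ t ∈ Icc 0 T, ∀ z : H10,
      ∫ s in (0 : ℝ)..t, (inner ℝ z.toL2 (g.2.2.1 s) + z 1 * g.2.2.2 s
          - inner ℝ z.dx (g.1 (tproj T s)).dx)
      = inner ℝ z.toL2 (itg t g.2.2.1) + z 1 * itg t g.2.2.2
        - inner ℝ z.dx (itg t (toTimeL2 g.1) : H10).dx := by
    intro t ht z
    have hF := TimeL2.intervalIntegrable g.2.2.1 ht
    have hv := TimeL2.intervalIntegrable g.2.2.2 ht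
    have hy : Continuous fun s => g.1 (tproj T s) := g.1.continuous.comp continuous_tproj
    have hyi : IntervalIntegrable (fun s => g.1 (tproj T s)) volume 0 t :=
      hy.intervalIntegrable _ _
    have i1 : ∫ s in (0 : ℝ)..t, inner ℝ z.toL2 (g.2.2.1 s) = inner ℝ z.toL2 (itg t g.2.2.1) := by
      rw [itg_eq ht]
      exact (innerSL ℝ z.toL2).intervalIntegral_comp_comm hF
    have i2 : ∫ s in (0 : ℝ)..t, z 1 * g.2.2.2 s = z 1 * itg t g.2.2.2 := by
      rw [itg_eq ht, intervalIntegral.integral_const_mul]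
    have i3 : ∫ s in (0 : ℝ)..t, inner ℝ z.dx (g.1 (tproj T s)).dx
        = inner ℝ z.dx (itg t (toTimeL2 g.1) : H10).dx := by
      rw [itg_toTimeL2 ht]
      exact ((innerSL ℝ z.dx).comp H10.dxL.toContinuousLinearMap).intervalIntegral_comp_comm hyi
    have h1 : IntervalIntegrable (fun s => inner ℝ z.toL2 (g.2.2.1 s)) volume 0 t := by
      rw [intervalIntegrable_iff] at hF ⊢
      exact (innerSL ℝ z.toL2).integrable_comp hF
    have h3 : IntervalIntegrable (fun s => inner ℝ z.dx (g.1 (tproj T s)).dx) volume 0 t := by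
      rw [intervalIntegrable_iff] at hyi ⊢
      exact ((innerSL ℝ z.dx).comp H10.dxL.toContinuousLinearMap).integrable_comp hyi
    rw [intervalIntegral.integral_sub (h1.add (hv.const_mul _)) h3,
      intervalIntegral.integral_add h1 (hv.const_mul _), i1, i2, i3]
  constructor
  · rintro ⟨h1, h2⟩
    refine ⟨fun t ht => ?_, fun t ht z => ?_⟩
    · rw [tproj_of_mem ht, h1 ⟨t, ht⟩, itg_toTimeL2 ht]
    · rw [tproj_of_mem ht, h2 ⟨t, ht⟩ z, key t ht z]; ring
  · rintro ⟨h1, h2⟩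
    refine ⟨fun t => ?_, fun t z => ?_⟩
    · have := h1 t t.2
      rwa [tproj_coe, ← itg_toTimeL2 t.2] at this
    · have := h2 t t.2 z
      rw [tproj_coe, key t t.2] at this
      rw [this]; ring

end StateSpace

section Spectral

/-- The square roots of the eigenvalues of `-∂ₓₓ` with the conditions `y(0) = 0`, `y'(1) = 0`. -/
def freq (n : ℤ) : ℝ := (n + 1 / 2) * Real.pi

/-- The functions `cos (ωₙ x)`. -/
def cosC (n : ℤ) : C(I, ℝ) := ⟨fun x => Real.cos (freq n * x), by fun_prop⟩

/-- The functions `sin (ωₙ x)`. -/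
def sinC (n : ℤ) : C(I, ℝ) := ⟨fun x => Real.sin (freq n * x), by fun_prop⟩

theorem cos_freq (n : ℤ) : Real.cos (freq n) = 0 := by
  rw [Real.cos_eq_zero_iff]
  exact ⟨n, by rw [freq]; ring⟩

theorem sin_freq_sq (n : ℤ) : Real.sin (freq n) ^ 2 = 1 := by
  rw [Real.sin_sq, cos_freq]; norm_num

theorem intervalIntegrable_symm {E : Type} [NormedAddCommGroup E] {h : ℝ → E}
    (h1 : IntervalIntegrable h volume 0 1) (h2 : IntervalIntegrable (fun s => h (-s)) volume 0 1) :
    IntervalIntegrable h volume (-1) 1 := by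
  have h3 : IntervalIntegrable h volume (-1) 0 := by
    have := (IntervalIntegrable.iff_comp_neg (f := fun s => h (-s)) (a := 0) (b := 1)).1 h2
    simpa using this.symm
  exact h3.trans h1

theorem integral_symm {E : Type} [NormedAddCommGroup E] [NormedSpace ℝ E] {h : ℝ → E}
    (h1 : IntervalIntegrable h volume 0 1) (h2 : IntervalIntegrable (fun s => h (-s)) volume 0 1) :
    ∫ s in (-1 : ℝ)..1, h s = ∫ s in (0 : ℝ)..1, (h s + h (-s)) := by
  have h3 : IntervalIntegrable h volume (-1) 0 := by
    have := (IntervalIntegrable.iff_comp_neg (f := fun s => h (-s)) (a := 0) (b := 1)).1 h2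
    simpa using this.symm
  rw [← intervalIntegral.integral_add_adjacent_intervals h3 h1, intervalIntegral.integral_add h1 h2,
    intervalIntegral.integral_comp_neg]
  simp [add_comm]

theorem intervalIntegrable_ofReal {h : ℝ → ℝ} {a b : ℝ} (hh : IntervalIntegrable h volume a b) :
    IntervalIntegrable (fun s => (h s : ℂ)) volume a b :=
  ⟨hh.1.ofReal, hh.2.ofReal⟩

theorem fourierCoeffOn_symm (u : ℝ → ℝ) (n : ℤ) :
    fourierCoeffOn (show (-1 : ℝ) < 1 by norm_num)
      (fun s => Complex.exp (-(Complex.I * Real.pi / 2 * s)) * u s) n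
    = (1 / 2 : ℝ) • ∫ s in (-1 : ℝ)..1, Complex.exp (-(Complex.I * freq n * s)) * u s := by
  rw [fourierCoeffOn_eq_integral]
  congr 1
  · norm_num
  · refine intervalIntegral.integral_congr fun s _ => ?_
    simp only [fourier_coe_apply, smul_eq_mul]
    rw [← mul_assoc, ← Complex.exp_add]
    congr 2
    simp only [freq]
    push_cast
    ring

theorem exp_neg_I_mul (w s : ℝ) : Complex.exp (-(Complex.I * w * s))
    = Real.cos (w * s) - Complex.I * Real.sin (w * s) := by
  rw [show -(Complex.I * w * s) = ((-(w * s) : ℝ) : ℂ) * Complex.I by push_cast; ring,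
    Complex.exp_mul_I, ← Complex.ofReal_cos, ← Complex.ofReal_sin, Real.cos_neg, Real.sin_neg]
  push_cast; ring

theorem norm_sq_sub_I_mul (a b : ℝ) : ‖(a : ℂ) - Complex.I * b‖ ^ 2 = a ^ 2 + b ^ 2 := by
  rw [Complex.sq_norm, Complex.normSq_apply]
  simp
  ring

theorem L2.intervalIntegrable_mul (p q : L2) :
    IntervalIntegrable (fun s => ext01 (fun x => p x) s * ext01 (fun x => q x) s) volume 0 1 := by
  have h : Integrable (fun x => p x * q x) := by
    have := (Lp.memLp p).integrable_mul (Lp.memLp q)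
    exact this
  exact integrableOn_ext01 h

theorem L2.measurable_ext01 (p : L2) : Measurable (ext01 fun x => p x) :=
  (Lp.stronglyMeasurable p).measurable.comp continuous_projIcc.measurable

/-- Parseval's identity for the mixed boundary conditions. -/
theorem hasSum_inner_sq (p q : L2) :
    HasSum (fun n : ℤ => (inner ℝ p (cL2 (cosC n))) ^ 2 + (inner ℝ q (cL2 (sinC n))) ^ 2)
      (‖p‖ ^ 2 + ‖q‖ ^ 2) := by
  set P := ext01 (fun x => p x) with hP
  set Q := ext01 (fun x => q x) with hQ
  have hPm : Measurable P := L2.measurable_ext01 p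
  have hQm : Measurable Q := L2.measurable_ext01 q
  have hPi : IntervalIntegrable P volume 0 1 := integrableOn_ext01 (L2.integrable p)
  have hQi : IntervalIntegrable Q volume 0 1 := integrableOn_ext01 (L2.integrable q)
  set u : ℝ → ℝ := fun s => if 0 < s then P s + Q s else P (-s) - Q (-s) with hu
  have hum : Measurable u :=
    Measurable.ite measurableSet_Ioi (hPm.add hQm)
      ((hPm.comp measurable_neg).sub (hQm.comp measurable_neg))
  have hup : ∀ s, s ∈ uIoc (0 : ℝ) 1 → u s = P s + Q s := by
    intro s hs
    rw [uIoc_of_le zero_le_one] at hs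
    simp [hu, hs.1]
  have hun : ∀ s, s ∈ uIoc (0 : ℝ) 1 → u (-s) = P s - Q s := by
    intro s hs
    rw [uIoc_of_le zero_le_one] at hs
    simp [hu, hs.1.le]
  have hPP := L2.intervalIntegrable_mul p p
  have hQQ := L2.intervalIntegrable_mul q q
  have hPQ := L2.intervalIntegrable_mul p q
  have hsq1 : IntervalIntegrable (fun s => u s ^ 2) volume 0 1 := by
    refine ((hPP.add hQQ).add (hPQ.const_mul 2)).congr fun s hs => ?_
    simp only [hup s hs]; ring
  have hsq2 : IntervalIntegrable (fun s => u (-s) ^ 2) volume 0 1 := by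
    refine ((hPP.add hQQ).sub (hPQ.const_mul 2)).congr fun s hs => ?_
    simp only [hun s hs]; ring
  have hu1 : IntervalIntegrable u volume 0 1 :=
    (hPi.add hQi).congr fun s hs => by simp only [hup s hs]
  have hu2 : IntervalIntegrable (fun s => u (-s)) volume 0 1 :=
    (hPi.sub hQi).congr fun s hs => by simp only [hun s hs]
  set f : ℝ → ℂ := fun s => Complex.exp (-(Complex.I * Real.pi / 2 * s)) * u s with hf
  have hfn : ∀ s, ‖f s‖ ^ 2 = u s ^ 2 := by
    intro s
    rw [hf]
    simp only [norm_mul, mul_pow]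
    rw [show -(Complex.I * Real.pi / 2 * s) = ((-(Real.pi / 2 * s) : ℝ) : ℂ) * Complex.I by
      push_cast; ring, Complex.norm_exp_ofReal_mul_I]
    simp
  have hfm : Measurable f := by
    refine Measurable.mul ?_ (Complex.measurable_ofReal.comp hum)
    exact Continuous.measurable (by fun_prop)
  have hsq : IntervalIntegrable (fun s => u s ^ 2) volume (-1) 1 :=
    intervalIntegrable_symm hsq1 hsq2
  have hL2 : MemLp f 2 (volume.restrict (Ioc (-1) 1)) := by
    rw [memLp_two_iff_integrable_sq_norm hfm.aestronglyMeasurable]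
    simp only [hfn]
    exact (intervalIntegrable_iff_integrableOn_Ioc_of_le (by norm_num)).1 hsq
  have key := hasSum_sq_fourierCoeffOn (show (-1 : ℝ) < 1 by norm_num) hL2
  convert key using 1
  · ext n
    rw [fourierCoeffOn_symm]
    have hc : Continuous fun s : ℝ => Complex.exp (-(Complex.I * freq n * s)) := by fun_prop
    have hc' : Continuous fun s : ℝ => Complex.exp (-(Complex.I * freq n * (-s : ℝ))) := by fun_prop
    rw [integral_symm ((intervalIntegrable_ofReal hu1).continuousOn_mul hc.continuousOn)
      ((intervalIntegrable_ofReal hu2).continuousOn_mul hc'.continuousOn)]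
    have h1 : ∫ s in (0 : ℝ)..1, (Complex.exp (-(Complex.I * freq n * s)) * u s
          + Complex.exp (-(Complex.I * freq n * (-s : ℝ))) * u (-s))
        = ∫ s in (0 : ℝ)..1, (((2 * (P s * Real.cos (freq n * s)) : ℝ) : ℂ)
            - Complex.I * ((2 * (Q s * Real.sin (freq n * s)) : ℝ) : ℂ)) := by
      refine intervalIntegral.integral_congr_ae (Eventually.of_forall fun s hs => ?_)
      rw [hup s hs, hun s hs, exp_neg_I_mul, exp_neg_I_mul]
      rw [mul_neg, Real.cos_neg, Real.sin_neg]
      push_cast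
      ring
    have hcosi : IntervalIntegrable (fun s => 2 * (P s * Real.cos (freq n * s))) volume 0 1 :=
      (hPi.mul_continuousOn (by fun_prop)).const_mul 2
    have hsini : IntervalIntegrable (fun s => 2 * (Q s * Real.sin (freq n * s))) volume 0 1 :=
      (hQi.mul_continuousOn (by fun_prop)).const_mul 2
    rw [h1, intervalIntegral.integral_sub (intervalIntegrable_ofReal hcosi) ((intervalIntegrable_ofReal hsini).const_mul _),
      intervalIntegral.integral_const_mul, intervalIntegral.integral_ofReal,
      intervalIntegral.integral_ofReal, intervalIntegral.integral_const_mul,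
      intervalIntegral.integral_const_mul, norm_smul, mul_pow, norm_sq_sub_I_mul]
    have e1 : inner ℝ p (cL2 (cosC n)) = ∫ s in (0 : ℝ)..1, P s * Real.cos (freq n * s) := by
      rw [inner_cL2_right]
      refine integral_unit_eq_of_eqOn (g := fun x => p x * cosC n x)
        (h := fun s => P s * Real.cos (freq n * s)) fun x => ?_
      rw [hP, ext01_coe]; rfl
    have e2 : inner ℝ q (cL2 (sinC n)) = ∫ s in (0 : ℝ)..1, Q s * Real.sin (freq n * s) := by
      rw [inner_cL2_right]
      refine integral_unit_eq_of_eqOn (g := fun x => q x * sinC n x)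
        (h := fun s => Q s * Real.sin (freq n * s)) fun x => ?_
      rw [hQ, ext01_coe]; rfl
    rw [e1, e2]
    norm_num
    ring
  · simp only [hfn]
    rw [integral_symm hsq1 hsq2]
    have h1 : ∫ s in (0 : ℝ)..1, (u s ^ 2 + u (-s) ^ 2)
        = ∫ s in (0 : ℝ)..1, (2 * (P s * P s) + 2 * (Q s * Q s)) := by
      refine intervalIntegral.integral_congr_ae (Eventually.of_forall fun s hs => ?_)
      rw [hup s hs, hun s hs]; ring
    rw [h1, intervalIntegral.integral_add (hPP.const_mul 2) (hQQ.const_mul 2),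
      intervalIntegral.integral_const_mul, intervalIntegral.integral_const_mul]
    have e : ∀ r : L2, ‖r‖ ^ 2
        = ∫ s in (0 : ℝ)..1, ext01 (fun x => r x) s * ext01 (fun x => r x) s := by
      intro r
      rw [← real_inner_self_eq_norm_sq, L2.inner_eq]
      refine integral_unit_eq_of_eqOn (g := fun x => r x * r x)
        (h := fun s => ext01 (fun x => r x) s * ext01 (fun x => r x) s) fun x => ?_
      rw [ext01_coe]
    rw [e p, e q, smul_eq_mul]
    norm_num
    ring

theorem sum_inner_sin_sq_le (q : L2) (S : Finset ℤ) :
    ∑ n ∈ S, (inner ℝ q (cL2 (sinC n))) ^ 2 ≤ ‖q‖ ^ 2 := by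
  have h := sum_le_hasSum S (fun n _ => by positivity) (hasSum_inner_sq 0 q)
  simpa using h

end Spectral

section Bessel

variable {T : ℝ}

/-- Bessel's inequality in time for the frequencies `ωₙ`. -/
theorem exists_bessel_time (T : ℝ) (hT : 0 < T) : ∃ L : ℝ, 0 < L ∧ ∀ (v : TimeL2 T ℝ),
    ∀ t ∈ Icc 0 T, ∀ S : Finset ℤ,
    ∑ n ∈ S, ((∫ s in (0 : ℝ)..t, Real.cos (freq n * s) * v s) ^ 2
      + (∫ s in (0 : ℝ)..t, Real.sin (freq n * s) * v s) ^ 2) ≤ L * ‖v‖ ^ 2 := by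
  obtain ⟨N, hN⟩ := exists_nat_gt T
  have hNpos : 0 < (N : ℝ) := hT.trans hN
  set L : ℝ := 2 * N with hL
  have hLpos : 0 < L := by positivity
  refine ⟨L, hLpos, fun v t ht S => ?_⟩
  set w : ℝ → ℝ := (Ioc 0 t).indicator (fun s => v s) with hw
  set f : ℝ → ℂ := fun s => Complex.exp (-(Complex.I * Real.pi / 2 * s)) * w s with hf
  have hwm : Measurable w := (Lp.stronglyMeasurable v).measurable.indicator measurableSet_Ioc
  have hfm : Measurable f := by
    refine Measurable.mul ?_ (Complex.measurable_ofReal.comp hwm)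
    exact Continuous.measurable (by fun_prop)
  have hfn : ∀ s, ‖f s‖ ^ 2 = w s ^ 2 := by
    intro s
    rw [hf]
    simp only [norm_mul, mul_pow]
    rw [show -(Complex.I * Real.pi / 2 * s) = ((-(Real.pi / 2 * s) : ℝ) : ℂ) * Complex.I by
      push_cast; ring, Complex.norm_exp_ofReal_mul_I]
    simp
  have hwsq : (fun s => w s ^ 2) = (Ioc 0 t).indicator (fun s => v s ^ 2) := by
    ext s
    by_cases hs : s ∈ Ioc 0 t <;> simp [hw, hs]
  have hv2 : IntegrableOn (fun s => v s ^ 2) (Ioc 0 t) := by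
    have := TimeL2.integrable_norm_sq v
    simp only [Real.norm_eq_abs, sq_abs] at this
    exact IntegrableOn.mono_set this fun s hs => ⟨hs.1.le, hs.2.trans ht.2⟩
  have hw2 : Integrable (fun s => w s ^ 2) := by
    rw [hwsq, integrable_indicator_iff measurableSet_Ioc]; exact hv2
  have hL2 : MemLp f 2 (volume.restrict (Ioc 0 L)) := by
    rw [memLp_two_iff_integrable_sq_norm hfm.aestronglyMeasurable]
    simp only [hfn]
    exact hw2.restrict
  have key := hasSum_sq_fourierCoeffOn hLpos hL2
  have hinj : Function.Injective fun n : ℤ => n * (N : ℤ) := by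
    intro a b hab
    have : (N : ℤ) ≠ 0 := by
      have : (0 : ℝ) < N := hNpos
      have : 0 < N := by exact_mod_cast this
      omega
    exact mul_right_cancel₀ this hab
  have h1 := sum_le_hasSum (S.map ⟨_, hinj⟩) (fun n _ => by positivity) key
  rw [Finset.sum_map] at h1
  have hInt : ∫ s in (0 : ℝ)..L, ‖f s‖ ^ 2 ≤ ‖v‖ ^ 2 := by
    simp only [hfn]
    rw [intervalIntegral.integral_of_le hLpos.le, TimeL2.norm_sq_eq]
    calc ∫ s in Ioc 0 L, w s ^ 2 ≤ ∫ s, w s ^ 2 :=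
          setIntegral_le_integral hw2 (Eventually.of_forall fun s => sq_nonneg _)
      _ = ∫ s in Ioc 0 t, v s ^ 2 := by rw [hwsq, integral_indicator measurableSet_Ioc]
      _ ≤ ∫ s in Icc 0 T, v s ^ 2 := by
          refine setIntegral_mono_set ?_ (Eventually.of_forall fun s => sq_nonneg _)
            (LE.le.eventuallyLE fun s hs => ⟨hs.1.le, hs.2.trans ht.2⟩)
          have := TimeL2.integrable_norm_sq v
          simp only [Real.norm_eq_abs, sq_abs] at this
          exact this
      _ = _ := by simp only [Real.norm_eq_abs, sq_abs]
  have hcoef : ∀ n : ℤ, ‖fourierCoeffOn hLpos f (n * (N : ℤ))‖ ^ 2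
      = (L⁻¹) ^ 2 * ((∫ s in (0 : ℝ)..t, Real.cos (freq n * s) * v s) ^ 2
      + (∫ s in (0 : ℝ)..t, Real.sin (freq n * s) * v s) ^ 2) := by
    intro n
    have hvi := TimeL2.intervalIntegrable v ht
    have e1 : ∫ s in (0 : ℝ)..L, fourier (-(n * (N : ℤ))) (s : AddCircle (L - 0)) • f s
        = ∫ s in (0 : ℝ)..t, Complex.exp (-(Complex.I * freq n * s)) * v s := by
      rw [intervalIntegral.integral_of_le hLpos.le, intervalIntegral.integral_of_le ht.1]
      have htL : t ≤ L := ht.2.trans (by linarith)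
      have e2 : ∀ s : ℝ, fourier (-(n * (N : ℤ))) (s : AddCircle (L - 0)) • f s
          = (Ioc 0 t).indicator (fun s => Complex.exp (-(Complex.I * freq n * s)) * v s) s := by
        intro s
        by_cases hs : s ∈ Ioc 0 t
        · rw [indicator_of_mem hs, hf]
          simp only [hw, indicator_of_mem hs]
          rw [fourier_coe_apply, smul_eq_mul, ← mul_assoc, ← Complex.exp_add]
          congr 2
          have : (N : ℂ) ≠ 0 := by exact_mod_cast hNpos.ne'
          simp only [freq, hL]
          push_cast
          field_simp
          ring
        · rw [indicator_of_notMem hs, hf]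
          simp [hw, indicator_of_notMem hs]
      simp only [e2]
      rw [integral_indicator measurableSet_Ioc, Measure.restrict_restrict measurableSet_Ioc,
        inter_eq_left.2 (Ioc_subset_Ioc le_rfl htL)]
    rw [fourierCoeffOn_eq_integral, e1]
    have e3 : ∀ s : ℝ, Complex.exp (-(Complex.I * freq n * s)) * v s
        = ((Real.cos (freq n * s) * v s : ℝ) : ℂ)
          - Complex.I * ((Real.sin (freq n * s) * v s : ℝ) : ℂ) := by
      intro s
      rw [exp_neg_I_mul]; push_cast; ring
    simp only [e3]
    have hc : IntervalIntegrable (fun s => Real.cos (freq n * s) * v s) volume 0 t :=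
      hvi.continuousOn_mul (by fun_prop)
    have hs : IntervalIntegrable (fun s => Real.sin (freq n * s) * v s) volume 0 t :=
      hvi.continuousOn_mul (by fun_prop)
    rw [intervalIntegral.integral_sub (intervalIntegrable_ofReal hc) ((intervalIntegrable_ofReal hs).const_mul _),
      intervalIntegral.integral_const_mul, intervalIntegral.integral_ofReal,
      intervalIntegral.integral_ofReal, norm_smul, mul_pow, norm_sq_sub_I_mul]
    simp
  simp only [Function.Embedding.coeFn_mk, hcoef, ← Finset.mul_sum, smul_eq_mul, sub_zero] at h1
  have h2 := h1.trans (mul_le_mul_of_nonneg_left hInt (inv_nonneg.2 hLpos.le))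
  have h3 := mul_le_mul_of_nonneg_left h2 (sq_nonneg L)
  have e1 : L ^ 2 * (L⁻¹ ^ 2 * ∑ n ∈ S, ((∫ s in (0 : ℝ)..t, Real.cos (freq n * s) * v s) ^ 2
      + (∫ s in (0 : ℝ)..t, Real.sin (freq n * s) * v s) ^ 2))
      = ∑ n ∈ S, ((∫ s in (0 : ℝ)..t, Real.cos (freq n * s) * v s) ^ 2
      + (∫ s in (0 : ℝ)..t, Real.sin (freq n * s) * v s) ^ 2) := by
    field_simp
  have e2 : L ^ 2 * (L⁻¹ * ‖v‖ ^ 2) = L * ‖v‖ ^ 2 := by field_simp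
  rwa [e1, e2] at h3

end Bessel

section Oscillator

theorem integral_mul_eq_of_primitive {t : ℝ} (ht : 0 ≤ t) {φ φ' k K : ℝ → ℝ}
    (hφ : ∀ s, HasDerivAt φ (φ' s) s) (hφ' : Continuous φ')
    (hk : IntervalIntegrable k volume 0 t)
    (hK : ∀ s ∈ Icc 0 t, K s = K 0 + ∫ r in (0 : ℝ)..s, k r) :
    ∫ s in (0 : ℝ)..t, φ s * k s = φ t * K t - φ 0 * K 0 - ∫ s in (0 : ℝ)..t, φ' s * K s := by
  rw [integral_mul_eq_sub_primitive hφ hφ' hk]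
  have h1 : ∫ s in (0 : ℝ)..t, φ' s * ∫ r in (0 : ℝ)..s, k r
      = (∫ s in (0 : ℝ)..t, φ' s * K s) - (φ t - φ 0) * K 0 := by
    have hInt : ∫ s in (0 : ℝ)..t, φ' s = φ t - φ 0 :=
      intervalIntegral.integral_eq_sub_of_hasDerivAt (fun s _ => hφ s) (hφ'.intervalIntegrable _ _)
    have hKc : ContinuousOn K (uIcc 0 t) := by
      rw [uIcc_of_le ht]
      have hc := intervalIntegral.continuousOn_primitive_interval (μ := volume) (a := 0) (b := t)
        (f := k) (by
          rw [uIcc_of_le ht]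
          exact (intervalIntegrable_iff_integrableOn_Icc_of_le ht).1 hk)
      rw [uIcc_of_le ht] at hc
      exact (continuousOn_const.add hc).congr fun s hs => hK s hs
    rw [← hInt, ← intervalIntegral.integral_mul_const, ← intervalIntegral.integral_sub]
    · refine intervalIntegral.integral_congr fun s hs => ?_
      rw [uIcc_of_le ht] at hs
      simp only [hK s hs]; ring
    · exact (hφ'.continuousOn.mul hKc).intervalIntegrable
    · exact (hφ'.mul continuous_const).intervalIntegrable _ _
  rw [h1, hK t ⟨ht, le_rfl⟩]
  ring

/-- Variation of constants for the oscillator `A' = ωB`, `B' = h - ωA`. -/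
theorem oscillator_eq {t ω : ℝ} (ht : 0 ≤ t) {A B h : ℝ → ℝ} (hAc : Continuous A)
    (hBc : Continuous B) (hh : IntervalIntegrable h volume 0 t)
    (hA : ∀ s ∈ Icc 0 t, A s = A 0 + ∫ r in (0 : ℝ)..s, ω * B r)
    (hB : ∀ s ∈ Icc 0 t, B s = B 0 + ∫ r in (0 : ℝ)..s, (h r - ω * A r)) :
    (Real.cos (ω * t) * B t + Real.sin (ω * t) * A t
      = B 0 + ∫ s in (0 : ℝ)..t, Real.cos (ω * s) * h s) ∧
    (Real.cos (ω * t) * A t - Real.sin (ω * t) * B t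
      = A 0 - ∫ s in (0 : ℝ)..t, Real.sin (ω * s) * h s) := by
  have hcos : ∀ s, HasDerivAt (fun s => Real.cos (ω * s)) (-Real.sin (ω * s) * ω) s := by
    intro s
    have := ((hasDerivAt_id s).const_mul ω).cos
    simpa using this
  have hsin : ∀ s, HasDerivAt (fun s => Real.sin (ω * s)) (Real.cos (ω * s) * ω) s := by
    intro s
    have := ((hasDerivAt_id s).const_mul ω).sin
    simpa using this
  have ck : IntervalIntegrable (fun r => h r - ω * A r) volume 0 t :=
    hh.sub ((continuous_const.mul hAc).intervalIntegrable _ _)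
  have cB : IntervalIntegrable (fun r => ω * B r) volume 0 t :=
    (continuous_const.mul hBc).intervalIntegrable _ _
  have e1 := integral_mul_eq_of_primitive ht hcos (by fun_prop) ck hB
  have e2 := integral_mul_eq_of_primitive ht hsin (by fun_prop) cB hA
  have e3 := integral_mul_eq_of_primitive ht hsin (by fun_prop) ck hB
  have e4 := integral_mul_eq_of_primitive ht hcos (by fun_prop) cB hA
  have hhc : IntervalIntegrable (fun s => Real.cos (ω * s) * h s) volume 0 t :=
    hh.continuousOn_mul (by fun_prop)
  have hhs : IntervalIntegrable (fun s => Real.sin (ω * s) * h s) volume 0 t :=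
    hh.continuousOn_mul (by fun_prop)
  have i : ∀ {g : ℝ → ℝ}, Continuous g → IntervalIntegrable g volume 0 t :=
    fun hg => hg.intervalIntegrable _ _
  have f1 : ∫ s in (0 : ℝ)..t, Real.cos (ω * s) * (h s - ω * A s)
      = (∫ s in (0 : ℝ)..t, Real.cos (ω * s) * h s) - ω * ∫ s in (0 : ℝ)..t, Real.cos (ω * s) * A s := by
    rw [← intervalIntegral.integral_const_mul, ← intervalIntegral.integral_sub hhc (i (by fun_prop))]
    congr 1; ext s; ring
  have f3 : ∫ s in (0 : ℝ)..t, Real.sin (ω * s) * (h s - ω * A s)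
      = (∫ s in (0 : ℝ)..t, Real.sin (ω * s) * h s) - ω * ∫ s in (0 : ℝ)..t, Real.sin (ω * s) * A s := by
    rw [← intervalIntegral.integral_const_mul, ← intervalIntegral.integral_sub hhs (i (by fun_prop))]
    congr 1; ext s; ring
  have g1 : ∀ X : ℝ → ℝ, ∫ s in (0 : ℝ)..t, -Real.sin (ω * s) * ω * X s
      = -(ω * ∫ s in (0 : ℝ)..t, Real.sin (ω * s) * X s) := by
    intro X
    rw [← intervalIntegral.integral_const_mul, ← intervalIntegral.integral_neg]
    congr 1; ext s; ring
  have g2 : ∀ X : ℝ → ℝ, ∫ s in (0 : ℝ)..t, Real.cos (ω * s) * ω * X s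
      = ω * ∫ s in (0 : ℝ)..t, Real.cos (ω * s) * X s := by
    intro X
    rw [← intervalIntegral.integral_const_mul]
    congr 1; ext s; ring
  have g3 : ∀ X Y : ℝ → ℝ, ∫ s in (0 : ℝ)..t, X s * (ω * Y s)
      = ω * ∫ s in (0 : ℝ)..t, X s * Y s := by
    intro X Y
    rw [← intervalIntegral.integral_const_mul]
    congr 1; ext s; ring
  rw [f1, g1] at e1
  rw [g3, g2] at e2
  rw [f3, g2] at e3
  rw [g3, g1] at e4
  simp only [mul_zero, Real.cos_zero, Real.sin_zero, one_mul, zero_mul] at e1 e2 e3 e4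
  constructor <;> linarith

end Oscillator

section Energy

variable {T : ℝ} [hT : Fact (0 < T)]

/-- The eigenfunction `sin (ωₙ x)` as an element of `H¹₍₀₎(Ω)`. -/
def sinH (n : ℤ) : H10 := H10.ofL2 (freq n • cL2 (cosC n))

theorem H10.ofL2_apply (g : L2) (x : I) : H10.ofL2 g x = ∫ s in Iic x, g s := rfl

theorem H10.ofL2_cL2_apply {h H : ℝ → ℝ} (c : C(I, ℝ)) (hc : ∀ x : I, c x = h x)
    (hcont : Continuous h) (hH : ∀ s, HasDerivAt H (h s) s) (x : I) :
    H10.ofL2 (cL2 c) x = H x - H 0 := by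
  rw [H10.ofL2_apply, integral_congr_ae (ae_restrict_of_ae (cL2_coe c)), setIntegral_Iic_eq,
    ← intervalIntegral.integral_eq_sub_of_hasDerivAt (fun s _ => hH s)
      (hcont.intervalIntegrable 0 x)]
  refine intervalIntegral.integral_congr fun s hs => ?_
  rw [uIcc_of_le x.2.1] at hs
  have hs' : s ∈ I := ⟨hs.1, hs.2.trans x.2.2⟩
  rw [ext01_of_mem _ hs', hc]

theorem sinH_dx (n : ℤ) : (sinH n).dx = freq n • cL2 (cosC n) := rfl

theorem sinH_apply (n : ℤ) (x : I) : sinH n x = Real.sin (freq n * x) := by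
  have h : sinH n = H10.ofL2 (cL2 (freq n • cosC n)) := by rw [sinH, map_smul]
  rw [h, H10.ofL2_cL2_apply (h := fun s => freq n * Real.cos (freq n * s))
    (H := fun s => Real.sin (freq n * s)) _ (fun x => rfl) (by fun_prop)]
  · simp
  · intro s
    have := ((hasDerivAt_id s).const_mul (freq n)).sin
    simpa [mul_comm] using this

theorem sinH_toL2 (n : ℤ) : (sinH n).toL2 = cL2 (sinC n) := by
  rw [H10.toL2_eq]
  congr 1
  ext x
  exact sinH_apply n x

theorem inner_dx_cos (n : ℤ) (z : H10) :
    inner ℝ z.dx (cL2 (cosC n)) = freq n * inner ℝ z.toL2 (cL2 (sinC n)) := by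
  rw [inner_cL2_right, H10.toL2_eq, inner_cL2_cL2]
  have h := H10.integral_mul_dx z (φ := fun s => Real.cos (freq n * s))
    (φ' := fun s => -(freq n * Real.sin (freq n * s))) (fun s => by
      have := ((hasDerivAt_id s).const_mul (freq n)).cos
      simpa [mul_comm] using this) (by fun_prop)
  simp only [mul_one, cos_freq, mul_zero, zero_sub] at h
  refine h.trans ?_
  rw [← integral_const_mul, ← integral_neg]
  refine integral_congr_ae (Eventually.of_forall fun x => ?_)
  change -(z x * -(freq n * Real.sin (freq n * x))) = freq n * (z x * Real.sin (freq n * x))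
  ring

/-- Elements of `L²(Ω)` are determined by their products with elements of `H¹₍₀₎(Ω)`. -/
theorem L2.eq_zero_of_inner_H10 {g : L2} (h : ∀ z : H10, inner ℝ g z.toL2 = 0) : g = 0 := by
  have h1 := hasSum_inner_sq 0 g
  have h2 : (fun n : ℤ => (inner ℝ (0 : L2) (cL2 (cosC n))) ^ 2 + (inner ℝ g (cL2 (sinC n))) ^ 2)
      = fun _ => 0 := by
    ext n
    rw [← sinH_toL2, h]; simp
  rw [h2] at h1
  have := h1.unique hasSum_zero
  simpa using this

theorem TimeL2.sq_integral_le (g : TimeL2 T ℝ) {t : ℝ} (ht : t ∈ Icc 0 T) {φ : ℝ → ℝ}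
    (hφ : ∀ s, |φ s| ≤ 1) : (∫ s in (0 : ℝ)..t, φ s * g s) ^ 2 ≤ T * ‖g‖ ^ 2 := by
  have h1 : |∫ s in (0 : ℝ)..t, φ s * g s| ≤ √T * ‖g‖ := by
    refine le_trans ?_ (TimeL2.integral_norm_le g)
    rw [← Real.norm_eq_abs]
    have hmono : IntegrableOn (fun s => ‖g s‖) (Ioc 0 t) :=
      IntegrableOn.mono_set (TimeL2.integrable g).norm fun s hs => ⟨hs.1.le, hs.2.trans ht.2⟩
    calc ‖∫ s in (0 : ℝ)..t, φ s * g s‖ ≤ ∫ s in (0 : ℝ)..t, ‖g s‖ := by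
          refine intervalIntegral.norm_integral_le_of_norm_le ht.1 ?_ ?_
          · refine Eventually.of_forall fun s _ => ?_
            rw [norm_mul]
            exact mul_le_of_le_one_left (norm_nonneg _) (hφ s)
          · exact (intervalIntegrable_iff_integrableOn_Ioc_of_le ht.1).2 hmono
      _ ≤ _ := by
          rw [intervalIntegral.integral_of_le ht.1]
          exact setIntegral_mono_set (TimeL2.integrable g).norm
            (Eventually.of_forall fun s => norm_nonneg _)
            (LE.le.eventuallyLE fun s hs => ⟨hs.1.le, hs.2.trans ht.2⟩)
  have h2 := pow_le_pow_left₀ (abs_nonneg _) h1 2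
  rwa [sq_abs, mul_pow, Real.sq_sqrt hT.out.le] at h2

/-- The source seen through the `n`-th eigenfunction. -/
def modeF (n : ℤ) (F : TimeL2 T L2) : TimeL2 T ℝ := (innerSL ℝ (cL2 (sinC n))).compLp F

theorem modeF_coe {T : ℝ} (n : ℤ) (F : TimeL2 T L2) :
    (modeF n F : ℝ → ℝ) =ᵐ[timeMeasure T] fun s => inner ℝ (cL2 (sinC n)) (F s) :=
  (innerSL ℝ (cL2 (sinC n))).coeFn_compLp F

theorem sum_modeF_sq_le {T : ℝ} (F : TimeL2 T L2) (S : Finset ℤ) :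
    ∑ n ∈ S, ‖modeF n F‖ ^ 2 ≤ ‖F‖ ^ 2 := by
  simp_rw [TimeL2.norm_sq_eq]
  rw [← integral_finsetSum _ fun n _ => TimeL2.integrable_norm_sq (modeF n F)]
  refine integral_mono_ae (integrable_finsetSum _ fun n _ => TimeL2.integrable_norm_sq _)
    (TimeL2.integrable_norm_sq F) ?_
  have h : ∀ᵐ s ∂(timeMeasure T), ∀ n : ℤ, modeF n F s = inner ℝ (cL2 (sinC n)) (F s) :=
    ae_all_iff.2 fun n => modeF_coe n F
  filter_upwards [h] with s hs
  simp only [hs, Real.norm_eq_abs, sq_abs]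
  refine le_trans (le_of_eq ?_) (sum_inner_sin_sq_le (F s) S)
  refine Finset.sum_congr rfl fun n _ => by rw [real_inner_comm]

theorem mode_eq {g : Quad T} (hg : g ∈ solSpace T) (n : ℤ) {t : ℝ} (ht : t ∈ Icc 0 T) :
    let A := fun s => inner ℝ (g.1 (tproj T s)).dx (cL2 (cosC n))
    let B := fun s => inner ℝ (g.2.1 (tproj T s)) (cL2 (sinC n))
    let h := fun s => modeF n g.2.2.1 s + Real.sin (freq n) * g.2.2.2 s
    A t ^ 2 + B t ^ 2 = (B 0 + ∫ s in (0 : ℝ)..t, Real.cos (freq n * s) * h s) ^ 2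
      + (A 0 - ∫ s in (0 : ℝ)..t, Real.sin (freq n * s) * h s) ^ 2 := by
  intro A B h
  obtain ⟨h1, h2⟩ := mem_solSpace_iff'.1 hg
  have hyc : Continuous fun s => g.1 (tproj T s) := g.1.continuous.comp continuous_tproj
  have htc : Continuous fun s => g.2.1 (tproj T s) := g.2.1.continuous.comp continuous_tproj
  have hAc : Continuous A := (H10.dxL.continuous.comp hyc).inner continuous_const
  have hBc : Continuous B := htc.inner continuous_const
  have hh : ∀ r ∈ Icc 0 T, IntervalIntegrable h volume 0 r := fun r hr =>
    (TimeL2.intervalIntegrable _ hr).add ((TimeL2.intervalIntegrable _ hr).const_mul _)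
  have h0 : tproj T 0 = t0 T := tproj_of_mem ⟨le_rfl, hT.out.le⟩
  have hsub : ∀ s ∈ Icc 0 t, s ∈ Icc 0 T := fun s hs => ⟨hs.1, hs.2.trans ht.2⟩
  have hA : ∀ s ∈ Icc 0 t, A s = A 0 + ∫ r in (0 : ℝ)..s, freq n * B r := by
    intro s hs
    simp only [A]
    rw [inner_dx_cos, inner_dx_cos, h1 s (hsub s hs), h0, inner_add_left, mul_add,
      intervalIntegral.integral_const_mul]
    congr 2
    rw [real_inner_comm]
    refine Eq.trans ((innerSL ℝ (cL2 (sinC n))).intervalIntegral_comp_comm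
      (htc.intervalIntegrable 0 s)).symm ?_
    refine intervalIntegral.integral_congr fun r _ => ?_
    exact real_inner_comm (g.2.1 (tproj T r)) (cL2 (sinC n))
  have hB : ∀ s ∈ Icc 0 t, B s = B 0 + ∫ r in (0 : ℝ)..s, (h r - freq n * A r) := by
    intro s hs
    have h3 := h2 s (hsub s hs) (sinH n)
    simp only [B]
    rw [real_inner_comm, ← sinH_toL2, h3, h0, sinH_toL2, real_inner_comm]
    congr 1
    refine intervalIntegral.integral_congr_ae ?_
    filter_upwards [ae_timeMeasure_restrict_uIoc (hsub s hs) (modeF_coe n g.2.2.1)] with r hr hr'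
    simp only [h, A]
    rw [hr hr', sinH_dx, inner_smul_left, sinH_apply, real_inner_comm (cL2 (cosC n))]
    simp
  obtain ⟨e1, e2⟩ := oscillator_eq ht.1 hAc hBc (hh t ht) hA hB
  rw [← e1, ← e2]
  nlinarith [Real.sin_sq_add_cos_sq (freq n * t)]

/-- Energy estimate, with the hidden regularity of the control. -/
theorem exists_energy_bound (T : ℝ) [hT : Fact (0 < T)] : ∃ C : ℝ, 0 < C ∧ ∀ g ∈ solSpace T,
    ‖g.1‖ ≤ C * (‖g.1 (t0 T)‖ + ‖g.2.1 (t0 T)‖ + ‖g.2.2.1‖ + ‖g.2.2.2‖) ∧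
    ‖g.2.1‖ ≤ C * (‖g.1 (t0 T)‖ + ‖g.2.1 (t0 T)‖ + ‖g.2.2.1‖ + ‖g.2.2.2‖) := by
  obtain ⟨L, hL, hbes⟩ := exists_bessel_time T hT.out
  have hTpos := hT.out
  refine ⟨√(3 * (1 + 2 * T + L)), by positivity, fun g hg => ?_⟩
  set R := ‖g.1 (t0 T)‖ + ‖g.2.1 (t0 T)‖ + ‖g.2.2.1‖ + ‖g.2.2.2‖ with hR
  have hR0 : 0 ≤ R := by positivity
  have key : ∀ t : Icc 0 T, ‖g.1 t‖ ^ 2 + ‖g.2.1 t‖ ^ 2 ≤ 3 * (1 + 2 * T + L) * R ^ 2 := by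
    intro t
    have hs := hasSum_inner_sq (g.1 t).dx (g.2.1 t)
    refine hasSum_le_of_sum_le hs fun S => ?_
    have hs0 := sum_le_hasSum S (fun n _ => by positivity)
      (hasSum_inner_sq (g.1 (t0 T)).dx (g.2.1 (t0 T)))
    have hv := hbes g.2.2.2 t t.2 S
    have hF := sum_modeF_sq_le g.2.2.1 S
    have h0 : tproj T 0 = t0 T := tproj_of_mem ⟨le_rfl, hT.out.le⟩
    have hmode : ∀ n : ℤ, (inner ℝ (g.1 t).dx (cL2 (cosC n))) ^ 2
        + (inner ℝ (g.2.1 t) (cL2 (sinC n))) ^ 2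
        ≤ 3 * ((inner ℝ (g.1 (t0 T)).dx (cL2 (cosC n))) ^ 2
          + (inner ℝ (g.2.1 (t0 T)) (cL2 (sinC n))) ^ 2) + 3 * (2 * T * ‖modeF n g.2.2.1‖ ^ 2)
          + 3 * ((∫ s in (0 : ℝ)..t, Real.cos (freq n * s) * g.2.2.2 s) ^ 2
            + (∫ s in (0 : ℝ)..t, Real.sin (freq n * s) * g.2.2.2 s) ^ 2) := by
      intro n
      have h1 := mode_eq hg n t.2
      simp only [tproj_coe, h0] at h1
      rw [h1]
      have hi1 := TimeL2.intervalIntegrable (modeF n g.2.2.1) t.2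
      have hi2 := TimeL2.intervalIntegrable g.2.2.2 t.2
      have split : ∀ φ : ℝ → ℝ, Continuous φ →
          ∫ s in (0 : ℝ)..t, φ s * (modeF n g.2.2.1 s + Real.sin (freq n) * g.2.2.2 s)
          = (∫ s in (0 : ℝ)..t, φ s * modeF n g.2.2.1 s)
            + Real.sin (freq n) * ∫ s in (0 : ℝ)..t, φ s * g.2.2.2 s := by
        intro φ hφ
        rw [← intervalIntegral.integral_const_mul, ← intervalIntegral.integral_add
          (hi1.continuousOn_mul hφ.continuousOn) ((hi2.continuousOn_mul hφ.continuousOn).const_mul _)]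
        congr 1; ext s; ring
      rw [split _ (by fun_prop), split _ (by fun_prop)]
      have c1 := TimeL2.sq_integral_le (modeF n g.2.2.1) t.2
        (φ := fun s => Real.cos (freq n * s)) fun s => Real.abs_cos_le_one _
      have c2 := TimeL2.sq_integral_le (modeF n g.2.2.1) t.2
        (φ := fun s => Real.sin (freq n * s)) fun s => Real.abs_sin_le_one _
      have hsn := sin_freq_sq n
      have sq3 : ∀ x y z : ℝ, (x + (y + z)) ^ 2 ≤ 3 * (x ^ 2 + y ^ 2 + z ^ 2) := fun x y z => by
        nlinarith [sq_nonneg (x - y), sq_nonneg (y - z), sq_nonneg (x - z)]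
      have s1 := sq3 (inner ℝ (g.2.1 (t0 T)) (cL2 (sinC n)))
        (∫ s in (0 : ℝ)..t, Real.cos (freq n * s) * modeF n g.2.2.1 s)
        (Real.sin (freq n) * ∫ s in (0 : ℝ)..t, Real.cos (freq n * s) * g.2.2.2 s)
      have s2 := sq3 (inner ℝ (g.1 (t0 T)).dx (cL2 (cosC n)))
        (-∫ s in (0 : ℝ)..t, Real.sin (freq n * s) * modeF n g.2.2.1 s)
        (-(Real.sin (freq n) * ∫ s in (0 : ℝ)..t, Real.sin (freq n * s) * g.2.2.2 s))
      rw [mul_pow, hsn, one_mul] at s1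
      rw [neg_sq, neg_sq, mul_pow, hsn, one_mul] at s2
      rw [← neg_add, ← sub_eq_add_neg] at s2
      linarith
    refine (Finset.sum_le_sum fun n _ => hmode n).trans ?_
    rw [Finset.sum_add_distrib, Finset.sum_add_distrib, ← Finset.mul_sum, ← Finset.mul_sum,
      ← Finset.mul_sum, ← Finset.mul_sum]
    have a1 : ‖g.1 (t0 T)‖ ^ 2 + ‖g.2.1 (t0 T)‖ ^ 2 ≤ R ^ 2 := by
      rw [hR]
      nlinarith [norm_nonneg (g.1 (t0 T)), norm_nonneg (g.2.1 (t0 T)), norm_nonneg g.2.2.1,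
        norm_nonneg g.2.2.2, mul_nonneg (norm_nonneg (g.1 (t0 T))) (norm_nonneg (g.2.1 (t0 T))),
        mul_nonneg (add_nonneg (norm_nonneg (g.1 (t0 T))) (norm_nonneg (g.2.1 (t0 T))))
          (add_nonneg (norm_nonneg g.2.2.1) (norm_nonneg g.2.2.2))]
    have a2 : ‖g.2.2.1‖ ^ 2 ≤ R ^ 2 := by
      refine pow_le_pow_left₀ (norm_nonneg _) ?_ 2
      rw [hR]
      linarith [norm_nonneg (g.1 (t0 T)), norm_nonneg (g.2.1 (t0 T)), norm_nonneg g.2.2.2]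
    have a3 : ‖g.2.2.2‖ ^ 2 ≤ R ^ 2 := by
      refine pow_le_pow_left₀ (norm_nonneg _) ?_ 2
      rw [hR]
      linarith [norm_nonneg (g.1 (t0 T)), norm_nonneg (g.2.1 (t0 T)), norm_nonneg g.2.2.1]
    have b1 : ‖(g.1 (t0 T)).dx‖ = ‖g.1 (t0 T)‖ := rfl
    rw [b1] at hs0
    have b2 := mul_le_mul_of_nonneg_left (hF.trans a2) (show 0 ≤ 2 * T by positivity)
    have b3 := hv.trans (mul_le_mul_of_nonneg_left a3 hL.le)
    have b4 := hs0.trans a1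
    linarith
  have fin : ∀ a : ℝ, 0 ≤ a → a ^ 2 ≤ 3 * (1 + 2 * T + L) * R ^ 2 →
      a ≤ √(3 * (1 + 2 * T + L)) * R := by
    intro a ha h
    rw [← Real.sqrt_sq hR0, ← Real.sqrt_mul (by positivity)]
    exact Real.le_sqrt_of_sq_le h
  constructor
  · refine (ContinuousMap.norm_le _ (by positivity)).2 fun t => fin _ (norm_nonneg _) ?_
    nlinarith [key t, sq_nonneg ‖g.2.1 t‖]
  · refine (ContinuousMap.norm_le _ (by positivity)).2 fun t => fin _ (norm_nonneg _) ?_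
    nlinarith [key t, sq_nonneg ‖g.1 t‖]

end Energy

section Transport

/-- Leibniz' rule for `x ↦ ∫₀ˣ m(ξ,x) dξ`. -/
theorem hasDerivAt_integral_diag {m m' : ℝ → ℝ → ℝ} (hm : Continuous m.uncurry)
    (hm' : Continuous m'.uncurry) (hd : ∀ ξ x, HasDerivAt (m ξ) (m' ξ x) x) (x : ℝ) :
    HasDerivAt (fun x => ∫ ξ in (0 : ℝ)..x, m ξ x) (m x x + ∫ ξ in (0 : ℝ)..x, m' ξ x) x := by
  set f : ℝ → ℝ → ℝ := fun a b => ∫ ξ in (0 : ℝ)..a, m ξ b with hf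
  have hmb : ∀ b, Continuous fun ξ => m ξ b := fun b => hm.comp (by fun_prop : Continuous fun ξ => (ξ, b))
  have hmb' : ∀ b, Continuous fun ξ => m' ξ b :=
    fun b => hm'.comp (by fun_prop : Continuous fun ξ => (ξ, b))
  have d1 : ∀ a b, HasDerivAt (fun a => f a b) (m a b) a := fun a b =>
    (hmb b).integral_hasStrictDerivAt 0 a |>.hasDerivAt
  have d2 : ∀ a b, HasDerivAt (fun b => f a b) (∫ ξ in (0 : ℝ)..a, m' ξ b) b := by
    intro a b
    obtain ⟨C, hC⟩ := (isCompact_uIcc.prod (isCompact_closedBall b 1)).exists_bound_of_continuousOn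
      (f := m'.uncurry) (s := uIcc 0 a ×ˢ Metric.closedBall b 1) hm'.continuousOn
    refine (intervalIntegral.hasDerivAt_integral_of_dominated_loc_of_deriv_le (F := fun b ξ => m ξ b)
      (F' := fun b ξ => m' ξ b) (bound := fun _ => C) (Metric.closedBall_mem_nhds b one_pos)
      (Eventually.of_forall fun b => (hmb b).aestronglyMeasurable) ((hmb b).intervalIntegrable _ _)
      (hmb' b).aestronglyMeasurable ?_ (continuous_const.intervalIntegrable _ _) ?_).2
    · exact Eventually.of_forall fun ξ hξ b' hb' => hC (ξ, b') ⟨uIoc_subset_uIcc hξ, hb'⟩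
    · exact Eventually.of_forall fun ξ _ b' _ => hd ξ b'
  have c2 : Continuous fun p : ℝ × ℝ => ∫ ξ in (0 : ℝ)..p.1, m' ξ p.2 := by
    refine intervalIntegral.continuous_parametric_intervalIntegral_of_continuous
      (f := fun (p : ℝ × ℝ) ξ => m' ξ p.2) ?_ continuous_fst
    exact hm'.comp (by fun_prop : Continuous fun q : (ℝ × ℝ) × ℝ => (q.2, q.1.2))
  have key := hasStrictFDerivAt_uncurry_coprod (𝕜 := ℝ) (u := (x, x)) (f := f)
    (f₁ := fun a b => ContinuousLinearMap.toSpanSingleton ℝ (m a b))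
    (f₂ := fun a b => ContinuousLinearMap.toSpanSingleton ℝ (∫ ξ in (0 : ℝ)..a, m' ξ b))
    (Eventually.of_forall fun p => (d1 p.1 p.2).hasFDerivAt)
    (Eventually.of_forall fun p => (d2 p.1 p.2).hasFDerivAt)
    (Continuous.continuousAt ((ContinuousLinearMap.toSpanSingletonCLE (𝕜 := ℝ) (E := ℝ)).continuous.comp hm))
    (Continuous.continuousAt ((ContinuousLinearMap.toSpanSingletonCLE (𝕜 := ℝ) (E := ℝ)).continuous.comp c2))
  have hx : HasDerivAt (fun x : ℝ => (x, x)) (1, 1) x := (hasDerivAt_id x).prodMk (hasDerivAt_id x)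
  have := HasFDerivAt.comp_hasDerivAt (l := fun p : ℝ × ℝ => f p.1 p.2) (f := fun x : ℝ => (x, x)) x
    key.hasFDerivAt hx
  refine this.congr_deriv ?_
  simp [Function.HasUncurry.uncurry]

theorem hasDerivAt_integral_comp_add {h : ℝ → ℝ} (hh : Continuous h) (t x : ℝ) :
    HasDerivAt (fun x => ∫ s in (0 : ℝ)..t, h (s + x)) (h (t + x) - h x) x := by
  have e : (fun x => ∫ s in (0 : ℝ)..t, h (s + x))
      = fun x => (∫ r in (0 : ℝ)..(t + x), h r) - ∫ r in (0 : ℝ)..x, h r := by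
    ext x
    rw [intervalIntegral.integral_comp_add_right, zero_add,
      intervalIntegral.integral_interval_sub_left (hh.intervalIntegrable _ _)
        (hh.intervalIntegrable _ _)]
  rw [e]
  have h1 : HasDerivAt (fun x => ∫ r in (0 : ℝ)..x, h r) (h x) x :=
    (hh.integral_hasStrictDerivAt 0 x).hasDerivAt
  have h2 : HasDerivAt (fun x => ∫ r in (0 : ℝ)..x, h r) (h (t + x)) (t + x) :=
    (hh.integral_hasStrictDerivAt 0 (t + x)).hasDerivAt
  exact (h2.comp_const_add t x).sub h1

/-- The left-moving Riemann invariant of the explicit solution. -/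
def waveA (ψ : ℝ → ℝ) (G : ℝ → ℝ → ℝ) (x t : ℝ) : ℝ :=
  ψ (t + x) - 1 / 2 * ∫ ξ in (0 : ℝ)..x, G ξ (t + x - ξ)

/-- The right-moving Riemann invariant of the explicit solution. -/
def waveB (ψ : ℝ → ℝ) (G : ℝ → ℝ → ℝ) (x t : ℝ) : ℝ :=
  ψ (t - x) - 1 / 2 * ∫ ξ in (0 : ℝ)..x, G ξ (t - x + ξ)

variable {ψ : ℝ → ℝ} {G : ℝ → ℝ → ℝ}

theorem continuous_waveA (hψ : Continuous ψ) (hG : Continuous G.uncurry) :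
    Continuous (waveA ψ G).uncurry := by
  refine Continuous.sub (hψ.comp (by fun_prop)) (continuous_const.mul ?_)
  refine intervalIntegral.continuous_parametric_intervalIntegral_of_continuous
    (f := fun (p : ℝ × ℝ) ξ => G ξ (p.2 + p.1 - ξ)) ?_ continuous_fst
  exact hG.comp (by fun_prop : Continuous fun q : (ℝ × ℝ) × ℝ => (q.2, q.1.2 + q.1.1 - q.2))

theorem waveB_eq_waveA (ψ : ℝ → ℝ) (G : ℝ → ℝ → ℝ) (x t : ℝ) :
    waveB ψ G x t = waveA (fun r => ψ (-r)) (fun ξ τ => G ξ (-τ)) x (-t) := by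
  simp only [waveA, waveB]
  congr 3
  · ring
  · ext ξ; congr 1; ring

theorem continuous_waveB (hψ : Continuous ψ) (hG : Continuous G.uncurry) :
    Continuous (waveB ψ G).uncurry := by
  have h := continuous_waveA (ψ := fun r => ψ (-r)) (G := fun ξ τ => G ξ (-τ))
    (hψ.comp continuous_neg) (hG.comp (by fun_prop : Continuous fun p : ℝ × ℝ => (p.1, -p.2)))
  have e : (waveB ψ G).uncurry
      = (waveA (fun r => ψ (-r)) (fun ξ τ => G ξ (-τ))).uncurry ∘ fun p : ℝ × ℝ => (p.1, -p.2) := by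
    ext p
    exact waveB_eq_waveA ψ G p.1 p.2
  rw [e]
  exact h.comp (by fun_prop)

/-- The transport equation for `waveA`, integrated in time. -/
theorem hasDerivAt_integral_waveA (hψ : Continuous ψ) (hG : Continuous G.uncurry) (t x : ℝ) :
    HasDerivAt (fun x => ∫ s in (0 : ℝ)..t, waveA ψ G x s)
      (waveA ψ G x t - waveA ψ G x 0 - 1 / 2 * ∫ s in (0 : ℝ)..t, G x s) x := by
  set m : ℝ → ℝ → ℝ := fun ξ x => ∫ s in (0 : ℝ)..t, G ξ (s + x - ξ) with hm
  set m' : ℝ → ℝ → ℝ := fun ξ x => G ξ (t + x - ξ) - G ξ (x - ξ) with hm'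
  have cm : Continuous m.uncurry := by
    refine intervalIntegral.continuous_parametric_intervalIntegral_of_continuous'
      (f := fun (p : ℝ × ℝ) s => G p.1 (s + p.2 - p.1)) ?_ 0 t
    exact hG.comp (by fun_prop : Continuous fun q : (ℝ × ℝ) × ℝ => (q.1.1, q.2 + q.1.2 - q.1.1))
  have cm' : Continuous m'.uncurry :=
    (hG.comp (by fun_prop : Continuous fun p : ℝ × ℝ => (p.1, t + p.2 - p.1))).sub
      (hG.comp (by fun_prop : Continuous fun p : ℝ × ℝ => (p.1, p.2 - p.1)))
  have dm : ∀ ξ x, HasDerivAt (m ξ) (m' ξ x) x := by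
    intro ξ x
    have hc : Continuous fun r => G ξ (r - ξ) :=
      hG.comp (by fun_prop : Continuous fun r => (ξ, r - ξ))
    exact hasDerivAt_integral_comp_add hc t x
  have e : (fun x => ∫ s in (0 : ℝ)..t, waveA ψ G x s)
      = fun x => (∫ s in (0 : ℝ)..t, ψ (s + x)) - 1 / 2 * ∫ ξ in (0 : ℝ)..x, m ξ x := by
    ext x
    simp only [waveA]
    have c1 : Continuous fun s => ψ (s + x) := hψ.comp (by fun_prop)
    have c2 : Continuous fun s => ∫ ξ in (0 : ℝ)..x, G ξ (s + x - ξ) := by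
      refine intervalIntegral.continuous_parametric_intervalIntegral_of_continuous'
        (f := fun (s : ℝ) ξ => G ξ (s + x - ξ)) ?_ 0 x
      exact hG.comp (by fun_prop : Continuous fun q : ℝ × ℝ => (q.2, q.1 + x - q.2))
    rw [intervalIntegral.integral_sub (c1.intervalIntegrable _ _)
      ((c2.intervalIntegrable _ _).const_mul _), intervalIntegral.integral_const_mul]
    congr 2
    refine intervalIntegral_intervalIntegral_swap (F := fun s ξ => G ξ (s + x - ξ)) ?_
    have c3 : Continuous (Function.uncurry fun s ξ => G ξ (s + x - ξ)) :=
      hG.comp (by fun_prop : Continuous fun q : ℝ × ℝ => (q.2, q.1 + x - q.2))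
    exact (c3.continuousOn.integrableOn_compact (isCompact_uIcc.prod isCompact_uIcc)).mono_set
      (prod_mono uIoc_subset_uIcc uIoc_subset_uIcc)
  rw [e]
  have h1 := hasDerivAt_integral_comp_add hψ t x
  have h2 := (hasDerivAt_integral_diag cm cm' dm x).const_mul (1 / 2)
  refine (h1.sub h2).congr_deriv ?_
  simp only [waveA, hm, hm', zero_add, add_sub_cancel_right]
  rw [intervalIntegral.integral_sub]
  · ring
  · exact Continuous.intervalIntegrable
      (hG.comp (by fun_prop : Continuous fun ξ : ℝ => (ξ, t + x - ξ))) _ _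
  · exact Continuous.intervalIntegrable
      (hG.comp (by fun_prop : Continuous fun ξ : ℝ => (ξ, x - ξ))) _ _

/-- The transport equation for `waveB`, integrated in time. -/
theorem hasDerivAt_integral_waveB (hψ : Continuous ψ) (hG : Continuous G.uncurry) (t x : ℝ) :
    HasDerivAt (fun x => ∫ s in (0 : ℝ)..t, waveB ψ G x s)
      (-(waveB ψ G x t - waveB ψ G x 0) - 1 / 2 * ∫ s in (0 : ℝ)..t, G x s) x := by
  have h := hasDerivAt_integral_waveA (ψ := fun r => ψ (-r)) (G := fun ξ τ => G ξ (-τ))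
    (hψ.comp continuous_neg) (hG.comp (by fun_prop : Continuous fun p : ℝ × ℝ => (p.1, -p.2)))
    (-t) x
  have e : (fun x => ∫ s in (0 : ℝ)..t, waveB ψ G x s)
      = fun x => -∫ s in (0 : ℝ)..(-t), waveA (fun r => ψ (-r)) (fun ξ τ => G ξ (-τ)) x s := by
    ext x
    simp only [waveB_eq_waveA]
    rw [intervalIntegral.integral_comp_neg
      (f := fun s => waveA (fun r => ψ (-r)) (fun ξ τ => G ξ (-τ)) x s), neg_zero,
      intervalIntegral.integral_symm]
  rw [e]
  refine h.neg.congr_deriv ?_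
  rw [waveB_eq_waveA, waveB_eq_waveA, neg_zero, intervalIntegral.integral_comp_neg (f := fun s => G x s),
    neg_neg, neg_zero, intervalIntegral.integral_symm 0 t]
  ring

end Transport

section Explicit

variable {T : ℝ} [hT : Fact (0 < T)] {ψ : ℝ → ℝ} {G : ℝ → ℝ → ℝ}

/-- The slice at time `t` of a function of `(x,t)`. -/
def slice (h : ℝ → ℝ → ℝ) (hh : Continuous h.uncurry) (t : ℝ) : C(I, ℝ) :=
  ⟨fun x => h x t, hh.comp (by fun_prop : Continuous fun x : I => ((x : ℝ), t))⟩

theorem continuous_slice {h : ℝ → ℝ → ℝ} (hh : Continuous h.uncurry) : Continuous (slice h hh) := by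
  have : Continuous (Function.uncurry fun (t : ℝ) (x : I) => h x t) :=
    hh.comp (by fun_prop : Continuous fun p : ℝ × I => ((p.2 : ℝ), p.1))
  exact (ContinuousMap.curry ⟨_, this⟩).continuous

theorem intervalIntegral_slice {h : ℝ → ℝ → ℝ} (hh : Continuous h.uncurry) (t : ℝ) (x : I) :
    (∫ s in (0 : ℝ)..t, slice h hh s) x = ∫ s in (0 : ℝ)..t, h x s :=
  ((ContinuousMap.evalCLM ℝ x).intervalIntegral_comp_comm
    ((continuous_slice hh).intervalIntegrable 0 t)).symm

theorem integral_inner_slice {h : ℝ → ℝ → ℝ} (hh : Continuous h.uncurry) (t : ℝ) (w : L2) :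
    ∫ s in (0 : ℝ)..t, inner ℝ w (cL2 (slice h hh s))
      = ∫ x, w x * ∫ s in (0 : ℝ)..t, h x s := by
  have h1 := ((innerSL ℝ w).comp cL2).intervalIntegral_comp_comm
    ((continuous_slice hh).intervalIntegrable (μ := volume) 0 t)
  refine h1.trans ?_
  change inner ℝ w (cL2 _) = _
  rw [inner_cL2_right]
  simp only [intervalIntegral_slice]

theorem H10.ofL2_eq : H10.ofL2 = H10.equivL2.symm := by
  ext g
  exact (H10.equivL2.symm_apply_apply (H10.ofL2 g)).symm

theorem continuous_ofL2 : Continuous H10.ofL2 := by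
  rw [H10.ofL2_eq]; exact H10.equivL2.symm.continuous

/-- The quadruple of the solution with sidewise data `ψ` and source `G`. -/
def explicitQuad (hψ : Continuous ψ) (hG : Continuous G.uncurry) : Quad T :=
  (⟨fun t => H10.ofL2 (cL2 (slice (fun x t => waveA ψ G x t + waveB ψ G x t)
      ((continuous_waveA hψ hG).add (continuous_waveB hψ hG)) t)),
      continuous_ofL2.comp (cL2.continuous.comp
        ((continuous_slice _).comp continuous_subtype_val))⟩,
    ⟨fun t => cL2 (slice (fun x t => waveA ψ G x t - waveB ψ G x t)
      ((continuous_waveA hψ hG).sub (continuous_waveB hψ hG)) t),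
      cL2.continuous.comp ((continuous_slice _).comp continuous_subtype_val)⟩,
    toTimeL2 ⟨fun t => cL2 (slice G hG t),
      cL2.continuous.comp ((continuous_slice _).comp continuous_subtype_val)⟩,
    toTimeL2 ⟨fun t => waveA ψ G 1 t + waveB ψ G 1 t,
      ((continuous_waveA hψ hG).comp (by fun_prop : Continuous fun t : Icc 0 T => ((1 : ℝ), (t : ℝ)))).add
      ((continuous_waveB hψ hG).comp
        (by fun_prop : Continuous fun t : Icc 0 T => ((1 : ℝ), (t : ℝ))))⟩)

theorem integral_waveX (hψ : Continuous ψ) (hG : Continuous G.uncurry) (t x : ℝ) :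
    ∫ ξ in (0 : ℝ)..x, (waveA ψ G ξ t + waveB ψ G ξ t)
      = (∫ ξ in (0 : ℝ)..x, (waveA ψ G ξ 0 + waveB ψ G ξ 0))
        + ∫ s in (0 : ℝ)..t, (waveA ψ G x s - waveB ψ G x s) := by
  have cA := continuous_waveA hψ hG
  have cB := continuous_waveB hψ hG
  have cAx : ∀ x, Continuous fun s => waveA ψ G x s := fun x => cA.comp (by fun_prop : Continuous fun s => (x, s))
  have cBx : ∀ x, Continuous fun s => waveB ψ G x s := fun x => cB.comp (by fun_prop : Continuous fun s => (x, s))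
  have cAt : ∀ t, Continuous fun x => waveA ψ G x t := fun t => cA.comp (by fun_prop : Continuous fun x => (x, t))
  have cBt : ∀ t, Continuous fun x => waveB ψ G x t := fun t => cB.comp (by fun_prop : Continuous fun x => (x, t))
  have hd : ∀ ξ, HasDerivAt (fun x => ∫ s in (0 : ℝ)..t, (waveA ψ G x s - waveB ψ G x s))
      (waveA ψ G ξ t + waveB ψ G ξ t - (waveA ψ G ξ 0 + waveB ψ G ξ 0)) ξ := by
    intro ξ
    have h := (hasDerivAt_integral_waveA hψ hG t ξ).sub (hasDerivAt_integral_waveB hψ hG t ξ)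
    have e : (fun x => ∫ s in (0 : ℝ)..t, (waveA ψ G x s - waveB ψ G x s))
        = (fun x => ∫ s in (0 : ℝ)..t, waveA ψ G x s) - fun x => ∫ s in (0 : ℝ)..t, waveB ψ G x s := by
      ext x
      rw [Pi.sub_apply, intervalIntegral.integral_sub ((cAx x).intervalIntegrable _ _)
        ((cBx x).intervalIntegrable _ _)]
    rw [e]
    refine h.congr_deriv ?_
    ring
  have hi := intervalIntegral.integral_eq_sub_of_hasDerivAt (a := 0) (b := x) (fun ξ _ => hd ξ)
    ((((cAt t).add (cBt t)).sub ((cAt 0).add (cBt 0))).intervalIntegrable _ _)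
  have cXt : ∀ t, IntervalIntegrable (fun ξ => waveA ψ G ξ t + waveB ψ G ξ t) volume 0 x :=
    fun t => ((cAt t).add (cBt t)).intervalIntegrable _ _
  rw [intervalIntegral.integral_sub (cXt t) (cXt 0)] at hi
  have h0 : ∫ s in (0 : ℝ)..t, (waveA ψ G 0 s - waveB ψ G 0 s) = 0 := by
    simp [waveA, waveB]
  rw [h0] at hi
  linarith

theorem explicitQuad_state_apply (hψ : Continuous ψ) (hG : Continuous G.uncurry) (t : Icc 0 T)
    (x : I) : (explicitQuad (T := T) hψ hG).1 t x
      = ∫ ξ in (0 : ℝ)..x, (waveA ψ G ξ t + waveB ψ G ξ t) := by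
  have hc : Continuous fun ξ => waveA ψ G ξ t + waveB ψ G ξ t :=
    ((continuous_waveA hψ hG).comp (by fun_prop : Continuous fun ξ => (ξ, (t : ℝ)))).add
    ((continuous_waveB hψ hG).comp (by fun_prop : Continuous fun ξ => (ξ, (t : ℝ))))
  have h := H10.ofL2_cL2_apply (h := fun ξ => waveA ψ G ξ t + waveB ψ G ξ t)
    (H := fun x => ∫ ξ in (0 : ℝ)..x, (waveA ψ G ξ t + waveB ψ G ξ t))
    (slice (fun x t => waveA ψ G x t + waveB ψ G x t)
      ((continuous_waveA hψ hG).add (continuous_waveB hψ hG)) t) (fun x => rfl) hc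
    (fun s => (hc.integral_hasStrictDerivAt 0 s).hasDerivAt) x
  refine h.trans ?_
  simp

theorem explicitQuad_mem (hψ : Continuous ψ) (hG : Continuous G.uncurry) :
    explicitQuad hψ hG ∈ solSpace T := by
  have cA := continuous_waveA hψ hG
  have cB := continuous_waveB hψ hG
  have cAx : ∀ x, Continuous fun s => waveA ψ G x s := fun x => cA.comp (by fun_prop : Continuous fun s => (x, s))
  have cBx : ∀ x, Continuous fun s => waveB ψ G x s := fun x => cB.comp (by fun_prop : Continuous fun s => (x, s))
  have cAt : ∀ t, Continuous fun x => waveA ψ G x t := fun t => cA.comp (by fun_prop : Continuous fun x => (x, t))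
  have cBt : ∀ t, Continuous fun x => waveB ψ G x t := fun t => cB.comp (by fun_prop : Continuous fun x => (x, t))
  have hproj : ∀ t ∈ Icc 0 T, ∀ s ∈ uIcc 0 t, ((tproj T s : Icc 0 T) : ℝ) = s := by
    intro t ht s hs
    rw [uIcc_of_le ht.1] at hs
    rw [tproj_of_mem ⟨hs.1, hs.2.trans ht.2⟩]
  set X : ℝ → ℝ → ℝ := fun x t => waveA ψ G x t + waveB ψ G x t with hX
  set V : ℝ → ℝ → ℝ := fun x t => waveA ψ G x t - waveB ψ G x t with hV
  have cX : Continuous X.uncurry := cA.add cB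
  have cV : Continuous V.uncurry := cA.sub cB
  rw [mem_solSpace_iff']
  refine ⟨fun t ht => ?_, fun t ht z => ?_⟩
  · have e : ∫ s in (0 : ℝ)..t, (explicitQuad (T := T) hψ hG).2.1 (tproj T s)
        = cL2 (∫ s in (0 : ℝ)..t, slice V cV s) := by
      rw [← cL2.intervalIntegral_comp_comm ((continuous_slice cV).intervalIntegrable 0 t)]
      refine intervalIntegral.integral_congr fun s hs => ?_
      change cL2 (slice V cV (tproj T s : Icc 0 T)) = _
      rw [hproj t ht s hs]
    rw [e, H10.toL2_eq, H10.toL2_eq, ← map_add]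
    congr 1
    ext x
    rw [ContinuousMap.add_apply, intervalIntegral_slice]
    rw [explicitQuad_state_apply, explicitQuad_state_apply, tproj_of_mem ht]
    exact integral_waveX hψ hG t x
  · have hb : ∀ᵐ s, s ∈ uIoc 0 t → (explicitQuad (T := T) hψ hG).2.2.1 s = cL2 (slice G hG s) := by
      filter_upwards [ae_timeMeasure_restrict_uIoc ht (toTimeL2_coe (T := T)
        ⟨fun t : Icc 0 T => cL2 (slice G hG t),
          cL2.continuous.comp ((continuous_slice hG).comp continuous_subtype_val)⟩)] with s hs hs'
      refine (hs hs').trans ?_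
      change cL2 (slice G hG (tproj T s : Icc 0 T)) = _
      rw [hproj t ht s (uIoc_subset_uIcc hs')]
    have hv : ∀ᵐ s, s ∈ uIoc 0 t → (explicitQuad (T := T) hψ hG).2.2.2 s = X 1 s := by
      filter_upwards [ae_timeMeasure_restrict_uIoc ht (toTimeL2_coe (T := T)
        ⟨fun t : Icc 0 T => X 1 t,
          cX.comp (by fun_prop : Continuous fun t : Icc 0 T => ((1 : ℝ), (t : ℝ)))⟩)] with s hs hs'
      refine (hs hs').trans ?_
      change X 1 (tproj T s : Icc 0 T) = _
      rw [hproj t ht s (uIoc_subset_uIcc hs')]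
    have e : ∫ s in (0 : ℝ)..t, (inner ℝ z.toL2 ((explicitQuad (T := T) hψ hG).2.2.1 s)
          + z 1 * (explicitQuad (T := T) hψ hG).2.2.2 s
          - inner ℝ z.dx ((explicitQuad (T := T) hψ hG).1 (tproj T s)).dx)
        = ∫ s in (0 : ℝ)..t, (inner ℝ z.toL2 (cL2 (slice G hG s)) + z 1 * X 1 s
          - inner ℝ z.dx (cL2 (slice X cX s))) := by
      refine intervalIntegral.integral_congr_ae ?_
      filter_upwards [hb, hv] with s h1 h2 hs
      rw [h1 hs, h2 hs]
      congr 2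
      change cL2 (slice X cX (tproj T s : Icc 0 T)) = _
      rw [hproj t ht s (uIoc_subset_uIcc hs)]
    have cX1 : Continuous fun s => X 1 s := (cAx 1).add (cBx 1)
    have i1 : IntervalIntegrable (fun s => inner ℝ z.toL2 (cL2 (slice G hG s))) volume 0 t :=
      Continuous.intervalIntegrable
        (continuous_const.inner (cL2.continuous.comp (continuous_slice hG))) _ _
    have i2 : IntervalIntegrable (fun s => z 1 * X 1 s) volume 0 t :=
      (continuous_const.mul cX1).intervalIntegrable _ _
    have i3 : IntervalIntegrable (fun s => inner ℝ z.dx (cL2 (slice X cX s))) volume 0 t :=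
      Continuous.intervalIntegrable
        (continuous_const.inner (cL2.continuous.comp (continuous_slice cX))) _ _
    rw [e, intervalIntegral.integral_sub (i1.add i2) i3, intervalIntegral.integral_add i1 i2,
      integral_inner_slice, integral_inner_slice, intervalIntegral.integral_const_mul]
    have hd : ∀ ξ, HasDerivAt (fun x => ∫ s in (0 : ℝ)..t, X x s)
        (V ξ t - V ξ 0 - ∫ s in (0 : ℝ)..t, G ξ s) ξ := by
      intro ξ
      have h := (hasDerivAt_integral_waveA hψ hG t ξ).add (hasDerivAt_integral_waveB hψ hG t ξ)
      have e : (fun x => ∫ s in (0 : ℝ)..t, X x s)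
          = (fun x => ∫ s in (0 : ℝ)..t, waveA ψ G x s) + fun x => ∫ s in (0 : ℝ)..t, waveB ψ G x s := by
        ext x
        rw [Pi.add_apply, ← intervalIntegral.integral_add ((cAx x).intervalIntegrable _ _)
          ((cBx x).intervalIntegrable _ _)]
      rw [e]
      refine h.congr_deriv ?_
      simp only [hV]
      ring
    have cVt : ∀ t, Continuous fun x => V x t := fun t => (cAt t).sub (cBt t)
    have cGt : Continuous fun x => ∫ s in (0 : ℝ)..t, G x s :=
      intervalIntegral.continuous_parametric_intervalIntegral_of_continuous' hG 0 t
    have parts := H10.integral_mul_dx z hd (((cVt t).sub (cVt 0)).sub cGt)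
    rw [parts]
    have hz : ∀ s, inner ℝ z.toL2 (cL2 (slice V cV s)) = ∫ x : I, z x * V x s := by
      intro s
      rw [H10.toL2_eq, inner_cL2_cL2]; rfl
    have hz1 : inner ℝ z.toL2 ((explicitQuad (T := T) hψ hG).2.1 (tproj T t)) = ∫ x : I, z x * V x t := by
      rw [tproj_of_mem ht]; exact hz t
    have hz0 : inner ℝ z.toL2 ((explicitQuad (T := T) hψ hG).2.1 (t0 T)) = ∫ x : I, z x * V x 0 := hz 0
    have hzG : ∫ x, z.toL2 x * ∫ s in (0 : ℝ)..t, G x s = ∫ x : I, z x * ∫ s in (0 : ℝ)..t, G x s := by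
      refine integral_congr_ae ?_
      filter_upwards [cL2_coe z.val] with x hx
      rw [H10.toL2_eq, hx]
    rw [hz1, hz0, hzG]
    have ci : ∀ {w : ℝ → ℝ}, Continuous w → Integrable fun x : I => z x * w x := by
      intro w hw
      exact Continuous.integrable_of_hasCompactSupport
        (z.val.continuous.mul (hw.comp continuous_subtype_val)) (HasCompactSupport.of_compactSpace _)
    have e2 : ∫ x : I, z x * (V x t - V x 0 - ∫ s in (0 : ℝ)..t, G x s)
        = (∫ x : I, z x * V x t) - (∫ x : I, z x * V x 0) - ∫ x : I, z x * ∫ s in (0 : ℝ)..t, G x s := by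
      have c3 : Integrable fun x : I => z x * V x t - z x * V x 0 := (ci (cVt t)).sub (ci (cVt 0))
      rw [← integral_sub (ci (cVt t)) (ci (cVt 0)), ← integral_sub c3 (ci cGt)]
      refine integral_congr_ae (Eventually.of_forall fun x => ?_)
      simp only
      ring
    rw [e2]
    ring

end Explicit

section NullSpace

variable {T : ℝ} [hT : Fact (0 < T)]

/-- The space `𝒜₀` of null-controlled pairs, as a subspace of the space of quadruples. -/
def nullSpace (T : ℝ) [Fact (0 < T)] : Submodule ℝ (Quad T) :=
  solSpace T ⊓ ((((ContinuousMap.evalCLM ℝ (t0 T)).comp stateL).ker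
    ⊓ ((ContinuousMap.evalCLM ℝ (t0 T)).comp velL).ker)
    ⊓ (((ContinuousMap.evalCLM ℝ (t1 T)).comp stateL).ker
    ⊓ ((ContinuousMap.evalCLM ℝ (t1 T)).comp velL).ker))

theorem mem_nullSpace_iff {g : Quad T} : g ∈ nullSpace T ↔ g ∈ solSpace T ∧
    (g.1 (t0 T) = 0 ∧ g.2.1 (t0 T) = 0) ∧ g.1 (t1 T) = 0 ∧ g.2.1 (t1 T) = 0 := Iff.rfl

theorem isClosed_nullSpace : IsClosed (nullSpace T : Set (Quad T)) :=
  isClosed_solSpace.inter (((ContinuousLinearMap.isClosed_ker _).inter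
    (ContinuousLinearMap.isClosed_ker _)).inter ((ContinuousLinearMap.isClosed_ker _).inter
    (ContinuousLinearMap.isClosed_ker _)))

theorem exists_null_bound (T : ℝ) [hT : Fact (0 < T)] : ∃ C : ℝ, 1 ≤ C ∧ ∀ g ∈ nullSpace T,
    ‖g‖ ≤ C * (‖g.2.2.1‖ + ‖g.2.2.2‖) := by
  obtain ⟨C, hC, h⟩ := exists_energy_bound T
  refine ⟨max C 1, le_max_right _ _, fun g hg => ?_⟩
  obtain ⟨hs, ⟨h1, h2⟩, -⟩ := mem_nullSpace_iff.1 hg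
  obtain ⟨e1, e2⟩ := h g hs
  rw [h1, h2] at e1 e2
  simp only [norm_zero, zero_add] at e1 e2
  have hF := norm_nonneg g.2.2.1
  have hv := norm_nonneg g.2.2.2
  have hm : C * (‖g.2.2.1‖ + ‖g.2.2.2‖) ≤ max C 1 * (‖g.2.2.1‖ + ‖g.2.2.2‖) :=
    mul_le_mul_of_nonneg_right (le_max_left _ _) (by positivity)
  have hm1 : 1 * (‖g.2.2.1‖ + ‖g.2.2.2‖) ≤ max C 1 * (‖g.2.2.1‖ + ‖g.2.2.2‖) :=
    mul_le_mul_of_nonneg_right (le_max_right _ _) (by positivity)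
  refine norm_prod_le_iff.2 ⟨e1.trans hm, norm_prod_le_iff.2 ⟨e2.trans hm, norm_prod_le_iff.2 ⟨?_, ?_⟩⟩⟩
    <;> linarith

end NullSpace

section NullData

variable {T : ℝ} {ψ : ℝ → ℝ} {G : ℝ → ℝ → ℝ}

/-- Sidewise data that make the explicit solution vanish before time `0`. -/
def inData (G : ℝ → ℝ → ℝ) (s : ℝ) : ℝ := 1 / 2 * ∫ ξ in (0 : ℝ)..1, G ξ (s - ξ)

/-- Sidewise data that make the explicit solution vanish after time `T`. -/
def outData (G : ℝ → ℝ → ℝ) (s : ℝ) : ℝ := 1 / 2 * ∫ ξ in (0 : ℝ)..1, G ξ (s + ξ)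

theorem continuous_inData (hG : Continuous G.uncurry) : Continuous (inData G) := by
  refine continuous_const.mul ?_
  refine intervalIntegral.continuous_parametric_intervalIntegral_of_continuous'
    (f := fun s ξ => G ξ (s - ξ)) ?_ 0 1
  exact hG.comp (by fun_prop : Continuous fun q : ℝ × ℝ => (q.2, q.1 - q.2))

theorem continuous_outData (hG : Continuous G.uncurry) : Continuous (outData G) := by
  refine continuous_const.mul ?_
  refine intervalIntegral.continuous_parametric_intervalIntegral_of_continuous'
    (f := fun s ξ => G ξ (s + ξ)) ?_ 0 1
  exact hG.comp (by fun_prop : Continuous fun q : ℝ × ℝ => (q.2, q.1 + q.2))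

/-- Sidewise data for which the solution with source `G` is null-controlled. -/
structure IsNullData (T : ℝ) (ψ : ℝ → ℝ) (G : ℝ → ℝ → ℝ) : Prop where
  cont_data : Continuous ψ
  cont_source : Continuous G.uncurry
  source_neg : ∀ ξ τ, τ ≤ 0 → G ξ τ = 0
  source_late : ∀ ξ τ, T ≤ τ → G ξ τ = 0
  data_in : ∀ s ≤ 1, ψ s = inData G s
  data_out : ∀ s, T - 1 ≤ s → ψ s = outData G s

namespace IsNullData

theorem reverse (h : IsNullData T ψ G) :
    IsNullData T (fun s => ψ (T - s)) (fun ξ τ => G ξ (T - τ)) where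
  cont_data := h.cont_data.comp (by fun_prop)
  cont_source := h.cont_source.comp (by fun_prop : Continuous fun p : ℝ × ℝ => (p.1, T - p.2))
  source_neg := fun ξ τ hτ => h.source_late ξ _ (by linarith)
  source_late := fun ξ τ hτ => h.source_neg ξ _ (by linarith)
  data_in := fun s hs => by
    rw [h.data_out _ (by linarith)]
    simp only [inData, outData]
    congr 2; ext ξ; congr 1; ring
  data_out := fun s hs => by
    rw [h.data_in _ (by linarith)]
    simp only [inData, outData]
    congr 2; ext ξ; congr 1; ring

theorem waveA_reverse (ψ : ℝ → ℝ) (G : ℝ → ℝ → ℝ) (T x t : ℝ) :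
    waveA (fun s => ψ (T - s)) (fun ξ τ => G ξ (T - τ)) x (T - t) = waveB ψ G x t := by
  simp only [waveA, waveB, show T - (T - t + x) = t - x by ring,
    fun ξ : ℝ => show T - (T - t + x - ξ) = t - x + ξ by ring]

theorem waveB_reverse (ψ : ℝ → ℝ) (G : ℝ → ℝ → ℝ) (T x t : ℝ) :
    waveB (fun s => ψ (T - s)) (fun ξ τ => G ξ (T - τ)) x (T - t) = waveA ψ G x t := by
  simp only [waveA, waveB, show T - (T - t - x) = t + x by ring,
    fun ξ : ℝ => show T - (T - t - x + ξ) = t + x - ξ by ring]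

theorem waveA_eq (h : IsNullData T ψ G) {x t : ℝ} (hxt : t + x ≤ 1) :
    waveA ψ G x t = 1 / 2 * ∫ ξ in x..1, G ξ (t + x - ξ) := by
  have hc : Continuous fun ξ => G ξ (t + x - ξ) :=
    h.cont_source.comp (by fun_prop : Continuous fun ξ : ℝ => (ξ, t + x - ξ))
  rw [waveA, h.data_in _ hxt, inData,
    ← intervalIntegral.integral_add_adjacent_intervals (hc.intervalIntegrable 0 x)
      (hc.intervalIntegrable x 1)]
  ring

theorem waveB_eq (h : IsNullData T ψ G) {x t : ℝ} (hxt : t - x ≤ 1) :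
    waveB ψ G x t = 1 / 2 * (∫ ξ in (0 : ℝ)..1, G ξ (t - x - ξ))
      - 1 / 2 * ∫ ξ in (0 : ℝ)..x, G ξ (t - x + ξ) := by
  rw [waveB, h.data_in _ hxt, inData]

theorem waveA_zero (h : IsNullData T ψ G) {x : ℝ} (hx : x ∈ Icc (0 : ℝ) 1) : waveA ψ G x 0 = 0 := by
  rw [h.waveA_eq (by linarith [hx.2])]
  rw [intervalIntegral.integral_congr (g := fun _ => 0)]
  · simp
  · intro ξ hξ
    rw [uIcc_of_le hx.2] at hξ
    exact h.source_neg _ _ (by linarith [hξ.1])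

theorem waveB_zero (h : IsNullData T ψ G) {x : ℝ} (hx : x ∈ Icc (0 : ℝ) 1) : waveB ψ G x 0 = 0 := by
  rw [h.waveB_eq (by linarith [hx.1])]
  rw [intervalIntegral.integral_congr (g := fun _ => 0), intervalIntegral.integral_congr (a := 0) (b := x) (g := fun _ => 0)]
  · simp
  · intro ξ hξ
    rw [uIcc_of_le hx.1] at hξ
    exact h.source_neg _ _ (by linarith [hξ.2])
  · intro ξ hξ
    rw [uIcc_of_le zero_le_one] at hξ
    exact h.source_neg _ _ (by linarith [hξ.1, hx.1])

theorem waveA_final (h : IsNullData T ψ G) {x : ℝ} (hx : x ∈ Icc (0 : ℝ) 1) : waveA ψ G x T = 0 := by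
  rw [← waveB_reverse ψ G T, sub_self]
  exact h.reverse.waveB_zero hx

theorem waveB_final (h : IsNullData T ψ G) {x : ℝ} (hx : x ∈ Icc (0 : ℝ) 1) : waveB ψ G x T = 0 := by
  rw [← waveA_reverse ψ G T, sub_self]
  exact h.reverse.waveA_zero hx

theorem explicitQuad_mem_nullSpace [hT : Fact (0 < T)] (h : IsNullData T ψ G) :
    explicitQuad h.cont_data h.cont_source ∈ nullSpace T := by
  refine mem_nullSpace_iff.2 ⟨explicitQuad_mem _ _, ⟨?_, ?_⟩, ?_, ?_⟩
  · refine H10.dx_injective ?_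
    rw [map_zero]
    refine Eq.trans ?_ (map_zero cL2)
    refine congrArg cL2 (ContinuousMap.ext fun x => ?_)
    change waveA ψ G x 0 + waveB ψ G x 0 = 0
    rw [h.waveA_zero x.2, h.waveB_zero x.2, add_zero]
  · refine Eq.trans ?_ (map_zero cL2)
    refine congrArg cL2 (ContinuousMap.ext fun x => ?_)
    change waveA ψ G x 0 - waveB ψ G x 0 = 0
    rw [h.waveA_zero x.2, h.waveB_zero x.2, sub_zero]
  · refine H10.dx_injective ?_
    rw [map_zero]
    refine Eq.trans ?_ (map_zero cL2)
    refine congrArg cL2 (ContinuousMap.ext fun x => ?_)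
    change waveA ψ G x T + waveB ψ G x T = 0
    rw [h.waveA_final x.2, h.waveB_final x.2, add_zero]
  · refine Eq.trans ?_ (map_zero cL2)
    refine congrArg cL2 (ContinuousMap.ext fun x => ?_)
    change waveA ψ G x T - waveB ψ G x T = 0
    rw [h.waveA_final x.2, h.waveB_final x.2, sub_zero]

theorem control_eq (ψ : ℝ → ℝ) (G : ℝ → ℝ → ℝ) (t : ℝ) : waveA ψ G 1 t + waveB ψ G 1 t
    = ψ (t + 1) + ψ (t - 1) - inData G (t + 1) - outData G (t - 1) := by
  rw [waveA, waveB, inData, outData]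
  ring

end IsNullData

end NullData

section Weights

theorem abs_integral_le_exp {a b μ K c : ℝ} (hab : a ≤ b) (hμ : 0 < μ) (hK : 0 ≤ K) {h : ℝ → ℝ}
    (hh : ∀ ξ ∈ Ioc a b, |h ξ| ≤ K * Real.exp (c + μ * ξ)) :
    |∫ ξ in a..b, h ξ| ≤ K * Real.exp (c + μ * b) / μ := by
  have hd : ∀ ξ, HasDerivAt (fun ξ => K * Real.exp (c + μ * ξ) / μ) (K * Real.exp (c + μ * ξ)) ξ := by
    intro ξ
    have h1 := ((((hasDerivAt_id ξ).const_mul μ).const_add c).exp.const_mul K).div_const μ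
    refine h1.congr_deriv ?_
    simp only [id, mul_one]
    field_simp
  have hc : Continuous fun ξ => K * Real.exp (c + μ * ξ) := by fun_prop
  have h1 := intervalIntegral.norm_integral_le_of_norm_le (μ := volume) (f := h) hab
    (Eventually.of_forall hh) (hc.intervalIntegrable a b)
  rw [intervalIntegral.integral_eq_sub_of_hasDerivAt (fun ξ _ => hd ξ) (hc.intervalIntegrable a b)] at h1
  refine h1.trans ?_
  have : 0 ≤ K * Real.exp (c + μ * a) / μ := by positivity
  linarith

theorem abs_integral_le_exp_neg {a b μ K c : ℝ} (hab : a ≤ b) (hμ : 0 < μ) (hK : 0 ≤ K) {h : ℝ → ℝ}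
    (hh : ∀ ξ ∈ Ioc a b, |h ξ| ≤ K * Real.exp (c - μ * ξ)) :
    |∫ ξ in a..b, h ξ| ≤ K * Real.exp (c - μ * a) / μ := by
  have hd : ∀ ξ, HasDerivAt (fun ξ => -(K * Real.exp (c - μ * ξ) / μ)) (K * Real.exp (c - μ * ξ)) ξ := by
    intro ξ
    have h1 := ((((hasDerivAt_id ξ).const_mul μ).const_sub c).exp.const_mul K).div_const μ |>.neg
    refine h1.congr_deriv ?_
    simp only [id, mul_one]
    field_simp
  have hc : Continuous fun ξ => K * Real.exp (c - μ * ξ) := by fun_prop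
  have h1 := intervalIntegral.norm_integral_le_of_norm_le (μ := volume) (f := h) hab
    (Eventually.of_forall hh) (hc.intervalIntegrable a b)
  rw [intervalIntegral.integral_eq_sub_of_hasDerivAt (fun ξ _ => hd ξ) (hc.intervalIntegrable a b)] at h1
  refine h1.trans ?_
  have : 0 ≤ K * Real.exp (c - μ * b) / μ := by positivity
  linarith

variable {T μ K : ℝ} {ψ : ℝ → ℝ} {G : ℝ → ℝ → ℝ}

/-- Exponential bounds: `K e^{μ(2+x)}` on the whole rectangle, `K e^{μt}` in the domain of
dependence of the initial time, `K e^{μ(T-t)}` in that of the final time. -/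
structure WeightBound (T μ K : ℝ) (Y : ℝ → ℝ → ℝ) : Prop where
  all : ∀ x ∈ Icc (0 : ℝ) 1, ∀ t ∈ Icc 0 T, |Y x t| ≤ K * Real.exp (μ * (2 + x))
  early : ∀ x ∈ Icc (0 : ℝ) 1, ∀ t ∈ Icc 0 T, t + x ≤ 1 → |Y x t| ≤ K * Real.exp (μ * t)
  late : ∀ x ∈ Icc (0 : ℝ) 1, ∀ t ∈ Icc 0 T, T - t + x ≤ 1 → |Y x t| ≤ K * Real.exp (μ * (T - t))

theorem WeightBound.reverse {Y : ℝ → ℝ → ℝ} (h : WeightBound T μ K Y) :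
    WeightBound T μ K fun x t => Y x (T - t) where
  all := fun x hx t ht => h.all x hx _ ⟨by linarith [ht.2], by linarith [ht.1]⟩
  early := fun x hx t ht hxt => by
    have := h.late x hx (T - t) ⟨by linarith [ht.2], by linarith [ht.1]⟩ (by linarith)
    rwa [sub_sub_cancel] at this
  late := fun x hx t ht hxt =>
    h.early x hx (T - t) ⟨by linarith [ht.2], by linarith [ht.1]⟩ (by linarith)

theorem WeightBound.source_early (hw : WeightBound T μ K G) (hn : IsNullData T ψ G) (hT : 2 < T)
    (hK : 0 ≤ K) {ξ τ : ℝ} (hξ : ξ ∈ Icc (0 : ℝ) 1) (h : τ + ξ ≤ 1) :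
    |G ξ τ| ≤ K * Real.exp (μ * τ) := by
  rcases le_total τ 0 with h0 | h0
  · rw [hn.source_neg _ _ h0, abs_zero]; positivity
  · exact hw.early ξ hξ τ ⟨h0, by linarith [hξ.1]⟩ h

theorem WeightBound.source_all (hw : WeightBound T μ K G) (hn : IsNullData T ψ G)
    (hK : 0 ≤ K) {ξ : ℝ} (hξ : ξ ∈ Icc (0 : ℝ) 1) (τ : ℝ) :
    |G ξ τ| ≤ K * Real.exp (μ * (2 + ξ)) := by
  rcases le_total τ 0 with h0 | h0
  · rw [hn.source_neg _ _ h0, abs_zero]; positivity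
  rcases le_total T τ with h1 | h1
  · rw [hn.source_late _ _ h1, abs_zero]; positivity
  · exact hw.all ξ hξ τ ⟨h0, h1⟩

theorem WeightBound.abs_inData_le (hw : WeightBound T μ K G) (hn : IsNullData T ψ G) (hT : 2 < T)
    (hμ : 0 < μ) (hK : 0 ≤ K) {s : ℝ} (hs : s ≤ 1) :
    |inData G s| ≤ 1 / 2 * (K * Real.exp μ / μ) := by
  have h := abs_integral_le_exp_neg (a := 0) (b := 1) (c := μ * s) (h := fun ξ => G ξ (s - ξ))
    zero_le_one hμ hK fun ξ hξ => by
      have := hw.source_early hn hT hK (ξ := ξ) (τ := s - ξ) ⟨hξ.1.le, hξ.2⟩ (by linarith)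
      rwa [mul_sub] at this
  rw [inData, abs_mul, abs_of_pos (by norm_num : (0 : ℝ) < 1 / 2)]
  refine mul_le_mul_of_nonneg_left (h.trans ?_) (by norm_num)
  have : Real.exp (μ * s - μ * 0) ≤ Real.exp μ := Real.exp_le_exp.2 (by nlinarith)
  gcongr

theorem WeightBound.abs_velocity_early (hw : WeightBound T μ K G) (hn : IsNullData T ψ G) (hT : 2 < T)
    (hμ : 0 < μ) (hK : 0 ≤ K) {x t : ℝ} (hx : x ∈ Icc (0 : ℝ) 1) (hxt : t + x ≤ 1) :
    |waveA ψ G x t - waveB ψ G x t| ≤ 2 * K / μ * Real.exp (μ * t) := by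
  have hA : |∫ ξ in x..1, G ξ (t + x - ξ)| ≤ K * Real.exp (μ * t) / μ := by
    have h := abs_integral_le_exp_neg (a := x) (b := 1) (c := μ * (t + x))
      (h := fun ξ => G ξ (t + x - ξ)) hx.2 hμ hK fun ξ hξ => by
        have := hw.source_early hn hT hK (ξ := ξ) (τ := t + x - ξ) ⟨hx.1.trans hξ.1.le, hξ.2⟩
          (by linarith)
        rwa [mul_sub] at this
    rwa [← mul_sub, add_sub_cancel_right] at h
  have hB1 : |∫ ξ in (0 : ℝ)..1, G ξ (t - x - ξ)| ≤ K * Real.exp (μ * t) / μ := by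
    have h := abs_integral_le_exp_neg (a := 0) (b := 1) (c := μ * (t - x))
      (h := fun ξ => G ξ (t - x - ξ)) zero_le_one hμ hK fun ξ hξ => by
        have := hw.source_early hn hT hK (ξ := ξ) (τ := t - x - ξ) ⟨hξ.1.le, hξ.2⟩
          (by linarith [hx.1])
        rwa [mul_sub] at this
    refine h.trans ?_
    have : Real.exp (μ * (t - x) - μ * 0) ≤ Real.exp (μ * t) :=
      Real.exp_le_exp.2 (by nlinarith [hx.1])
    gcongr
  have hB2 : |∫ ξ in (0 : ℝ)..x, G ξ (t - x + ξ)| ≤ K * Real.exp (μ * t) / μ := by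
    have h := abs_integral_le_exp (a := 0) (b := x) (c := μ * (t - x))
      (h := fun ξ => G ξ (t - x + ξ)) hx.1 hμ hK fun ξ hξ => by
        have := hw.source_early hn hT hK (ξ := ξ) (τ := t - x + ξ) ⟨hξ.1.le, hξ.2.trans hx.2⟩
          (by linarith [hξ.2])
        rwa [mul_add] at this
    rwa [← mul_add, sub_add_cancel] at h
  rw [hn.waveA_eq hxt, hn.waveB_eq (by linarith [hx.1])]
  have e : 2 * K / μ * Real.exp (μ * t) = 2 * (K * Real.exp (μ * t) / μ) := by ring
  rw [e]
  have hpos : 0 ≤ K * Real.exp (μ * t) / μ := by positivity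
  rw [abs_le] at *
  constructor <;> linarith [hA.1, hA.2, hB1.1, hB1.2, hB2.1, hB2.2]

theorem WeightBound.abs_state_early (hw : WeightBound T μ K G) (hn : IsNullData T ψ G) (hT : 2 < T)
    (hμ : 0 < μ) (hK : 0 ≤ K) {x t : ℝ} (hx : x ∈ Icc (0 : ℝ) 1) (ht : 0 ≤ t) (hxt : t + x ≤ 1) :
    |∫ ξ in (0 : ℝ)..x, (waveA ψ G ξ t + waveB ψ G ξ t)| ≤ 2 * K / μ ^ 2 * Real.exp (μ * t) := by
  have h0 : ∫ ξ in (0 : ℝ)..x, (waveA ψ G ξ 0 + waveB ψ G ξ 0) = 0 := by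
    rw [intervalIntegral.integral_congr (g := fun _ => 0)]
    · simp
    · intro ξ hξ
      rw [uIcc_of_le hx.1] at hξ
      have hξ' : ξ ∈ Icc (0 : ℝ) 1 := ⟨hξ.1, hξ.2.trans hx.2⟩
      simp only [hn.waveA_zero hξ', hn.waveB_zero hξ', add_zero]
  rw [integral_waveX hn.cont_data hn.cont_source, h0, zero_add]
  have h := abs_integral_le_exp (a := 0) (b := t) (c := 0) (K := 2 * K / μ)
    (h := fun s => waveA ψ G x s - waveB ψ G x s) ht hμ (by positivity) fun s hs => by
      have := hw.abs_velocity_early hn hT hμ hK hx (t := s) (by linarith [hs.2])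
      rwa [zero_add]
  rw [zero_add] at h
  refine h.trans (le_of_eq ?_)
  field_simp

theorem WeightBound.state (hw : WeightBound T μ K G) (hn : IsNullData T ψ G) (hT : 2 < T)
    (hμ : 0 < μ) (hK : 0 ≤ K) (hψ : ∀ s, |ψ s| ≤ 1 / 2 * (K * Real.exp μ / μ)) :
    WeightBound T μ (2 * K / μ ^ 2)
      fun x t => ∫ ξ in (0 : ℝ)..x, (waveA ψ G ξ t + waveB ψ G ξ t) where
  early := fun x hx t ht hxt => hw.abs_state_early hn hT hμ hK hx ht.1 hxt
  late := fun x hx t ht hxt => by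
    have h := hw.reverse.abs_state_early hn.reverse hT hμ hK hx (t := T - t) (by linarith [ht.2]) hxt
    simp only [IsNullData.waveA_reverse, IsNullData.waveB_reverse] at h
    simpa only [add_comm] using h
  all := fun x hx t ht => by
    have hb : ∀ ξ ∈ Ioc 0 x, |waveA ψ G ξ t + waveB ψ G ξ t|
        ≤ K * Real.exp μ / μ + K / μ * Real.exp (2 * μ + μ * ξ) := by
      intro ξ hξ
      have h1 : |∫ η in (0 : ℝ)..ξ, G η (t + ξ - η)| ≤ K * Real.exp (2 * μ + μ * ξ) / μ :=
        abs_integral_le_exp hξ.1.le hμ hK fun η hη => by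
          have := hw.source_all hn hK (ξ := η) ⟨hη.1.le, hη.2.trans (hξ.2.trans hx.2)⟩ (t + ξ - η)
          rwa [mul_add, mul_comm μ 2] at this
      have h2 : |∫ η in (0 : ℝ)..ξ, G η (t - ξ + η)| ≤ K * Real.exp (2 * μ + μ * ξ) / μ :=
        abs_integral_le_exp hξ.1.le hμ hK fun η hη => by
          have := hw.source_all hn hK (ξ := η) ⟨hη.1.le, hη.2.trans (hξ.2.trans hx.2)⟩ (t - ξ + η)
          rwa [mul_add, mul_comm μ 2] at this
      have h3 := hψ (t + ξ)
      have h4 := hψ (t - ξ)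
      rw [waveA, waveB]
      have e : K / μ * Real.exp (2 * μ + μ * ξ) = K * Real.exp (2 * μ + μ * ξ) / μ := by ring
      rw [e]
      rw [abs_le] at *
      constructor <;> linarith [h1.1, h1.2, h2.1, h2.2, h3.1, h3.2, h4.1, h4.2]
    have hd : ∀ ξ, HasDerivAt (fun ξ => K * Real.exp μ / μ * ξ + K / μ ^ 2 * Real.exp (2 * μ + μ * ξ))
        (K * Real.exp μ / μ + K / μ * Real.exp (2 * μ + μ * ξ)) ξ := by
      intro ξ
      have h1 := (((hasDerivAt_id ξ).const_mul μ).const_add (2 * μ)).exp.const_mul (K / μ ^ 2)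
      have h2 := (hasDerivAt_id ξ).const_mul (K * Real.exp μ / μ)
      refine (h2.add h1).congr_deriv ?_
      simp only [id, mul_one]
      field_simp
    have hc : Continuous fun ξ => K * Real.exp μ / μ + K / μ * Real.exp (2 * μ + μ * ξ) := by fun_prop
    have h1 := intervalIntegral.norm_integral_le_of_norm_le (μ := volume)
      (f := fun ξ => waveA ψ G ξ t + waveB ψ G ξ t) hx.1
      (Eventually.of_forall hb) (hc.intervalIntegrable 0 x)
    rw [intervalIntegral.integral_eq_sub_of_hasDerivAt (fun ξ _ => hd ξ)
      (hc.intervalIntegrable 0 x)] at h1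
    refine h1.trans ?_
    have e1 : 2 * μ + μ * x = μ * (2 + x) := by ring
    rw [e1]
    have h2 : K * Real.exp μ / μ * x ≤ K / μ ^ 2 * Real.exp (μ * (2 + x)) := by
      have h3 : μ * Real.exp μ ≤ Real.exp (μ * (2 + x)) := by
        calc μ * Real.exp μ ≤ Real.exp μ * Real.exp μ :=
              mul_le_mul_of_nonneg_right (by linarith [Real.add_one_le_exp μ]) (Real.exp_pos _).le
          _ = Real.exp (μ + μ) := (Real.exp_add _ _).symm
          _ ≤ _ := Real.exp_le_exp.2 (by nlinarith [hx.1])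
      calc K * Real.exp μ / μ * x ≤ K * Real.exp μ / μ * 1 :=
            mul_le_mul_of_nonneg_left hx.2 (by positivity)
        _ = K / μ ^ 2 * (μ * Real.exp μ) := by field_simp
        _ ≤ _ := mul_le_mul_of_nonneg_left h3 (by positivity)
    have h4 : 0 ≤ K / μ ^ 2 * Real.exp (2 * μ + μ * 0) := by positivity
    have e2 : 2 * K / μ ^ 2 * Real.exp (μ * (2 + x))
        = K / μ ^ 2 * Real.exp (μ * (2 + x)) + K / μ ^ 2 * Real.exp (μ * (2 + x)) := by ring
    rw [e2]
    linarith

end Weights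

section Field

variable {T : ℝ} [hT : Fact (0 < T)]

/-- Continuous functions on `[0,T] × [0,1]`. -/
abbrev Field (T : ℝ) : Type := C(Icc 0 T, C(I, ℝ))

/-- The state as a continuous function on `[0,T] × [0,1]`. -/
def fieldL : Quad T →L[ℝ] Field T := (H10.valL.compLeftContinuous ℝ (Icc 0 T)).comp stateL

theorem fieldL_apply {T : ℝ} (g : Quad T) (t : Icc 0 T) (x : I) : fieldL g t x = g.1 t x := rfl

/-- A continuous function as an element of `L²(0,T;L²(Ω))`. -/
def srcL : Field T →L[ℝ] TimeL2 T L2 := toTimeL2.comp (cL2.compLeftContinuous ℝ (Icc 0 T))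

theorem srcL_coe (w : Field T) :
    (srcL w : ℝ → L2) =ᵐ[timeMeasure T] fun s => cL2 (w (tproj T s)) :=
  toTimeL2_coe _

theorem norm_fieldL_le {T : ℝ} (g : Quad T) : ‖fieldL g‖ ≤ ‖g‖ := by
  refine (ContinuousMap.norm_le _ (norm_nonneg _)).2 fun t => ?_
  exact (H10.norm_valL_le _).trans ((g.1.norm_coe_le_norm t).trans (norm_fst_le g))

theorem norm_srcL_le (w : Field T) : ‖srcL w‖ ≤ √T * ‖w‖ := by
  refine (norm_toTimeL2_le _).trans (mul_le_mul_of_nonneg_left ?_ (Real.sqrt_nonneg _))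
  refine (ContinuousMap.norm_le _ (norm_nonneg w)).2 fun t => ?_
  exact (norm_cL2_le (w t)).trans (w.norm_coe_le_norm t)

theorem Field.abs_apply_le {T : ℝ} (w : Field T) (t : Icc 0 T) (x : I) : |w t x| ≤ ‖w‖ :=
  ((w t).norm_coe_le_norm x).trans (w.norm_coe_le_norm t)

theorem Field.norm_le_iff {T : ℝ} {w : Field T} {C : ℝ} (hC : 0 ≤ C) : ‖w‖ ≤ C ↔ ∀ t x, |w t x| ≤ C := by
  rw [ContinuousMap.norm_le _ hC]
  exact forall_congr' fun t => ContinuousMap.norm_le _ hC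

/-- Extension of a continuous function on `[0,T] × [0,1]` to the plane; arguments are `(x,t)`. -/
def extField (w : Field T) (x t : ℝ) : ℝ := w (tproj T t) (projIcc 0 1 zero_le_one x)

theorem continuous_extField (w : Field T) : Continuous (extField w).uncurry := by
  have h1 : Continuous fun p : ℝ × ℝ => w (tproj T p.2) :=
    w.continuous.comp (continuous_tproj.comp continuous_snd)
  have h2 : Continuous fun p : ℝ × ℝ => (projIcc 0 1 zero_le_one p.1 : I) :=
    continuous_projIcc.comp continuous_fst
  exact h1.eval h2

theorem extField_coe (w : Field T) (t : Icc 0 T) (x : I) : extField w x t = w t x := by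
  rw [extField, tproj_coe, projIcc_val]

theorem slice_extField (w : Field T) (t : Icc 0 T) :
    slice (extField w) (continuous_extField w) t = w t := by
  ext x
  exact extField_coe w t x

theorem extField_neg {w : Field T} (h0 : w (t0 T) = 0) (x : ℝ) {t : ℝ} (ht : t ≤ 0) :
    extField w x t = 0 := by
  rw [extField, tproj, projIcc_of_le_left _ ht]
  change w (t0 T) _ = 0
  rw [h0]; rfl

theorem extField_late {w : Field T} (h1 : w (t1 T) = 0) (x : ℝ) {t : ℝ} (ht : T ≤ t) :
    extField w x t = 0 := by
  rw [extField, tproj, projIcc_of_right_le _ ht]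
  change w (t1 T) _ = 0
  rw [h1]; rfl

theorem abs_extField_le (w : Field T) (x t : ℝ) : |extField w x t| ≤ ‖w‖ := w.abs_apply_le _ _

theorem norm_srcL_sq (w : Field T) :
    ‖srcL w‖ ^ 2 = ∫ t in (0 : ℝ)..T, ∫ x in (0 : ℝ)..1, extField w x t ^ 2 := by
  rw [TimeL2.norm_sq_eq, intervalIntegral_eq_timeMeasure hT.out.le]
  refine integral_congr_ae ?_
  filter_upwards [srcL_coe w, ae_restrict_mem measurableSet_Icc] with t ht htm
  rw [ht, ← real_inner_self_eq_norm_sq, inner_cL2_cL2]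
  refine integral_unit_eq_of_eqOn (g := fun x => w (tproj T t) x * w (tproj T t) x)
    (h := fun x => extField w x t ^ 2) fun x => ?_
  rw [extField, projIcc_val, sq]

end Field

section Cutoff

/-- A cutoff equal to `1` before time `1` and to `0` after time `T - 1`. -/
def cutoff (T s : ℝ) : ℝ := max 0 (min 1 ((T - 1 - s) / (T - 2)))

theorem continuous_cutoff (T : ℝ) : Continuous (cutoff T) := by
  unfold cutoff
  fun_prop

theorem cutoff_nonneg (T s : ℝ) : 0 ≤ cutoff T s := le_max_left _ _

theorem cutoff_le_one (T s : ℝ) : cutoff T s ≤ 1 := max_le zero_le_one (min_le_left _ _)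

theorem cutoff_of_le {T s : ℝ} (hT : 2 < T) (hs : s ≤ 1) : cutoff T s = 1 := by
  have : 1 ≤ (T - 1 - s) / (T - 2) := (one_le_div (by linarith)).2 (by linarith)
  rw [cutoff, min_eq_left this, max_eq_right zero_le_one]

theorem cutoff_of_ge {T s : ℝ} (hT : 2 < T) (hs : T - 1 ≤ s) : cutoff T s = 0 := by
  have : (T - 1 - s) / (T - 2) ≤ 0 := div_nonpos_of_nonpos_of_nonneg (by linarith) (by linarith)
  rw [cutoff, max_eq_left ((min_le_right _ _).trans this)]

theorem abs_cutoff_combination_le {T s a b C : ℝ} (ha : |a| ≤ C) (hb : |b| ≤ C) :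
    |cutoff T s * a + (1 - cutoff T s) * b| ≤ C := by
  have h0 := cutoff_nonneg T s
  have h1 := cutoff_le_one T s
  calc |cutoff T s * a + (1 - cutoff T s) * b| ≤ |cutoff T s * a| + |(1 - cutoff T s) * b| := abs_add_le _ _
    _ = cutoff T s * |a| + (1 - cutoff T s) * |b| := by
        rw [abs_mul, abs_mul, abs_of_nonneg h0, abs_of_nonneg (by linarith : 0 ≤ 1 - cutoff T s)]
    _ ≤ cutoff T s * C + (1 - cutoff T s) * C :=
        add_le_add (mul_le_mul_of_nonneg_left ha h0) (mul_le_mul_of_nonneg_left hb (by linarith))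
    _ = C := by ring

theorem sq_cutoff_combination_le {T s a b : ℝ} :
    (cutoff T s * a + (1 - cutoff T s) * b) ^ 2 ≤ a ^ 2 + b ^ 2 := by
  have h0 := cutoff_nonneg T s
  have h1 := cutoff_le_one T s
  have h2 : 0 ≤ cutoff T s * (1 - cutoff T s) * (a - b) ^ 2 :=
    mul_nonneg (mul_nonneg h0 (by linarith)) (sq_nonneg _)
  have h3 : 0 ≤ (1 - cutoff T s) * a ^ 2 := mul_nonneg (by linarith) (sq_nonneg _)
  have h4 : 0 ≤ cutoff T s * b ^ 2 := mul_nonneg h0 (sq_nonneg _)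
  nlinarith

end Cutoff

section Step

variable {T : ℝ} [hF : Fact (0 < T)]

theorem explicitQuad_box {ψ : ℝ → ℝ} (w : Field T) (hψ : Continuous ψ) :
    (explicitQuad hψ (continuous_extField w)).2.2.1 = srcL w := by
  refine congrArg toTimeL2 (ContinuousMap.ext fun t => ?_)
  change cL2 (slice (extField w) (continuous_extField w) t) = cL2 (w t)
  rw [slice_extField]

theorem abs_inData_le_of_bound {G : ℝ → ℝ → ℝ} {S : ℝ} (h : ∀ ξ τ, |G ξ τ| ≤ S) (s : ℝ) :
    |inData G s| ≤ 1 / 2 * S := by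
  rw [inData, abs_mul, abs_of_pos (by norm_num : (0 : ℝ) < 1 / 2)]
  refine mul_le_mul_of_nonneg_left ?_ (by norm_num)
  have := intervalIntegral.norm_integral_le_of_norm_le_const (a := 0) (b := 1)
    (f := fun ξ => G ξ (s - ξ)) (C := S) fun ξ _ => h _ _
  simpa using this

theorem abs_outData_le_of_bound {G : ℝ → ℝ → ℝ} {S : ℝ} (h : ∀ ξ τ, |G ξ τ| ≤ S) (s : ℝ) :
    |outData G s| ≤ 1 / 2 * S := by
  rw [outData, abs_mul, abs_of_pos (by norm_num : (0 : ℝ) < 1 / 2)]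
  refine mul_le_mul_of_nonneg_left ?_ (by norm_num)
  have := intervalIntegral.norm_integral_le_of_norm_le_const (a := 0) (b := 1)
    (f := fun ξ => G ξ (s + ξ)) (C := S) fun ξ _ => h _ _
  simpa using this

theorem outData_eq_reverse (G : ℝ → ℝ → ℝ) (T s : ℝ) :
    outData G s = inData (fun ξ τ => G ξ (T - τ)) (T - s) := by
  simp only [inData, outData, fun ξ : ℝ => show T - (T - s - ξ) = s + ξ by ring]

/-- Null control with a continuous source, with exponential bounds. -/
theorem exists_nullControl_weighted (T : ℝ) [hF : Fact (0 < T)] (hT : 2 < T) :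
    ∃ C : ℝ, 0 < C ∧ ∀ w : Field T, w (t0 T) = 0 → w (t1 T) = 0 →
      ∃ g ∈ nullSpace T, g.2.2.1 = srcL w ∧ ∀ μ K : ℝ, 0 < μ → 0 ≤ K →
        WeightBound T μ K (extField w) →
        WeightBound T μ (2 * K / μ ^ 2) (extField (fieldL g)) ∧ ‖g‖ ≤ C * (K * Real.exp (3 * μ)) := by
  obtain ⟨C, hC, hbound⟩ := exists_null_bound T
  refine ⟨C * (√T + √T * 2), by have := hF.out; positivity, fun w h0 h1 => ?_⟩
  set G := extField w with hG
  set ψ : ℝ → ℝ := fun s => cutoff T s * inData G (min s 1)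
    + (1 - cutoff T s) * outData G (max s (T - 1)) with hψ
  have cG := continuous_extField w
  have hn : IsNullData T ψ G :=
    { cont_data := ((continuous_cutoff T).mul ((continuous_inData cG).comp (by fun_prop))).add
        ((continuous_const.sub (continuous_cutoff T)).mul ((continuous_outData cG).comp (by fun_prop)))
      cont_source := cG
      source_neg := fun ξ τ hτ => extField_neg h0 ξ hτ
      source_late := fun ξ τ hτ => extField_late h1 ξ hτ
      data_in := fun s hs => by
        simp only [hψ]
        rw [cutoff_of_le hT hs, min_eq_left hs]; ring
      data_out := fun s hs => by
        simp only [hψ]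
        rw [cutoff_of_ge hT hs, max_eq_left hs]; ring }
  refine ⟨explicitQuad hn.cont_data hn.cont_source, hn.explicitQuad_mem_nullSpace,
    explicitQuad_box w _, fun μ K hμ hK hw => ?_⟩
  have hin : ∀ s, |inData G (min s 1)| ≤ 1 / 2 * (K * Real.exp μ / μ) := fun s =>
    hw.abs_inData_le hn hT hμ hK (min_le_right _ _)
  have hout : ∀ s, |outData G (max s (T - 1))| ≤ 1 / 2 * (K * Real.exp μ / μ) := fun s => by
    rw [outData_eq_reverse G T]
    exact hw.reverse.abs_inData_le hn.reverse hT hμ hK (by linarith [le_max_right s (T - 1)])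
  have hst := hw.state hn hT hμ hK fun s => abs_cutoff_combination_le (hin s) (hout s)
  constructor
  · have e : ∀ x ∈ Icc (0 : ℝ) 1, ∀ t ∈ Icc 0 T,
        extField (fieldL (explicitQuad (T := T) hn.cont_data hn.cont_source)) x t
        = ∫ ξ in (0 : ℝ)..x, (waveA ψ G ξ t + waveB ψ G ξ t) := by
      intro x hx t ht
      have h := extField_coe (fieldL (explicitQuad (T := T) hn.cont_data hn.cont_source)) ⟨t, ht⟩ ⟨x, hx⟩
      refine h.trans ?_
      rw [fieldL_apply, explicitQuad_state_apply]
    exact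
      { all := fun x hx t ht => by rw [e x hx t ht]; exact hst.all x hx t ht
        early := fun x hx t ht hxt => by rw [e x hx t ht]; exact hst.early x hx t ht hxt
        late := fun x hx t ht hxt => by rw [e x hx t ht]; exact hst.late x hx t ht hxt }
  · set S := K * Real.exp (3 * μ) with hS
    have hS0 : 0 ≤ S := by positivity
    have hwS : ‖w‖ ≤ S := by
      rw [Field.norm_le_iff hS0]
      intro t x
      rw [← extField_coe]
      refine (hw.all x x.2 t t.2).trans (mul_le_mul_of_nonneg_left (Real.exp_le_exp.2 ?_) hK)
      nlinarith [x.2.2]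
    have hGS : ∀ ξ τ, |G ξ τ| ≤ S := fun ξ τ => (abs_extField_le w ξ τ).trans hwS
    have hψS : ∀ s, |ψ s| ≤ 1 / 2 * S := fun s =>
      abs_cutoff_combination_le (abs_inData_le_of_bound hGS _) (abs_outData_le_of_bound hGS _)
    have hbox : ‖(explicitQuad (T := T) hn.cont_data hn.cont_source).2.2.1‖ ≤ √T * S := by
      rw [explicitQuad_box]
      exact (norm_srcL_le w).trans (mul_le_mul_of_nonneg_left hwS (Real.sqrt_nonneg _))
    have hctrl : ‖(explicitQuad (T := T) hn.cont_data hn.cont_source).2.2.2‖ ≤ √T * (2 * S) := by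
      refine (norm_toTimeL2_le _).trans (mul_le_mul_of_nonneg_left ?_ (Real.sqrt_nonneg _))
      refine (ContinuousMap.norm_le _ (by positivity)).2 fun t => ?_
      change |waveA ψ G 1 t + waveB ψ G 1 t| ≤ _
      rw [IsNullData.control_eq]
      have a1 := hψS (t + 1)
      have a2 := hψS (t - 1)
      have a3 := abs_inData_le_of_bound hGS (t + 1)
      have a4 := abs_outData_le_of_bound hGS (t - 1)
      rw [abs_le] at *
      constructor <;> linarith [a1.1, a1.2, a2.1, a2.2, a3.1, a3.2, a4.1, a4.2]
    refine (hbound _ hn.explicitQuad_mem_nullSpace).trans ?_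
    calc C * (‖(explicitQuad (T := T) hn.cont_data hn.cont_source).2.2.1‖
          + ‖(explicitQuad (T := T) hn.cont_data hn.cont_source).2.2.2‖)
        ≤ C * (√T * S + √T * (2 * S)) := mul_le_mul_of_nonneg_left (add_le_add hbox hctrl) (by linarith)
      _ = _ := by ring

theorem sq_integral_le_integral_sq {h : ℝ → ℝ} (hh : Continuous h) :
    (∫ ξ in (0 : ℝ)..1, h ξ) ^ 2 ≤ ∫ ξ in (0 : ℝ)..1, h ξ ^ 2 := by
  set c := ∫ ξ in (0 : ℝ)..1, h ξ with hc
  have h1 : 0 ≤ ∫ ξ in (0 : ℝ)..1, (h ξ - c) ^ 2 :=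
    intervalIntegral.integral_nonneg zero_le_one fun ξ _ => sq_nonneg _
  have e : ∀ ξ, (h ξ - c) ^ 2 = h ξ ^ 2 - 2 * c * h ξ + c ^ 2 := fun ξ => by ring
  simp only [e] at h1
  have i1 : IntervalIntegrable (fun ξ => h ξ ^ 2) volume 0 1 := (hh.pow 2).intervalIntegrable _ _
  have i2 : IntervalIntegrable (fun ξ => 2 * c * h ξ) volume 0 1 :=
    (hh.intervalIntegrable _ _).const_mul _
  rw [intervalIntegral.integral_add (i1.sub i2) (by simp), intervalIntegral.integral_sub i1 i2,
    intervalIntegral.integral_const_mul, ← hc] at h1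
  simp only [intervalIntegral.integral_const, sub_zero, one_smul] at h1
  nlinarith

theorem intervalIntegral_swap_of_continuous {F : ℝ → ℝ → ℝ} (hF : Continuous F.uncurry) (a b c d : ℝ) :
    ∫ x in a..b, ∫ y in c..d, F x y = ∫ y in c..d, ∫ x in a..b, F x y :=
  intervalIntegral_intervalIntegral_swap
    ((hF.continuousOn.integrableOn_compact (isCompact_uIcc.prod isCompact_uIcc)).mono_set
      (prod_mono uIoc_subset_uIcc uIoc_subset_uIcc))

theorem integral_inData_sq_le {T : ℝ} {G : ℝ → ℝ → ℝ} (hT : 0 ≤ T) (hG : Continuous G.uncurry)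
    (h0 : ∀ ξ τ, τ ≤ 0 → G ξ τ = 0) (h1 : ∀ ξ τ, T ≤ τ → G ξ τ = 0) :
    ∫ s in (-1 : ℝ)..(T + 1), inData G s ^ 2
      ≤ 1 / 4 * ∫ t in (0 : ℝ)..T, ∫ x in (0 : ℝ)..1, G x t ^ 2 := by
  have hG2 : Continuous (Function.uncurry fun x t => G x t ^ 2) := hG.pow 2
  have c1 : Continuous (Function.uncurry fun s ξ => G ξ (s - ξ) ^ 2) :=
    hG2.comp (by fun_prop : Continuous fun q : ℝ × ℝ => (q.2, q.1 - q.2))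
  have hin : ∀ s, inData G s ^ 2 ≤ 1 / 4 * ∫ ξ in (0 : ℝ)..1, G ξ (s - ξ) ^ 2 := by
    intro s
    have hc : Continuous fun ξ => G ξ (s - ξ) :=
      hG.comp (by fun_prop : Continuous fun ξ : ℝ => (ξ, s - ξ))
    have := sq_integral_le_integral_sq hc
    rw [inData, mul_pow]
    linarith
  have hcin : Continuous fun s => 1 / 4 * ∫ ξ in (0 : ℝ)..1, G ξ (s - ξ) ^ 2 :=
    continuous_const.mul
      (intervalIntegral.continuous_parametric_intervalIntegral_of_continuous' c1 0 1)
  refine (intervalIntegral.integral_mono (by linarith)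
    (((continuous_inData hG).pow 2).intervalIntegrable _ _) (hcin.intervalIntegrable _ _) hin).trans ?_
  rw [intervalIntegral.integral_const_mul]
  refine mul_le_mul_of_nonneg_left (le_of_eq ?_) (by norm_num)
  rw [intervalIntegral_swap_of_continuous c1,
    intervalIntegral_swap_of_continuous (F := fun t x => G x t ^ 2)
      (hG2.comp (by fun_prop : Continuous fun q : ℝ × ℝ => (q.2, q.1)))]
  refine intervalIntegral.integral_congr fun ξ hξ => ?_
  rw [uIcc_of_le zero_le_one] at hξ
  have hc : Continuous fun τ => G ξ τ ^ 2 :=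
    hG2.comp (by fun_prop : Continuous fun τ : ℝ => (ξ, τ))
  have i := fun a b => hc.intervalIntegrable (μ := volume) a b
  change ∫ s in (-1 : ℝ)..(T + 1), G ξ (s - ξ) ^ 2 = ∫ t in (0 : ℝ)..T, G ξ t ^ 2
  rw [intervalIntegral.integral_comp_sub_right (fun τ => G ξ τ ^ 2),
    ← intervalIntegral.integral_add_adjacent_intervals (i (-1 - ξ) 0) (i 0 (T + 1 - ξ)),
    ← intervalIntegral.integral_add_adjacent_intervals (i 0 T) (i T (T + 1 - ξ))]
  have z1 : ∫ τ in (-1 - ξ)..0, G ξ τ ^ 2 = 0 := by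
    rw [intervalIntegral.integral_congr (g := fun _ => 0)]
    · simp
    · intro τ hτ
      rw [uIcc_of_le (by linarith [hξ.1])] at hτ
      simp [h0 ξ τ hτ.2]
  have z2 : ∫ τ in T..(T + 1 - ξ), G ξ τ ^ 2 = 0 := by
    rw [intervalIntegral.integral_congr (g := fun _ => 0)]
    · simp
    · intro τ hτ
      rw [uIcc_of_le (by linarith [hξ.2])] at hτ
      simp [h1 ξ τ hτ.1]
  rw [z1, z2]; ring

/-- Null control with a continuous source, bounded by the `L²` norm of the source. -/
theorem exists_nullControl_L2 (T : ℝ) [hF : Fact (0 < T)] (hT : 2 < T) :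
    ∃ C : ℝ, 0 < C ∧ ∀ w : Field T, w (t0 T) = 0 → w (t1 T) = 0 →
      ∃ g ∈ nullSpace T, g.2.2.1 = srcL w ∧ ‖g‖ ≤ C * ‖srcL w‖ := by
  obtain ⟨C, hC, hbound⟩ := exists_null_bound T
  refine ⟨C * (1 + √8), by positivity, fun w h0 h1 => ?_⟩
  set G := extField w with hG
  set ψ : ℝ → ℝ := fun s => cutoff T s * inData G s + (1 - cutoff T s) * outData G s with hψ
  have cG := continuous_extField w
  have cin := continuous_inData cG
  have cout := continuous_outData cG
  have hn : IsNullData T ψ G :=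
    { cont_data := ((continuous_cutoff T).mul cin).add
        ((continuous_const.sub (continuous_cutoff T)).mul cout)
      cont_source := cG
      source_neg := fun ξ τ hτ => extField_neg h0 ξ hτ
      source_late := fun ξ τ hτ => extField_late h1 ξ hτ
      data_in := fun s hs => by
        simp only [hψ]
        rw [cutoff_of_le hT hs]; ring
      data_out := fun s hs => by
        simp only [hψ]
        rw [cutoff_of_ge hT hs]; ring }
  refine ⟨explicitQuad hn.cont_data hn.cont_source, hn.explicitQuad_mem_nullSpace,
    explicitQuad_box w _, ?_⟩
  have hTpos : 0 < T := hF.out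
  set D := ‖srcL w‖ ^ 2 with hD
  have hDin : ∫ s in (-1 : ℝ)..(T + 1), inData G s ^ 2 ≤ 1 / 4 * D := by
    rw [hD, norm_srcL_sq]
    exact integral_inData_sq_le hTpos.le cG hn.source_neg hn.source_late
  have hDout : ∫ s in (-1 : ℝ)..(T + 1), outData G s ^ 2 ≤ 1 / 4 * D := by
    have hr := integral_inData_sq_le hTpos.le hn.reverse.cont_source hn.reverse.source_neg
      hn.reverse.source_late
    have e1 : ∫ t in (0 : ℝ)..T, ∫ x in (0 : ℝ)..1, G x (T - t) ^ 2
        = ∫ t in (0 : ℝ)..T, ∫ x in (0 : ℝ)..1, G x t ^ 2 := by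
      rw [intervalIntegral.integral_comp_sub_left (fun t => ∫ x in (0 : ℝ)..1, G x t ^ 2)]
      simp
    have e2 : ∫ s in (-1 : ℝ)..(T + 1), outData G s ^ 2
        = ∫ s in (-1 : ℝ)..(T + 1), inData (fun ξ τ => G ξ (T - τ)) s ^ 2 := by
      simp only [outData_eq_reverse G T]
      rw [intervalIntegral.integral_comp_sub_left
        (fun s => inData (fun ξ τ => G ξ (T - τ)) s ^ 2)]
      congr 1 <;> ring
    rw [e2, hD, norm_srcL_sq, ← e1]
    exact hr
  set Q : ℝ → ℝ := fun s => inData G s ^ 2 + outData G s ^ 2 with hQ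
  have cQ : Continuous Q := (cin.pow 2).add (cout.pow 2)
  have hQ0 : ∀ s, 0 ≤ Q s := fun s => by positivity
  have hQint : ∫ s in (-1 : ℝ)..(T + 1), Q s ≤ 1 / 2 * D := by
    have i1 : IntervalIntegrable (fun s => inData G s ^ 2) volume (-1) (T + 1) :=
      (cin.pow 2).intervalIntegrable _ _
    have i2 : IntervalIntegrable (fun s => outData G s ^ 2) volume (-1) (T + 1) :=
      (cout.pow 2).intervalIntegrable _ _
    rw [hQ, intervalIntegral.integral_add i1 i2]
    linarith
  have hv : ∀ t, (waveA ψ G 1 t + waveB ψ G 1 t) ^ 2 ≤ 8 * Q (t + 1) + 8 * Q (t - 1) := by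
    intro t
    rw [IsNullData.control_eq]
    have a1 : ψ (t + 1) ^ 2 ≤ Q (t + 1) := sq_cutoff_combination_le
    have a2 : ψ (t - 1) ^ 2 ≤ Q (t - 1) := sq_cutoff_combination_le
    have a3 : inData G (t + 1) ^ 2 ≤ Q (t + 1) := le_add_of_nonneg_right (sq_nonneg _)
    have a4 : outData G (t - 1) ^ 2 ≤ Q (t - 1) := le_add_of_nonneg_left (sq_nonneg _)
    have key : ∀ a b c d : ℝ, (a + b - c - d) ^ 2 ≤ 4 * (a ^ 2 + b ^ 2 + c ^ 2 + d ^ 2) := by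
      intro a b c d
      nlinarith [sq_nonneg (a - b), sq_nonneg (a + c), sq_nonneg (a + d), sq_nonneg (b + c),
        sq_nonneg (b + d), sq_nonneg (c - d)]
    have := key (ψ (t + 1)) (ψ (t - 1)) (inData G (t + 1)) (outData G (t - 1))
    have b1 := hQ0 (t + 1)
    have b2 := hQ0 (t - 1)
    linarith
  have hshift : ∀ c, -1 ≤ c → c ≤ 1 → ∫ t in (0 : ℝ)..T, Q (t + c) ≤ 1 / 2 * D := by
    intro c hc1 hc2
    rw [intervalIntegral.integral_comp_add_right]
    refine le_trans ?_ hQint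
    exact intervalIntegral.integral_mono_interval (by linarith) (by linarith) (by linarith)
      (Eventually.of_forall hQ0) (cQ.intervalIntegrable _ _)
  have hctrl : ‖(explicitQuad (T := T) hn.cont_data hn.cont_source).2.2.2‖ ^ 2 ≤ 8 * D := by
    have cv : Continuous fun t => waveA ψ G 1 t + waveB ψ G 1 t :=
      ((continuous_waveA hn.cont_data cG).comp (by fun_prop : Continuous fun t : ℝ => ((1 : ℝ), t))).add
        ((continuous_waveB hn.cont_data cG).comp (by fun_prop : Continuous fun t : ℝ => ((1 : ℝ), t)))
    have e : ‖(explicitQuad (T := T) hn.cont_data hn.cont_source).2.2.2‖ ^ 2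
        = ∫ t in (0 : ℝ)..T, (waveA ψ G 1 t + waveB ψ G 1 t) ^ 2 := by
      rw [TimeL2.norm_sq_eq, intervalIntegral_eq_timeMeasure hTpos.le]
      refine integral_congr_ae ?_
      have hc : ((explicitQuad (T := T) hn.cont_data hn.cont_source).2.2.2 : ℝ → ℝ)
          =ᵐ[timeMeasure T] fun t => waveA ψ G 1 (tproj T t) + waveB ψ G 1 (tproj T t) :=
        toTimeL2_coe _
      filter_upwards [hc, ae_restrict_mem measurableSet_Icc] with t ht htm
      rw [ht, tproj_of_mem htm, Real.norm_eq_abs, sq_abs]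
    have j : ∀ c : ℝ, IntervalIntegrable (fun t => 8 * Q (t + c)) volume 0 T := fun c =>
      (continuous_const.mul (cQ.comp (continuous_id.add continuous_const))).intervalIntegrable _ _
    have hle : ∫ t in (0 : ℝ)..T, (waveA ψ G 1 t + waveB ψ G 1 t) ^ 2
        ≤ ∫ t in (0 : ℝ)..T, (8 * Q (t + 1) + 8 * Q (t + -1)) :=
      intervalIntegral.integral_mono hTpos.le ((cv.pow 2).intervalIntegrable _ _)
        ((j 1).add (j (-1))) fun t => hv t
    rw [intervalIntegral.integral_add (j 1) (j (-1)), intervalIntegral.integral_const_mul,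
      intervalIntegral.integral_const_mul] at hle
    rw [e]
    linarith [hshift 1 (by norm_num) le_rfl, hshift (-1) le_rfl (by norm_num)]
  have hctrl2 : ‖(explicitQuad (T := T) hn.cont_data hn.cont_source).2.2.2‖ ≤ √8 * ‖srcL w‖ := by
    refine abs_le_of_sq_le_sq' ?_ (by positivity) |>.2
    rw [mul_pow, Real.sq_sqrt (by norm_num)]
    exact hctrl
  refine (hbound _ hn.explicitQuad_mem_nullSpace).trans ?_
  rw [explicitQuad_box, mul_assoc]
  exact mul_le_mul_of_nonneg_left (by linarith) (by linarith)

end Step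

section Linear

variable {T : ℝ} [hF : Fact (0 < T)]

/-- The zeroth order term `g ↦ A y`. -/
def potL (A : Field T) : Quad T →L[ℝ] TimeL2 T L2 :=
  srcL.comp ((ContinuousLinearMap.mul ℝ (Field T) A).comp fieldL)

theorem potL_apply (A : Field T) (g : Quad T) : potL A g = srcL (A * fieldL g) := rfl

/-- The linearized operator `g ↦ ∂ₜₜy - ∂ₓₓy + A y`. -/
def linL (A : Field T) : Quad T →L[ℝ] TimeL2 T L2 := boxL + potL A

theorem linL_apply (A : Field T) (g : Quad T) : linL A g = g.2.2.1 + srcL (A * fieldL g) := rfl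

theorem WeightBound.of_norm_le {Y : Field T} {μ K : ℝ} (hμ : 0 ≤ μ) (h : ‖Y‖ ≤ K) :
    WeightBound T μ K (extField Y) := by
  have key : ∀ x t e : ℝ, 0 ≤ e → |extField Y x t| ≤ K * Real.exp (μ * e) := by
    intro x t e he
    have h1 := (abs_extField_le Y x t).trans h
    have h2 : 1 ≤ Real.exp (μ * e) := Real.one_le_exp (mul_nonneg hμ he)
    nlinarith [norm_nonneg Y]
  exact ⟨fun x hx t _ => key x t _ (by linarith [hx.1]), fun x _ t ht _ => key x t _ ht.1,
    fun x _ t ht _ => key x t _ (by linarith [ht.2])⟩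

theorem WeightBound.neg_mul {A Y : Field T} {μ K m : ℝ} (hA : ‖A‖ ≤ m)
    (h : WeightBound T μ K (extField Y)) : WeightBound T μ (m * K) (extField (-(A * Y))) := by
  have key : ∀ x t e : ℝ, |extField Y x t| ≤ K * e → |extField (-(A * Y)) x t| ≤ m * K * e := by
    intro x t e he
    have e1 : extField (-(A * Y)) x t = -(extField A x t * extField Y x t) := rfl
    rw [e1, abs_neg, abs_mul, mul_assoc]
    exact mul_le_mul ((abs_extField_le A x t).trans hA) he (abs_nonneg _)
      ((norm_nonneg A).trans hA)
  exact ⟨fun x hx t ht => key _ _ _ (h.all x hx t ht),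
    fun x hx t ht hxt => key _ _ _ (h.early x hx t ht hxt),
    fun x hx t ht hxt => key _ _ _ (h.late x hx t ht hxt)⟩

theorem fieldL_t0 {g : Quad T} (hg : g ∈ nullSpace T) : fieldL g (t0 T) = 0 := by
  have h := (mem_nullSpace_iff.1 hg).2.1.1
  change H10.valL (g.1 (t0 T)) = 0
  rw [h, map_zero]

theorem fieldL_t1 {g : Quad T} (hg : g ∈ nullSpace T) : fieldL g (t1 T) = 0 := by
  have h := (mem_nullSpace_iff.1 hg).2.2.1
  change H10.valL (g.1 (t1 T)) = 0
  rw [h, map_zero]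

/-- Null control of the linearized equation with a continuous source. -/
theorem exists_nullControl_continuous (T : ℝ) [hF : Fact (0 < T)] (hT : 2 < T) :
    ∃ C : ℝ, 0 < C ∧ ∀ (A : Field T) (m : ℝ), 0 < m → ‖A‖ ≤ m →
      ∀ B : Field T, B (t0 T) = 0 → B (t1 T) = 0 →
        ∃ g ∈ nullSpace T, linL A g = srcL B ∧
          ‖g‖ ≤ C * (1 + m * Real.exp (6 * √m)) * ‖srcL B‖ := by
  obtain ⟨C₀, hC₀, h₀⟩ := exists_nullControl_L2 T hT
  obtain ⟨C₁, hC₁, h₁⟩ := exists_nullControl_weighted T hT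
  refine ⟨C₀ * (1 + 2 * C₁), by positivity, fun A m hm hA B hB0 hB1 => ?_⟩
  choose! S hSmem hSbox hSw using h₁
  obtain ⟨g₀, hg₀, hbox₀, hn₀⟩ := h₀ B hB0 hB1
  let g : ℕ → Quad T := fun n => Nat.rec g₀ (fun _ h => S (-(A * fieldL h))) n
  have gsucc : ∀ n, g (n + 1) = S (-(A * fieldL (g n))) := fun n => rfl
  have z0 : ∀ h ∈ nullSpace T, (-(A * fieldL h)) (t0 T) = 0 := fun h hh => by
    change -(A (t0 T) * fieldL h (t0 T)) = 0
    rw [fieldL_t0 hh, mul_zero, neg_zero]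
  have z1 : ∀ h ∈ nullSpace T, (-(A * fieldL h)) (t1 T) = 0 := fun h hh => by
    change -(A (t1 T) * fieldL h (t1 T)) = 0
    rw [fieldL_t1 hh, mul_zero, neg_zero]
  have gmem : ∀ n, g n ∈ nullSpace T := by
    intro n
    induction n with
    | zero => exact hg₀
    | succ n ih => exact hSmem _ (z0 _ ih) (z1 _ ih)
  set μ := 2 * √m with hμ
  have hμ0 : 0 < μ := by positivity
  have hμ2 : μ ^ 2 = 4 * m := by rw [hμ, mul_pow, Real.sq_sqrt hm.le]; ring
  set M := ‖g₀‖ with hM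
  have hM0 : 0 ≤ M := norm_nonneg _
  have hw : ∀ n, WeightBound T μ (M * (1 / 2) ^ n) (extField (fieldL (g n))) := by
    intro n
    induction n with
    | zero =>
      rw [pow_zero, mul_one]
      exact WeightBound.of_norm_le hμ0.le (norm_fieldL_le g₀)
    | succ n ih =>
      have := (hSw _ (z0 _ (gmem n)) (z1 _ (gmem n)) μ (m * (M * (1 / 2) ^ n)) hμ0
        (by positivity) (ih.neg_mul hA)).1
      rw [gsucc]
      convert this using 1
      rw [hμ2]
      field_simp
      ring
  have hE : Real.exp (3 * μ) = Real.exp (6 * √m) := by rw [hμ]; ring_nf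
  have hnorm : ∀ n, ‖g (n + 1)‖ ≤ C₁ * (m * M * Real.exp (6 * √m)) * (1 / 2) ^ n := by
    intro n
    have := (hSw _ (z0 _ (gmem n)) (z1 _ (gmem n)) μ (m * (M * (1 / 2) ^ n)) hμ0
        (by positivity) ((hw n).neg_mul hA)).2
    rw [gsucc]
    refine this.trans (le_of_eq ?_)
    rw [hE]; ring
  set D := C₁ * (m * M * Real.exp (6 * √m)) with hD
  have hgeo : HasSum (fun n : ℕ => D * (1 / 2 : ℝ) ^ n) (D * 2) :=
    hasSum_geometric_two.mul_left D
  have hs1 : Summable fun n => g (n + 1) := hgeo.summable.of_norm_bounded hnorm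
  have hs : Summable g := (summable_nat_add_iff 1).1 hs1
  have hle1 : ‖∑' n, g (n + 1)‖ ≤ D * 2 := tsum_of_norm_bounded hgeo hnorm
  have hsplit : ∑' n, g n = g₀ + ∑' n, g (n + 1) := hs.tsum_eq_zero_add
  refine ⟨∑' n, g n, ?_, ?_, ?_⟩
  · exact isClosed_nullSpace.mem_of_tendsto hs.hasSum.tendsto_sum_nat
      (Eventually.of_forall fun n => Submodule.sum_mem _ fun i _ => gmem i)
  · have e1 : boxL (∑' n, g n) = srcL B + ∑' n, boxL (g (n + 1)) := by
      rw [hsplit, map_add, ContinuousLinearMap.map_tsum _ hs1]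
      congr 1
    have e2 : ∀ n, boxL (g (n + 1)) = -potL A (g n) := fun n => by
      have := hSbox _ (z0 _ (gmem n)) (z1 _ (gmem n))
      rw [gsucc, potL_apply, ← map_neg]
      exact this
    have e3 : ∑' n, boxL (g (n + 1)) = -potL A (∑' n, g n) := by
      simp only [e2]
      rw [tsum_neg, ContinuousLinearMap.map_tsum _ hs]
    change boxL _ + potL A _ = _
    rw [e1, e3]; abel
  · rw [hsplit]
    refine (norm_add_le _ _).trans ((add_le_add le_rfl hle1).trans ?_)
    have h1 : M ≤ C₀ * ‖srcL B‖ := hn₀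
    set Ex := m * Real.exp (6 * √m) with hEx
    have hEx0 : 0 ≤ Ex := by positivity
    have : M + D * 2 = M * (1 + 2 * C₁ * Ex) := by rw [hD, hEx]; ring
    rw [← hM, this]
    calc M * (1 + 2 * C₁ * Ex) ≤ (C₀ * ‖srcL B‖) * ((1 + 2 * C₁) * (1 + Ex)) := by
          refine mul_le_mul h1 ?_ (by positivity) (by positivity)
          nlinarith
      _ = _ := by ring

/-- Continuous sources that vanish at the initial and at the final time. -/
def zeroEnds (T : ℝ) [Fact (0 < T)] : Submodule ℝ (Field T) where
  carrier := {B | B (t0 T) = 0 ∧ B (t1 T) = 0}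
  zero_mem' := ⟨rfl, rfl⟩
  add_mem' := fun {B C} hB hC => ⟨by
    rw [ContinuousMap.add_apply, hB.1, hC.1, add_zero], by
    rw [ContinuousMap.add_apply, hB.2, hC.2, add_zero]⟩
  smul_mem' := fun c B hB => ⟨by
    rw [ContinuousMap.smul_apply, hB.1, smul_zero], by
    rw [ContinuousMap.smul_apply, hB.2, smul_zero]⟩

theorem closure_srcL_zeroEnds :
    ((zeroEnds T).map (srcL : Field T →L[ℝ] TimeL2 T L2).toLinearMap).topologicalClosure = ⊤ := by
  rw [Submodule.topologicalClosure_eq_top_iff, Submodule.eq_bot_iff]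
  intro h hh
  have hTpos : 0 < T := hF.out
  have hInt : IntegrableOn (fun t => h t) (Icc 0 T) volume := TimeL2.integrable h
  have key : ∀ᵐ t : ℝ, t ∈ Ioo 0 T → (h : ℝ → L2) t = 0 := by
    refine isOpen_Ioo.ae_eq_zero_of_integral_contDiff_smul_eq_zero
      (hInt.mono_set Ioo_subset_Icc_self).locallyIntegrableOn fun φ hφ hφc hφs => ?_
    have hz : ∀ t, t ∉ Ioo 0 T → φ t = 0 := fun t ht => by
      by_contra hne
      exact ht (hφs (subset_tsupport φ hne))
    have e1 : ∫ t, φ t • (h : ℝ → L2) t = ∫ t, φ t • h t ∂(timeMeasure T) := by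
      refine (setIntegral_eq_integral_of_forall_compl_eq_zero fun t ht => ?_).symm
      rw [hz t fun h' => ht (Ioo_subset_Icc_self h'), zero_smul]
    rw [e1]
    have hInt₂ : Integrable (fun t => φ t • (h : ℝ → L2) t) (timeMeasure T) := by
      obtain ⟨C, hC⟩ := hφc.exists_bound_of_continuous hφ.continuous
      exact (TimeL2.integrable h).bdd_smul C hφ.continuous.aestronglyMeasurable
        (Eventually.of_forall hC)
    set u := ∫ t, φ t • h t ∂(timeMeasure T) with hu
    have orth : ∀ c : C(I, ℝ), inner ℝ (cL2 c) u = 0 := by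
      intro c
      let B : Field T := ⟨fun t => φ t • c,
        (hφ.continuous.comp continuous_subtype_val).smul continuous_const⟩
      have hB : B ∈ zeroEnds T := by
        constructor
        · change φ 0 • c = 0
          rw [hz 0 (by simp), zero_smul]
        · change φ T • c = 0
          rw [hz T (by simp), zero_smul]
      have h0 := hh (srcL B) ⟨B, hB, rfl⟩
      rw [MeasureTheory.L2.inner_def] at h0
      rw [hu, ← integral_inner hInt₂, ← h0]
      refine integral_congr_ae ?_
      filter_upwards [srcL_coe B, ae_restrict_mem measurableSet_Icc] with t ht htm
      rw [ht, tproj_of_mem htm]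
      change inner ℝ (cL2 c) (φ t • h t) = inner ℝ (cL2 (φ t • c)) (h t)
      rw [map_smul, real_inner_smul_left, real_inner_smul_right]
    have : ∀ w : L2, inner ℝ w u = 0 := fun w =>
      cL2_dense.induction_on (p := fun w => inner ℝ w u = 0) w
        (isClosed_eq (by fun_prop) continuous_const) orth
    exact inner_self_eq_zero.1 (this u)
  refine Lp.ext ?_
  have hz : ∀ᵐ t ∂(timeMeasure T), t ∈ Ioo 0 T := by
    change ∀ᵐ t ∂(volume.restrict (Icc 0 T)), t ∈ Ioo 0 T
    rw [← restrict_Ioo_eq_restrict_Icc]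
    exact ae_restrict_mem measurableSet_Ioo
  filter_upwards [ae_restrict_of_ae key, hz,
    Lp.coeFn_zero L2 2 (timeMeasure T)] with t h1 h2 h3
  rw [h1 h2, h3]; rfl

/-- Null control of the linearized equation with a square integrable source. -/
theorem exists_nullControl (T : ℝ) [hF : Fact (0 < T)] (hT : 2 < T) :
    ∃ C : ℝ, 0 < C ∧ ∀ (A : Field T) (m : ℝ), 0 < m → ‖A‖ ≤ m → ∀ B : TimeL2 T L2,
        ∃ g ∈ nullSpace T, linL A g = B ∧ ‖g‖ ≤ C * (1 + m * Real.exp (6 * √m)) * ‖B‖ := by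
  obtain ⟨C, hC, h⟩ := exists_nullControl_continuous T hT
  refine ⟨C + 1, by linarith, fun A m hm hA B => ?_⟩
  have : CompleteSpace (nullSpace T) := isClosed_nullSpace.completeSpace_coe
  let φ : NormedAddGroupHom (nullSpace T) (TimeL2 T L2) :=
    AddMonoidHom.mkNormedAddGroupHom ((linL A).toLinearMap.comp (nullSpace T).subtype).toAddMonoidHom
      ‖linL A‖ fun g => (linL A).le_opNorm (g : Quad T)
  let K := ((zeroEnds T).map (srcL : Field T →L[ℝ] TimeL2 T L2).toLinearMap)
  have hK : φ.SurjectiveOnWith K.toAddSubgroup (C * (1 + m * Real.exp (6 * √m))) := by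
    rintro _ ⟨B, hB, rfl⟩
    obtain ⟨g, hg, h1, h2⟩ := h A m hm hA B hB.1 hB.2
    exact ⟨⟨g, hg⟩, h1, h2⟩
  have hE : 0 ≤ m * Real.exp (6 * √m) := by positivity
  obtain ⟨g, h1, h2⟩ := controlled_closure_of_complete (ε := 1) (by positivity) one_pos hK B
    (by
      have : B ∈ K.topologicalClosure := by
        rw [closure_srcL_zeroEnds]; trivial
      exact this)
  refine ⟨g, g.2, h1, h2.trans (mul_le_mul_of_nonneg_right ?_ (norm_nonneg _))⟩
  nlinarith

end Linear

section Steering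

/-- Continuous functions on `[0,1]` that vanish at both ends. -/
def endZero : Submodule ℝ C(I, ℝ) where
  carrier := {c | c 0 = 0 ∧ c 1 = 0}
  zero_mem' := ⟨rfl, rfl⟩
  add_mem' := fun {a b} ha hb => ⟨by
    rw [ContinuousMap.add_apply, ha.1, hb.1, add_zero], by
    rw [ContinuousMap.add_apply, ha.2, hb.2, add_zero]⟩
  smul_mem' := fun r a ha => ⟨by
    rw [ContinuousMap.smul_apply, ha.1, smul_zero], by
    rw [ContinuousMap.smul_apply, ha.2, smul_zero]⟩

theorem closure_cL2_endZero : (endZero.map cL2.toLinearMap).topologicalClosure = ⊤ := by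
  rw [Submodule.topologicalClosure_eq_top_iff, Submodule.eq_bot_iff]
  intro h hh
  let θ : C(I, ℝ) := ⟨fun x => (x : ℝ) * (1 - x), by fun_prop⟩
  have hmem : MemLp (fun x => θ x * h x) 2 := by
    refine (Lp.memLp h).of_le_mul (c := ‖θ‖) (θ.continuous.aestronglyMeasurable.mul
      (Lp.aestronglyMeasurable h)) (Eventually.of_forall fun x => ?_)
    rw [norm_mul]
    exact mul_le_mul_of_nonneg_right (θ.norm_coe_le_norm x) (norm_nonneg _)
  have orth : ∀ c : C(I, ℝ), inner ℝ (hmem.toLp) (cL2 c) = 0 := by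
    intro c
    have hc : c * θ ∈ endZero := ⟨by simp [θ], by simp [θ]⟩
    have h0 := hh (cL2 (c * θ)) ⟨c * θ, hc, rfl⟩
    rw [real_inner_comm, inner_cL2_right] at h0
    rw [inner_cL2_right, ← h0]
    refine integral_congr_ae ?_
    filter_upwards [hmem.coeFn_toLp] with x hx
    rw [hx, ContinuousMap.mul_apply]; ring
  have hz : hmem.toLp = 0 := by
    have : ∀ w : L2, inner ℝ hmem.toLp w = 0 := fun w =>
      cL2_dense.induction_on (p := fun w => inner ℝ hmem.toLp w = 0) w
        (isClosed_eq (by fun_prop) continuous_const) orth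
    exact inner_self_eq_zero.1 (this _)
  have hne : ∀ᵐ x : I, θ x ≠ 0 := by
    have h01 : ({0, 1} : Set I).Countable := by simp
    have := h01.ae_notMem (μ := (volume : Measure I))
    filter_upwards [this] with x hx
    simp only [mem_insert_iff, mem_singleton_iff, not_or] at hx
    refine mul_ne_zero (fun e => hx.1 (Subtype.ext e)) fun e => hx.2 (Subtype.ext ?_)
    exact (sub_eq_zero.1 e).symm
  refine Lp.ext ?_
  have hz' : (fun x => θ x * h x) =ᵐ[volume] 0 := by
    filter_upwards [hmem.coeFn_toLp, Lp.coeFn_zero ℝ 2 (volume : Measure I)] with x h1 h2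
    rw [← h1, hz, h2]
  filter_upwards [hz', hne, Lp.coeFn_zero ℝ 2 (volume : Measure I)] with x h1 h2 h3
  rw [h3]
  exact (mul_eq_zero.1 h1).resolve_left h2

theorem ext01_of_le {c : C(I, ℝ)} (hc : c ∈ endZero) {s : ℝ} (hs : s ≤ 0) : ext01 c s = 0 :=
  (IccExtend_of_le_left _ _ hs).trans hc.1

theorem ext01_of_ge {c : C(I, ℝ)} (hc : c ∈ endZero) {s : ℝ} (hs : 1 ≤ s) : ext01 c s = 0 :=
  (IccExtend_of_right_le _ _ hs).trans hc.2

theorem continuous_ext01 (c : C(I, ℝ)) : Continuous (ext01 c) := c.continuous.Icc_extend'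

theorem norm_cL2_sq (c : C(I, ℝ)) : ‖cL2 c‖ ^ 2 = ∫ s in (0 : ℝ)..1, ext01 c s ^ 2 := by
  rw [← real_inner_self_eq_norm_sq, inner_cL2_cL2]
  refine integral_unit_eq_of_eqOn fun x => ?_
  rw [ext01_coe, sq]

theorem integral_ext01_sq_le {c : C(I, ℝ)} (hc : c ∈ endZero) {a b : ℝ} (hab : a ≤ b) :
    ∫ s in a..b, ext01 c s ^ 2 ≤ ‖cL2 c‖ ^ 2 := by
  have hcont : Continuous fun s => ext01 c s ^ 2 := (continuous_ext01 c).pow 2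
  have i := fun a b => hcont.intervalIntegrable (μ := volume) a b
  have h0 : 0 ≤ᵐ[volume.restrict (Ioc (min a 0) (max b 1))] fun s => ext01 c s ^ 2 :=
    Eventually.of_forall fun s => sq_nonneg _
  have h1 := intervalIntegral.integral_mono_interval (min_le_left a 0) hab (le_max_left b 1) h0 (i _ _)
  rw [norm_cL2_sq]
  refine h1.trans (le_of_eq ?_)
  rw [← intervalIntegral.integral_add_adjacent_intervals (i (min a 0) 0) (i 0 (max b 1)),
    ← intervalIntegral.integral_add_adjacent_intervals (i 0 1) (i 1 (max b 1))]
  have z1 : ∫ s in (min a 0)..0, ext01 c s ^ 2 = 0 := by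
    rw [intervalIntegral.integral_congr (g := fun _ => 0)]
    · simp
    · intro s hs
      rw [uIcc_of_le (min_le_right _ _)] at hs
      simp [ext01_of_le hc hs.2]
  have z2 : ∫ s in (1 : ℝ)..(max b 1), ext01 c s ^ 2 = 0 := by
    rw [intervalIntegral.integral_congr (g := fun _ => 0)]
    · simp
    · intro s hs
      rw [uIcc_of_le (le_max_right _ _)] at hs
      simp [ext01_of_ge hc hs.1]
  rw [z1, z2]; ring

variable {T : ℝ} [hF : Fact (0 < T)]

/-- A travelling profile, as a function of time. -/
def profile (c : C(I, ℝ)) (h : ℝ → ℝ) (hh : Continuous h) : C(Icc 0 T, ℝ) :=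
  ⟨fun t => ext01 c (h t), (continuous_ext01 c).comp (hh.comp continuous_subtype_val)⟩

theorem norm_toTimeL2_sq (u : ℝ → ℝ) (hu : Continuous u) :
    ‖toTimeL2 (⟨fun t => u t, hu.comp continuous_subtype_val⟩ : C(Icc 0 T, ℝ))‖ ^ 2
      = ∫ t in (0 : ℝ)..T, u t ^ 2 := by
  rw [TimeL2.norm_sq_eq, intervalIntegral_eq_timeMeasure hF.out.le]
  refine integral_congr_ae ?_
  filter_upwards [toTimeL2_coe (⟨fun t => u t, hu.comp continuous_subtype_val⟩ : C(Icc 0 T, ℝ)),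
    ae_restrict_mem measurableSet_Icc] with t ht htm
  rw [ht, tproj_of_mem htm, Real.norm_eq_abs, sq_abs]
  rfl

theorem norm_toTimeL2_profile_le {c : C(I, ℝ)} (hc : c ∈ endZero) {h : ℝ → ℝ} (hh : Continuous h)
    {k : ℝ} (hk : (∀ t, h t = t + k) ∨ ∀ t, h t = k - t) :
    ‖toTimeL2 (profile (T := T) c h hh)‖ ≤ ‖cL2 c‖ := by
  refine abs_le_of_sq_le_sq' ?_ (norm_nonneg _) |>.2
  refine (norm_toTimeL2_sq (fun t => ext01 c (h t)) ((continuous_ext01 c).comp hh)).trans_le ?_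
  have hT := hF.out
  rcases hk with hk | hk <;> simp only [hk]
  · rw [intervalIntegral.integral_comp_add_right (fun s => ext01 c s ^ 2)]
    exact integral_ext01_sq_le hc (by linarith)
  · rw [intervalIntegral.integral_comp_sub_left (fun s => ext01 c s ^ 2)]
    exact integral_ext01_sq_le hc (by linarith)

/-- Riemann invariants of the data at the initial and at the final time. -/
def endData : Quad T →L[ℝ] L2 × L2 × L2 × L2 :=
  let y := H10.dxL.toContinuousLinearMap
  let a := y.comp ((ContinuousMap.evalCLM ℝ (t0 T)).comp stateL)
  let b := (ContinuousMap.evalCLM ℝ (t0 T)).comp velL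
  let c := y.comp ((ContinuousMap.evalCLM ℝ (t1 T)).comp stateL)
  let d := (ContinuousMap.evalCLM ℝ (t1 T)).comp velL
  (a + b).prod ((a - b).prod ((c + d).prod (c - d)))

theorem endData_apply (g : Quad T) : endData g = ((g.1 (t0 T)).dx + g.2.1 (t0 T),
    (g.1 (t0 T)).dx - g.2.1 (t0 T), (g.1 (t1 T)).dx + g.2.1 (t1 T),
    (g.1 (t1 T)).dx - g.2.1 (t1 T)) := rfl

/-- Exact controllability of the wave equation, for a dense set of data. -/
theorem exists_steering_endZero (T : ℝ) [hF : Fact (0 < T)] (hT : 2 < T) :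
    ∃ C : ℝ, 0 < C ∧ ∀ a ∈ endZero, ∀ b ∈ endZero, ∀ c ∈ endZero, ∀ d ∈ endZero,
      ∃ g ∈ solSpace T, endData g = (cL2 a, cL2 b, cL2 c, cL2 d) ∧
        ‖g‖ ≤ C * (‖cL2 a‖ + ‖cL2 b‖ + ‖cL2 c‖ + ‖cL2 d‖) := by
  obtain ⟨C, hC, hbound⟩ := exists_energy_bound T
  refine ⟨C * 4 + 2, by positivity, fun a ha b hb c hc d hd => ?_⟩
  set ψ : ℝ → ℝ := fun s => 1 / 2 * (ext01 a s + ext01 b (-s) + ext01 c (s - T) + ext01 d (T - s))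
    with hψ
  have ea := continuous_ext01 a
  have eb := continuous_ext01 b
  have ec := continuous_ext01 c
  have ed := continuous_ext01 d
  have cψ : Continuous ψ := by fun_prop
  have cG : Continuous (Function.uncurry fun _ _ : ℝ => (0 : ℝ)) := continuous_const
  have wA : ∀ x t, waveA ψ (fun _ _ => 0) x t = ψ (t + x) := fun x t => by simp [waveA]
  have wB : ∀ x t, waveB ψ (fun _ _ => 0) x t = ψ (t - x) := fun x t => by simp [waveB]
  have p1 : ∀ x : I, ψ x = 1 / 2 * a x := fun x => by
    simp only [hψ]
    rw [ext01_coe, ext01_of_le hb (by linarith [x.2.1]), ext01_of_le hc (by linarith [x.2.2]),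
      ext01_of_ge hd (by linarith [x.2.2])]; ring
  have p2 : ∀ x : I, ψ (-x) = 1 / 2 * b x := fun x => by
    simp only [hψ]
    rw [neg_neg, ext01_coe, ext01_of_le ha (by linarith [x.2.1]), ext01_of_le hc (by linarith [x.2.1]),
      ext01_of_ge hd (by linarith [x.2.1])]; ring
  have p3 : ∀ x : I, ψ (T + x) = 1 / 2 * c x := fun x => by
    simp only [hψ]
    rw [show T + (x : ℝ) - T = x by ring, ext01_coe, ext01_of_ge ha (by linarith [x.2.1]),
      ext01_of_le hb (by linarith [x.2.1]), ext01_of_le hd (by linarith [x.2.1])]; ring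
  have p4 : ∀ x : I, ψ (T - x) = 1 / 2 * d x := fun x => by
    simp only [hψ]
    rw [show T - (T - (x : ℝ)) = x by ring, ext01_coe, ext01_of_ge ha (by linarith [x.2.2]),
      ext01_of_le hb (by linarith [x.2.2]), ext01_of_le hc (by linarith [x.2.1])]; ring
  set g : Quad T := explicitQuad cψ cG with hg
  have gs : g ∈ solSpace T := explicitQuad_mem _ _
  have d0 : (g.1 (t0 T)).dx = (1 / 2 : ℝ) • (cL2 a + cL2 b) := by
    rw [← map_add, ← map_smul]
    refine congrArg cL2 (ContinuousMap.ext fun x => ?_)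
    change waveA ψ _ x 0 + waveB ψ _ x 0 = 1 / 2 * (a x + b x)
    rw [wA, wB, zero_add, zero_sub, p1, p2]; ring
  have v0 : g.2.1 (t0 T) = (1 / 2 : ℝ) • (cL2 a - cL2 b) := by
    rw [← map_sub, ← map_smul]
    refine congrArg cL2 (ContinuousMap.ext fun x => ?_)
    change waveA ψ _ x 0 - waveB ψ _ x 0 = 1 / 2 * (a x - b x)
    rw [wA, wB, zero_add, zero_sub, p1, p2]; ring
  have d1 : (g.1 (t1 T)).dx = (1 / 2 : ℝ) • (cL2 c + cL2 d) := by
    rw [← map_add, ← map_smul]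
    refine congrArg cL2 (ContinuousMap.ext fun x => ?_)
    change waveA ψ _ x T + waveB ψ _ x T = 1 / 2 * (c x + d x)
    rw [wA, wB, p3, p4]; ring
  have v1 : g.2.1 (t1 T) = (1 / 2 : ℝ) • (cL2 c - cL2 d) := by
    rw [← map_sub, ← map_smul]
    refine congrArg cL2 (ContinuousMap.ext fun x => ?_)
    change waveA ψ _ x T - waveB ψ _ x T = 1 / 2 * (c x - d x)
    rw [wA, wB, p3, p4]; ring
  refine ⟨g, gs, ?_, ?_⟩
  · rw [endData_apply, d0, v0, d1, v1]
    refine Prod.ext ?_ (Prod.ext ?_ (Prod.ext ?_ ?_)) <;> module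
  set N := ‖cL2 a‖ + ‖cL2 b‖ + ‖cL2 c‖ + ‖cL2 d‖ with hN
  have na := norm_nonneg (cL2 a)
  have nb := norm_nonneg (cL2 b)
  have nc := norm_nonneg (cL2 c)
  have nd := norm_nonneg (cL2 d)
  have hy0 : ‖g.1 (t0 T)‖ ≤ N := by
    rw [H10.norm_eq, d0, norm_smul]
    have := norm_add_le (cL2 a) (cL2 b)
    norm_num; linarith
  have hv0 : ‖g.2.1 (t0 T)‖ ≤ N := by
    rw [v0, norm_smul]
    have := norm_sub_le (cL2 a) (cL2 b)
    norm_num; linarith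
  have hbox : g.2.2.1 = 0 := by
    refine Eq.trans (congrArg toTimeL2 (ContinuousMap.ext fun t => ?_)) (map_zero toTimeL2)
    refine Eq.trans ?_ (map_zero cL2)
    rfl
  have hpair : ∀ k : ℝ, ‖toTimeL2 (profile (T := T) a (fun t => t + k) (by fun_prop)
      + profile b (fun t => -k - t) (by fun_prop) + profile c (fun t => t + (k - T)) (by fun_prop)
      + profile d (fun t => (T - k) - t) (by fun_prop))‖ ≤ N := by
    intro k
    rw [map_add, map_add, map_add]
    refine (norm_add_le _ _).trans (add_le_add ((norm_add_le _ _).trans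
      (add_le_add ((norm_add_le _ _).trans (add_le_add ?_ ?_)) ?_)) ?_)
    · exact norm_toTimeL2_profile_le ha _ (.inl fun _ => rfl)
    · exact norm_toTimeL2_profile_le hb _ (.inr fun _ => rfl)
    · exact norm_toTimeL2_profile_le hc _ (.inl fun _ => rfl)
    · exact norm_toTimeL2_profile_le hd _ (.inr fun _ => rfl)
  have hctrl : ‖g.2.2.2‖ ≤ N := by
    have e : g.2.2.2 = (1 / 2 : ℝ) • toTimeL2 (profile (T := T) a (fun t => t + 1) (by fun_prop)
      + profile b (fun t => -1 - t) (by fun_prop) + profile c (fun t => t + (1 - T)) (by fun_prop)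
      + profile d (fun t => (T - 1) - t) (by fun_prop))
      + (1 / 2 : ℝ) • toTimeL2 (profile (T := T) a (fun t => t + -1) (by fun_prop)
      + profile b (fun t => - -1 - t) (by fun_prop) + profile c (fun t => t + (-1 - T)) (by fun_prop)
      + profile d (fun t => (T - -1) - t) (by fun_prop)) := by
      rw [← map_smul, ← map_smul, ← map_add]
      refine congrArg toTimeL2 (ContinuousMap.ext fun t => ?_)
      change waveA ψ _ 1 t + waveB ψ _ 1 t
        = 1 / 2 * (ext01 a (t + 1) + ext01 b (-1 - t) + ext01 c (t + (1 - T)) + ext01 d (T - 1 - t))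
        + 1 / 2 * (ext01 a (t + -1) + ext01 b (- -1 - t) + ext01 c (t + (-1 - T))
          + ext01 d (T - -1 - t))
      rw [wA, wB]
      simp only [hψ]
      ring_nf
    rw [e]
    refine (norm_add_le _ _).trans ?_
    rw [norm_smul, norm_smul]
    have h1 := hpair 1
    have h2 := hpair (-1)
    norm_num at h1 h2 ⊢
    linarith
  obtain ⟨b1, b2⟩ := hbound g gs
  have hN0 : 0 ≤ N := by positivity
  have hsum : ‖g.1 (t0 T)‖ + ‖g.2.1 (t0 T)‖ + ‖g.2.2.1‖ + ‖g.2.2.2‖ ≤ 4 * N := by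
    rw [hbox, norm_zero]; linarith
  have hCN : C * (‖g.1 (t0 T)‖ + ‖g.2.1 (t0 T)‖ + ‖g.2.2.1‖ + ‖g.2.2.2‖) ≤ (C * 4 + 2) * N := by
    have := mul_le_mul_of_nonneg_left hsum hC.le
    linarith
  have h3 : N ≤ (C * 4 + 2) * N := by nlinarith
  refine norm_prod_le_iff.2 ⟨b1.trans hCN, norm_prod_le_iff.2 ⟨b2.trans hCN,
    norm_prod_le_iff.2 ⟨?_, hctrl.trans h3⟩⟩⟩
  rw [hbox, norm_zero]; positivity

/-- Exact controllability of the wave equation. -/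
theorem exists_steering (T : ℝ) [hF : Fact (0 < T)] (hT : 2 < T) (u₀ : H10) (u₁ : L2) (z₀ : H10)
    (z₁ : L2) : ∃ g ∈ solSpace T, (g.1 (t0 T) = u₀ ∧ g.2.1 (t0 T) = u₁) ∧
      g.1 (t1 T) = z₀ ∧ g.2.1 (t1 T) = z₁ := by
  obtain ⟨C, hC, h⟩ := exists_steering_endZero T hT
  have : CompleteSpace (solSpace T) := isClosed_solSpace.completeSpace_coe
  let φ : NormedAddGroupHom (solSpace T) (L2 × L2 × L2 × L2) :=
    AddMonoidHom.mkNormedAddGroupHom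
      ((endData (T := T)).toLinearMap.comp (solSpace T).subtype).toAddMonoidHom
      ‖endData (T := T)‖ fun g => (endData (T := T)).le_opNorm (g : Quad T)
  let Z := endZero.map cL2.toLinearMap
  let K := Z.prod (Z.prod (Z.prod Z))
  have hK : φ.SurjectiveOnWith K.toAddSubgroup (C * 4) := by
    rintro ⟨_, _, _, _⟩ ⟨⟨a, ha, rfl⟩, ⟨b, hb, rfl⟩, ⟨c, hc, rfl⟩, ⟨d, hd, rfl⟩⟩
    obtain ⟨g, hg, h1, h2⟩ := h a ha b hb c hc d hd
    refine ⟨⟨g, hg⟩, h1, h2.trans ?_⟩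
    rw [mul_assoc]
    refine mul_le_mul_of_nonneg_left ?_ hC.le
    set P : L2 × L2 × L2 × L2 := (cL2 a, cL2 b, cL2 c, cL2 d) with hP
    change _ ≤ 4 * ‖P‖
    have n1 : ‖cL2 a‖ ≤ ‖P‖ := norm_fst_le P
    have n2 : ‖cL2 b‖ ≤ ‖P‖ := (norm_fst_le P.2).trans (norm_snd_le P)
    have n3 : ‖cL2 c‖ ≤ ‖P‖ := (norm_fst_le P.2.2).trans ((norm_snd_le P.2).trans (norm_snd_le P))
    have n4 : ‖cL2 d‖ ≤ ‖P‖ := (norm_snd_le P.2.2).trans ((norm_snd_le P.2).trans (norm_snd_le P))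
    linarith
  have hZ : closure (Z : Set L2) = univ := by
    rw [← Submodule.topologicalClosure_coe, closure_cL2_endZero]; rfl
  have hcl : closure (K : Set (L2 × L2 × L2 × L2)) = univ := by
    simp only [K, Submodule.prod_coe, closure_prod_eq, hZ, univ_prod_univ]
  obtain ⟨g, h1, -⟩ := controlled_closure_of_complete (ε := 1) (by positivity) one_pos hK
    (u₀.dx + u₁, u₀.dx - u₁, z₀.dx + z₁, z₀.dx - z₁)
    (by
      have : (u₀.dx + u₁, u₀.dx - u₁, z₀.dx + z₁, z₀.dx - z₁)
          ∈ closure (K : Set (L2 × L2 × L2 × L2)) := by rw [hcl]; trivial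
      exact this)
  have h2 : endData (g : Quad T) = (u₀.dx + u₁, u₀.dx - u₁, z₀.dx + z₁, z₀.dx - z₁) := h1
  rw [endData_apply] at h2
  have half : ∀ {a b c d : L2}, a + b = c + d → a - b = c - d → a = c ∧ b = d := by
    intro a b c d e1 e2
    have f1 : (2 : ℝ) • a = (2 : ℝ) • c := by
      rw [two_smul, two_smul]
      have := congrArg₂ (· + ·) e1 e2
      simpa using this
    have ha : a = c := smul_right_injective L2 (two_ne_zero' ℝ) f1
    exact ⟨ha, by rw [ha] at e1; exact add_left_cancel e1⟩
  have q := congrArg Prod.snd h2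
  have i0 := half (congrArg Prod.fst h2) (congrArg Prod.fst q)
  have i1 := half (congrArg (fun p => p.2.1) q) (congrArg (fun p => p.2.2) q)
  exact ⟨g, g.2, ⟨H10.dx_injective i0.1, i0.2⟩, H10.dx_injective i1.1, i1.2⟩

end Steering

section Bridge

variable {T : ℝ} [hF : Fact (0 < T)]

/-- The quadruple `g` represents the pair `p` on `[0,T]`. -/
structure Represents (g : Quad T) (p : Pair) : Prop where
  state : ∀ t : Icc 0 T, p.y t = g.1 t
  vel : ∀ t : Icc 0 T, p.dt t = g.2.1 t
  box : p.box =ᵐ[timeMeasure T] g.2.2.1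
  ctrl : p.v =ᵐ[timeMeasure T] g.2.2.2

/-- The pair given by a quadruple. -/
def pairOf (g : Quad T) : Pair :=
  ⟨fun t => g.1 (tproj T t), g.2.2.2, fun t => g.2.1 (tproj T t), g.2.2.1⟩

theorem represents_pairOf (g : Quad T) : Represents g (pairOf g) :=
  ⟨fun t => congrArg g.1 (tproj_coe t), fun t => congrArg g.2.1 (tproj_coe t), .rfl, .rfl⟩

theorem Represents.sub {T : ℝ} {g h : Quad T} {p q : Pair} (hp : Represents g p) (hq : Represents h q) :
    Represents (g - h) (p - q) where
  state := fun t => congrArg₂ (· - ·) (hp.state t) (hq.state t)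
  vel := fun t => congrArg₂ (· - ·) (hp.vel t) (hq.vel t)
  box := (hp.box.sub hq.box).trans (Lp.coeFn_sub _ _).symm
  ctrl := (hp.ctrl.sub hq.ctrl).trans (Lp.coeFn_sub _ _).symm

theorem Represents.smul {T : ℝ} {g : Quad T} {p : Pair} (c : ℝ) (hp : Represents g p) :
    Represents (c • g) (c • p) where
  state := fun t => congrArg (c • ·) (hp.state t)
  vel := fun t => congrArg (c • ·) (hp.vel t)
  box := (hp.box.const_smul c).trans (Lp.coeFn_smul _ _).symm
  ctrl := (hp.ctrl.const_smul c).trans (Lp.coeFn_smul _ _).symm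

theorem H10.inner_toL2 (z : H10) (w : L2) : inner ℝ z.toL2 w = ∫ x, w x * z x := by
  rw [real_inner_comm]
  exact inner_cL2_right w z.val

theorem H10.inner_dx (z : H10) (w : L2) : inner ℝ z.dx w = ∫ x, w x * z.dx x := by
  rw [real_inner_comm, L2.inner_eq]

theorem IsWeakSolution.mem_solSpace {F : ℝ → I → ℝ} {y : ℝ → H10} {yt : ℝ → L2} {v : ℝ → ℝ}
    (h : IsWeakSolution T F y yt v) {g : Quad T} (hy : ∀ t : Icc 0 T, y t = g.1 t)
    (hyt : ∀ t : Icc 0 T, yt t = g.2.1 t) (hv : v =ᵐ[timeMeasure T] g.2.2.2)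
    (hFB : ∀ᵐ t ∂(timeMeasure T), F t =ᵐ[volume] g.2.2.1 t) : g ∈ solSpace T := by
  have hT := hF.out
  have hy' : ∀ t ∈ Icc 0 T, y t = g.1 (tproj T t) := fun t ht => by
    rw [tproj_of_mem ht]; exact hy ⟨t, ht⟩
  have hyt' : ∀ t ∈ Icc 0 T, yt t = g.2.1 (tproj T t) := fun t ht => by
    rw [tproj_of_mem ht]; exact hyt ⟨t, ht⟩
  have e0 : y 0 = g.1 (t0 T) := hy (t0 T)
  have e0' : yt 0 = g.2.1 (t0 T) := hyt (t0 T)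
  refine mem_solSpace_iff'.2 ⟨fun t ht => ?_, fun t ht z => ?_⟩
  · have hsub : Icc 0 t ⊆ Icc 0 T := Icc_subset_Icc le_rfl ht.2
    have ci : IntervalIntegrable (fun s => g.2.1 (tproj T s)) volume 0 t :=
      (g.2.1.continuous.comp continuous_tproj).intervalIntegrable _ _
    have key := intervalIntegral.integral_eq_sub_of_hasDerivAt_of_le
      (f := fun s => (y s).toL2) (f' := fun s => g.2.1 (tproj T s)) ht.1
      (fun s hs => ((h.hasDeriv s (hsub hs)).continuousWithinAt).mono hsub)
      (fun s hs => by
        have hs' : s ∈ Icc 0 T := hsub (Ioo_subset_Icc_self hs)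
        rw [← hyt' s hs']
        exact (h.hasDeriv s hs').hasDerivAt (Icc_mem_nhds hs.1 (hs.2.trans_le ht.2))) ci
    rw [key, ← hy' t ht, ← e0]
    abel
  · obtain ⟨ytt, -, h1, h2⟩ := h.weak
    have h3 := h1 t ht z
    rw [← H10.inner_toL2, ← H10.inner_toL2, hyt' t ht, e0'] at h3
    rw [h3]
    congr 1
    refine intervalIntegral.integral_congr_ae ?_
    refine ae_timeMeasure_restrict_uIoc ht ?_
    filter_upwards [h2, hv, hFB, ae_restrict_mem measurableSet_Icc] with s hs hvs hFs hsm
    have := hs z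
    have eF : ∫ x, F s x * z x = inner ℝ z.toL2 (g.2.2.1 s) := by
      rw [H10.inner_toL2]
      refine integral_congr_ae ?_
      filter_upwards [hFs] with x hx
      rw [hx]
    rw [eF, ← H10.inner_dx, hvs, hy' s hsm] at this
    linarith

/-- The second time derivative of a weak solution. -/
def secondDeriv (g : Quad T) (s : ℝ) : StrongDual ℝ H10 :=
  (innerSL ℝ (g.2.2.1 s)).comp H10.toL2L + g.2.2.2 s • H10.evalL 1
    - (innerSL ℝ (g.1 (tproj T s)).dx).comp H10.dxL.toContinuousLinearMap

theorem secondDeriv_apply (g : Quad T) (s : ℝ) (z : H10) :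
    secondDeriv g s z = inner ℝ z.toL2 (g.2.2.1 s) + z 1 * g.2.2.2 s
      - inner ℝ z.dx (g.1 (tproj T s)).dx := by
  rw [real_inner_comm (g.2.2.1 s), real_inner_comm (g.1 (tproj T s)).dx, mul_comm]
  rfl

theorem memLp_secondDeriv (g : Quad T) : MemLp (secondDeriv g) 2 (timeMeasure T) := by
  refine MemLp.sub (MemLp.add ?_ ?_) ?_
  · exact (((ContinuousLinearMap.compL ℝ H10 L2 ℝ).flip H10.toL2L).comp (innerSL ℝ)).comp_memLp'
      (Lp.memLp g.2.2.1)
  · exact ((ContinuousLinearMap.toSpanSingleton ℝ (H10.evalL 1))).comp_memLp' (Lp.memLp g.2.2.2)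
  · have hc : Continuous fun s => (g.1 (tproj T s)).dx :=
      H10.dxL.continuous.comp (g.1.continuous.comp continuous_tproj)
    exact (((ContinuousLinearMap.compL ℝ H10 L2 ℝ).flip H10.dxL.toContinuousLinearMap).comp
      (innerSL ℝ)).comp_memLp' (memLp_of_continuous hc)

theorem isWeakSolution_of_mem_solSpace {F : ℝ → I → ℝ} {y : ℝ → H10} {yt : ℝ → L2} {v : ℝ → ℝ}
    {g : Quad T} (hg : g ∈ solSpace T) (hy : ∀ t : Icc 0 T, y t = g.1 t)
    (hyt : ∀ t : Icc 0 T, yt t = g.2.1 t) (hv : v =ᵐ[timeMeasure T] g.2.2.2)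
    (hFB : ∀ᵐ t ∂(timeMeasure T), F t =ᵐ[volume] g.2.2.1 t) : IsWeakSolution T F y yt v := by
  have hy' : ∀ t ∈ Icc 0 T, y t = g.1 (tproj T t) := fun t ht => by
    rw [tproj_of_mem ht]; exact hy ⟨t, ht⟩
  have hyt' : ∀ t ∈ Icc 0 T, yt t = g.2.1 (tproj T t) := fun t ht => by
    rw [tproj_of_mem ht]; exact hyt ⟨t, ht⟩
  have e0' : yt 0 = g.2.1 (t0 T) := hyt (t0 T)
  have cy : Continuous fun t => g.1 (tproj T t) := g.1.continuous.comp continuous_tproj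
  have cyt : Continuous fun t => g.2.1 (tproj T t) := g.2.1.continuous.comp continuous_tproj
  obtain ⟨h1, h2⟩ := mem_solSpace_iff'.1 hg
  refine ⟨cy.continuousOn.congr hy', cyt.continuousOn.congr hyt', fun t ht => ?_,
    (Lp.memLp g.2.2.2).ae_eq hv.symm, secondDeriv g, memLp_secondDeriv g, fun t ht z => ?_, ?_⟩
  · have hd : HasDerivWithinAt (fun s => (g.1 (t0 T)).toL2 + ∫ r in (0 : ℝ)..s, g.2.1 (tproj T r))
        (yt t) (Icc 0 T) t := by
      rw [hyt' t ht]
      exact ((cyt.integral_hasStrictDerivAt 0 t).hasDerivAt.const_add _).hasDerivWithinAt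
    refine hd.congr (fun s hs => ?_) ?_
    · rw [hy' s hs]; exact h1 s hs
    · rw [hy' t ht]; exact h1 t ht
  · rw [← H10.inner_toL2, ← H10.inner_toL2, hyt' t ht, e0', h2 t ht z]
    simp only [secondDeriv_apply]
  · filter_upwards [hv, hFB, ae_restrict_mem measurableSet_Icc] with s hvs hFs hsm z
    have eF : ∫ x, F s x * z x = inner ℝ z.toL2 (g.2.2.1 s) := by
      rw [H10.inner_toL2]
      refine integral_congr_ae ?_
      filter_upwards [hFs] with x hx
      rw [hx]
    rw [eF, ← H10.inner_dx, hvs, hy' s hsm, secondDeriv_apply]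
    ring

theorem eq_zero_of_itg {E : Type} [NormedAddCommGroup E] [NormedSpace ℝ E] [CompleteSpace E]
    {D : TimeL2 T E} (h : ∀ t ∈ Icc 0 T, itg t D = 0) : D = 0 := by
  have hT := hF.out
  have hd := (TimeL2.intervalIntegrable D (right_mem_Icc.2 hT.le)).ae_hasDerivAt_integral
  have hz : ∀ᵐ t ∂(timeMeasure T), t ∈ Ioo 0 T := by
    change ∀ᵐ t ∂(volume.restrict (Icc 0 T)), t ∈ Ioo 0 T
    rw [← restrict_Ioo_eq_restrict_Icc]
    exact ae_restrict_mem measurableSet_Ioo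
  refine Lp.ext ?_
  filter_upwards [ae_restrict_of_ae hd, hz, Lp.coeFn_zero E 2 (timeMeasure T)] with t h1 h2 h3
  rw [uIcc_of_le hT.le] at h1
  have d1 := h1 (Ioo_subset_Icc_self h2) 0 (left_mem_Icc.2 hT.le)
  have d2 : HasDerivAt (fun x => ∫ s in (0 : ℝ)..x, D s) 0 t := by
    refine (hasDerivAt_const t (0 : E)).congr_of_eventuallyEq ?_
    filter_upwards [Ioo_mem_nhds h2.1 h2.2] with s hs
    rw [← itg_eq (Ioo_subset_Icc_self hs) D, h s (Ioo_subset_Icc_self hs)]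
  rw [d1.unique d2, h3]; rfl

theorem box_unique {g h : Quad T} (hg : g ∈ solSpace T) (hh : h ∈ solSpace T) (hy : g.1 = h.1)
    (hyt : g.2.1 = h.2.1) (hv : g.2.2.2 = h.2.2.2) : g.2.2.1 = h.2.2.1 := by
  refine sub_eq_zero.1 (eq_zero_of_itg fun t ht => L2.eq_zero_of_inner_H10 fun z => ?_)
  have h1 := (mem_solSpace_iff.1 hg).2 ⟨t, ht⟩ z
  have h2 := (mem_solSpace_iff.1 hh).2 ⟨t, ht⟩ z
  rw [hy, hyt, hv] at h1
  rw [map_sub, real_inner_comm, inner_sub_right]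
  simp only at h1 h2
  linarith

theorem MemH.exists_represents {p : Pair} (h : MemH T p) : ∃ g ∈ solSpace T, Represents g p := by
  let g : Quad T := (⟨fun t => p.y t, h.sol.continuousOn_y.domRestrict⟩,
    ⟨fun t => p.dt t, h.sol.continuousOn_yt.domRestrict⟩, h.memLp_box.toLp, h.sol.memLp_v.toLp)
  have hr : Represents g p :=
    ⟨fun t => rfl, fun t => rfl, h.memLp_box.coeFn_toLp.symm, h.sol.memLp_v.coeFn_toLp.symm⟩
  refine ⟨g, h.sol.mem_solSpace hr.state hr.vel hr.ctrl ?_, hr⟩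
  filter_upwards [hr.box] with t ht
  rw [ht]

theorem Represents.memH {g : Quad T} {p : Pair} (hr : Represents g p) (hg : g ∈ solSpace T) :
    MemH T p := by
  refine ⟨(Lp.memLp g.2.2.1).ae_eq hr.box.symm,
    isWeakSolution_of_mem_solSpace hg hr.state hr.vel hr.ctrl ?_⟩
  filter_upwards [hr.box] with t ht
  rw [ht]

theorem Represents.memA {g : Quad T} {p : Pair} (hr : Represents g p) (hg : g ∈ solSpace T)
    {u₀ : H10} {u₁ : L2} {z₀ : H10} {z₁ : L2} (h : (g.1 (t0 T) = u₀ ∧ g.2.1 (t0 T) = u₁) ∧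
      g.1 (t1 T) = z₀ ∧ g.2.1 (t1 T) = z₁) : MemA T u₀ u₁ z₀ z₁ p :=
  ⟨hr.memH hg, ⟨(hr.state (t0 T)).trans h.1.1, (hr.vel (t0 T)).trans h.1.2⟩,
    (hr.state (t1 T)).trans h.2.1, (hr.vel (t1 T)).trans h.2.2⟩

theorem MemA.exists_represents {u₀ : H10} {u₁ : L2} {z₀ : H10} {z₁ : L2} {p : Pair}
    (h : MemA T u₀ u₁ z₀ z₁ p) : ∃ g ∈ solSpace T, Represents g p ∧
      (g.1 (t0 T) = u₀ ∧ g.2.1 (t0 T) = u₁) ∧ g.1 (t1 T) = z₀ ∧ g.2.1 (t1 T) = z₁ := by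
  obtain ⟨g, hg, hr⟩ := h.memH.exists_represents
  exact ⟨g, hg, hr, ⟨(hr.state (t0 T)).symm.trans h.init.1, (hr.vel (t0 T)).symm.trans h.init.2⟩,
    (hr.state (t1 T)).symm.trans h.final.1, (hr.vel (t1 T)).symm.trans h.final.2⟩

/-- The superposition operator `w ↦ f ∘ w`. -/
def nem {f : ℝ → ℝ} (hf : Continuous f) (w : Field T) : Field T :=
  ⟨fun t => (⟨f, hf⟩ : C(ℝ, ℝ)).comp (w t), (ContinuousMap.continuous_postcomp _).comp w.continuous⟩

theorem nem_apply {T : ℝ} {f : ℝ → ℝ} (hf : Continuous f) (w : Field T) (t : Icc 0 T) (x : I) :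
    nem hf w t x = f (w t x) := rfl

/-- The residual `∂ₜₜy - ∂ₓₓy + f(y)`. -/
def residual {f : ℝ → ℝ} (hf : Continuous f) (g : Quad T) : TimeL2 T L2 :=
  g.2.2.1 + srcL (nem hf (fieldL g))

theorem Represents.field_coe {g : Quad T} {p : Pair} (hr : Represents g p) {f : ℝ → ℝ}
    (hf : Continuous f) : ∀ᵐ t ∂(timeMeasure T),
      (srcL (nem hf (fieldL g)) t : I → ℝ) =ᵐ[volume] fun x => f (p.y t x) := by
  filter_upwards [srcL_coe (nem hf (fieldL g)), ae_restrict_mem measurableSet_Icc] with t ht htm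
  rw [ht, tproj_of_mem htm]
  filter_upwards [cL2_coe (nem hf (fieldL g) ⟨t, htm⟩)] with x hx
  rw [hx, nem_apply, fieldL_apply, ← hr.state]

theorem Represents.residual_coe {g : Quad T} {p : Pair} (hr : Represents g p) {f : ℝ → ℝ}
    (hf : Continuous f) : ∀ᵐ t ∂(timeMeasure T),
      (residual hf g t : I → ℝ) =ᵐ[volume] fun x => p.box t x + f (p.y t x) := by
  filter_upwards [hr.field_coe hf, hr.box,
    Lp.coeFn_add g.2.2.1 (srcL (nem hf (fieldL g)))] with t h1 h2 h3
  have h4 : residual hf g t = g.2.2.1 t + srcL (nem hf (fieldL g)) t := h3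
  rw [h4]
  filter_upwards [Lp.coeFn_add (g.2.2.1 t) (srcL (nem hf (fieldL g)) t), h1] with x e1 e2
  rw [e1, Pi.add_apply, e2, h2]

theorem Represents.energy_eq {g : Quad T} {p : Pair} (hr : Represents g p) {f : ℝ → ℝ}
    (hf : Continuous f) : energy T f p = 1 / 2 * ‖residual hf g‖ ^ 2 := by
  rw [energy, TimeL2.norm_sq_eq, intervalIntegral_eq_timeMeasure hF.out.le]
  congr 1
  refine integral_congr_ae ?_
  filter_upwards [hr.residual_coe hf] with t ht
  rw [L2.norm_sq_eq]
  refine integral_congr_ae ?_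
  filter_upwards [ht] with x hx
  rw [hx]

theorem integral_norm_toL2_sq {g : Quad T} {p : Pair} (hr : Represents g p) :
    ∫ t in (0 : ℝ)..T, ‖(p.y t).toL2‖ ^ 2 = ‖srcL (fieldL g)‖ ^ 2 := by
  rw [TimeL2.norm_sq_eq, intervalIntegral_eq_timeMeasure hF.out.le]
  refine integral_congr_ae ?_
  filter_upwards [srcL_coe (fieldL g), ae_restrict_mem measurableSet_Icc] with t ht htm
  rw [ht, tproj_of_mem htm, show p.y t = g.1 ⟨t, htm⟩ from hr.state ⟨t, htm⟩]
  rfl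

theorem integral_ctrl_sq {g : Quad T} {p : Pair} (hr : Represents g p) :
    ∫ t in (0 : ℝ)..T, (p.v t) ^ 2 = ‖g.2.2.2‖ ^ 2 := by
  rw [TimeL2.norm_sq_eq, intervalIntegral_eq_timeMeasure hF.out.le]
  refine integral_congr_ae ?_
  filter_upwards [hr.ctrl] with t ht
  rw [ht, Real.norm_eq_abs, sq_abs]

theorem Represents.cost_eq {g : Quad T} {p : Pair} (hr : Represents g p) :
    cost T p = ‖srcL (fieldL g)‖ ^ 2 + ‖g.2.2.2‖ ^ 2 := by
  rw [cost, integral_norm_toL2_sq hr, integral_ctrl_sq hr]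

theorem Represents.normH_eq {g : Quad T} {p : Pair} (hr : Represents g p) :
    normH T p = √(‖g.2.2.1‖ ^ 2 + ‖srcL (fieldL g)‖ ^ 2 + ‖g.2.2.2‖ ^ 2
      + (‖g.1 (t0 T)‖ ^ 2 + ‖g.2.1 (t0 T)‖ ^ 2)) := by
  have hb : ∫ t in (0 : ℝ)..T, ‖p.box t‖ ^ 2 = ‖g.2.2.1‖ ^ 2 := by
    rw [TimeL2.norm_sq_eq, intervalIntegral_eq_timeMeasure hF.out.le]
    refine integral_congr_ae ?_
    filter_upwards [hr.box] with t ht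
    rw [ht]
  have e0 : p.y 0 = g.1 (t0 T) := hr.state (t0 T)
  have e1 : p.dt 0 = g.2.1 (t0 T) := hr.vel (t0 T)
  rw [normH, integral_norm_toL2_sq hr, integral_ctrl_sq hr, hb, e0, e1]

/-- The source of the linearized equation. -/
theorem Represents.linearized_source_coe {g h : Quad T} {p q : Pair} (hp : Represents g p)
    (hq : Represents h q) {f f' : ℝ → ℝ} (hf : Continuous f) (hf' : Continuous f') :
    ∀ᵐ t ∂(timeMeasure T),
      (fun x => p.box t x + f (p.y t x) - f' (p.y t x) * q.y t x) =ᵐ[volume]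
        (residual hf g - srcL (nem hf' (fieldL g) * fieldL h) : TimeL2 T L2) t := by
  filter_upwards [hp.residual_coe hf, srcL_coe (nem hf' (fieldL g) * fieldL h),
    Lp.coeFn_sub (residual hf g) (srcL (nem hf' (fieldL g) * fieldL h)),
    ae_restrict_mem measurableSet_Icc] with t h1 h2 h3 htm
  rw [h3, Pi.sub_apply, h2, tproj_of_mem htm]
  filter_upwards [Lp.coeFn_sub (residual hf g t)
    (cL2 ((nem hf' (fieldL g) * fieldL h) ⟨t, htm⟩)), h1,
    cL2_coe ((nem hf' (fieldL g) * fieldL h) ⟨t, htm⟩)] with x e1 e2 e3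
  rw [e1, Pi.sub_apply, e2, e3]
  change _ = _ - f' (g.1 ⟨t, htm⟩ x) * h.1 ⟨t, htm⟩ x
  rw [← hp.state, ← hq.state]

theorem Represents.isDirection {g h : Quad T} {p q : Pair} (hp : Represents g p)
    (hq : Represents h q) {f : ℝ → ℝ} (hf : Continuous f) (hf' : Continuous (deriv f))
    (hh : h ∈ nullSpace T) (he : linL (nem hf' (fieldL g)) h = residual hf g) :
    IsDirection T f p q := by
  obtain ⟨hs, hd⟩ := mem_nullSpace_iff.1 hh
  refine ⟨hq.memA hs hd, isWeakSolution_of_mem_solSpace hs hq.state hq.vel hq.ctrl ?_⟩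
  have e : residual hf g - srcL (nem hf' (fieldL g) * fieldL h) = h.2.2.1 := by
    rw [← he, linL_apply, add_sub_cancel_right]
  rw [← e]
  exact hp.linearized_source_coe hq hf hf'

theorem IsDirection.exists_represents {f : ℝ → ℝ} {p q : Pair} (hd : IsDirection T f p q)
    {g : Quad T} (hp : Represents g p) (hf : Continuous f) (hf' : Continuous (deriv f)) :
    ∃ h ∈ nullSpace T, Represents h q ∧ linL (nem hf' (fieldL g)) h = residual hf g := by
  obtain ⟨h, hs, hq, hz⟩ := hd.memA₀.exists_represents
  refine ⟨h, mem_nullSpace_iff.2 ⟨hs, hz⟩, hq, ?_⟩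
  set B := residual hf g - srcL (nem hf' (fieldL g) * fieldL h) with hB
  have hm : ((h.1, h.2.1, B, h.2.2.2) : Quad T) ∈ solSpace T :=
    hd.sol.mem_solSpace hq.state hq.vel hq.ctrl (hp.linearized_source_coe hq hf hf')
  have : h.2.2.1 = B := box_unique hs hm rfl rfl rfl
  rw [linL_apply, this, hB, sub_add_cancel]

theorem Represents.isStateControlPair {g : Quad T} {p : Pair} (hr : Represents g p) {f : ℝ → ℝ}
    (hf : Continuous f) (hg : g ∈ solSpace T) (he : residual hf g = 0) {u₀ : H10} {u₁ : L2}
    {z₀ : H10} {z₁ : L2} (h : (g.1 (t0 T) = u₀ ∧ g.2.1 (t0 T) = u₁) ∧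
      g.1 (t1 T) = z₀ ∧ g.2.1 (t1 T) = z₁) : IsStateControlPair T f u₀ u₁ z₀ z₁ p := by
  have hA := hr.memA hg h
  refine ⟨isWeakSolution_of_mem_solSpace hg hr.state hr.vel hr.ctrl ?_, hA.init, hA.final⟩
  filter_upwards [hr.residual_coe hf, hr.box, Lp.coeFn_zero L2 2 (timeMeasure T)] with t h1 h2 h3
  rw [he, h3] at h1
  rw [← h2]
  filter_upwards [h1, Lp.coeFn_zero ℝ 2 (volume : Measure I)] with x e1 e2
  have e3 : (0 : ℝ) = p.box t x + f (p.y t x) := by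
    rw [← e1]; exact e2.symm
  linarith

end Bridge

section Minimal

variable {T : ℝ} [hF : Fact (0 < T)]

theorem norm_cL2_mul_le (a b : C(I, ℝ)) : ‖cL2 (a * b)‖ ≤ ‖a‖ * ‖cL2 b‖ := by
  refine Lp.norm_le_mul_norm_of_ae_le_mul ?_
  filter_upwards [cL2_coe (a * b), cL2_coe b] with x h1 h2
  rw [h1, h2, ContinuousMap.mul_apply, norm_mul]
  exact mul_le_mul_of_nonneg_right (a.norm_coe_le_norm x) (norm_nonneg _)

theorem norm_srcL_mul_le (A Y : Field T) : ‖srcL (A * Y)‖ ≤ ‖A‖ * ‖srcL Y‖ := by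
  refine Lp.norm_le_mul_norm_of_ae_le_mul ?_
  filter_upwards [srcL_coe (A * Y), srcL_coe Y] with t h1 h2
  rw [h1, h2]
  exact (norm_cL2_mul_le (A (tproj T t)) (Y (tproj T t))).trans
    (mul_le_mul_of_nonneg_right (A.norm_coe_le_norm _) (norm_nonneg _))

/-- The pair `(y, v)` in `L²(Q_T) × L²(0,T)`. -/
def costL : Quad T →L[ℝ] WithLp 2 (TimeL2 T L2 × TimeL2 T ℝ) :=
  (WithLp.prodContinuousLinearEquiv 2 ℝ (TimeL2 T L2) (TimeL2 T ℝ)).symm.toContinuousLinearMap.comp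
    ((srcL.comp fieldL).prod ctrlL)

theorem norm_costL_sq (g : Quad T) : ‖costL g‖ ^ 2 = ‖srcL (fieldL g)‖ ^ 2 + ‖g.2.2.2‖ ^ 2 :=
  WithLp.prod_norm_sq_eq_of_L2 _

theorem norm_srcL_fieldL_le_costL (g : Quad T) : ‖srcL (fieldL g)‖ ≤ ‖costL g‖ :=
  abs_le_of_sq_le_sq' (by rw [norm_costL_sq]; linarith [sq_nonneg ‖g.2.2.2‖]) (norm_nonneg _) |>.2

theorem norm_ctrl_le_costL (g : Quad T) : ‖g.2.2.2‖ ≤ ‖costL g‖ :=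
  abs_le_of_sq_le_sq' (by rw [norm_costL_sq]; linarith [sq_nonneg ‖srcL (fieldL g)‖])
    (norm_nonneg _) |>.2

theorem norm_costL_le (g : Quad T) : ‖costL g‖ ≤ √(T + 1) * ‖g‖ := by
  have hT := hF.out
  refine abs_le_of_sq_le_sq' ?_ (by positivity) |>.2
  rw [norm_costL_sq, mul_pow, Real.sq_sqrt (by linarith)]
  have h1 : ‖srcL (fieldL g)‖ ≤ √T * ‖g‖ :=
    (norm_srcL_le _).trans (mul_le_mul_of_nonneg_left (norm_fieldL_le g) (Real.sqrt_nonneg _))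
  have h2 : ‖g.2.2.2‖ ≤ ‖g‖ := (norm_snd_le g.2.2).trans ((norm_snd_le g.2).trans (norm_snd_le g))
  have h3 := pow_le_pow_left₀ (norm_nonneg _) h1 2
  have h4 := pow_le_pow_left₀ (norm_nonneg _) h2 2
  rw [mul_pow, Real.sq_sqrt hT.le] at h3
  linarith

/-- Bound of a controlled solution of the linearized equation by its cost and its source. -/
theorem exists_linearized_bound (T : ℝ) [hF : Fact (0 < T)] :
    ∃ C : ℝ, 1 ≤ C ∧ ∀ (A : Field T) (m : ℝ), ‖A‖ ≤ m → ∀ g ∈ nullSpace T,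
      ‖g‖ ≤ C * (‖linL A g‖ + (1 + m) * ‖costL g‖) := by
  obtain ⟨C, hC, h⟩ := exists_null_bound T
  refine ⟨C, hC, fun A m hA g hg => (h g hg).trans (mul_le_mul_of_nonneg_left ?_ (by linarith))⟩
  have e : g.2.2.1 = linL A g - srcL (A * fieldL g) := by rw [linL_apply, add_sub_cancel_right]
  have h1 : ‖srcL (A * fieldL g)‖ ≤ m * ‖costL g‖ :=
    (norm_srcL_mul_le A _).trans (mul_le_mul hA (norm_srcL_fieldL_le_costL g) (norm_nonneg _)
      ((norm_nonneg A).trans hA))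
  have h2 : ‖g.2.2.1‖ ≤ ‖linL A g‖ + m * ‖costL g‖ := by
    rw [e]
    exact (norm_sub_le _ _).trans (add_le_add le_rfl h1)
  linarith [norm_ctrl_le_costL g]

/-- There is a control of minimal cost for the linearized equation. -/
theorem exists_minimal_control (A : Field T) {B : TimeL2 T L2} {g₀ : Quad T}
    (hg₀ : g₀ ∈ nullSpace T) (hB : linL A g₀ = B) :
    ∃ g ∈ nullSpace T, linL A g = B ∧
      ∀ g' ∈ nullSpace T, linL A g' = B → ‖costL g‖ ≤ ‖costL g'‖ := by
  obtain ⟨C, hC, hbound⟩ := exists_linearized_bound T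
  let V : Submodule ℝ (Quad T) := nullSpace T ⊓ (linL A).ker
  have hVc : IsClosed (V : Set (Quad T)) :=
    isClosed_nullSpace.inter (linL A).isClosed_ker
  have : CompleteSpace V := hVc.completeSpace_coe
  let Φ : V →L[ℝ] WithLp 2 (TimeL2 T L2 × TimeL2 T ℝ) := costL.comp V.subtypeL
  have hanti : AntilipschitzWith (Real.toNNReal (C * (1 + ‖A‖))) Φ := by
    refine ContinuousLinearMap.antilipschitz_of_bound _ fun g => ?_
    have h0 : linL A (g : Quad T) = 0 := g.2.2
    have := hbound A ‖A‖ le_rfl g g.2.1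
    rw [h0, norm_zero, zero_add, ← mul_assoc] at this
    rw [Real.coe_toNNReal _ (by positivity)]
    exact this
  have hcomp : IsComplete (Φ.range : Set (WithLp 2 (TimeL2 T L2 × TimeL2 T ℝ))) := by
    have := hanti.isComplete_range Φ.uniformContinuous
    exact this
  obtain ⟨w, hw, hmin⟩ := Φ.range.exists_norm_eq_iInf_of_complete_subspace hcomp (costL g₀)
  obtain ⟨v, rfl⟩ := hw
  refine ⟨g₀ - v, (nullSpace T).sub_mem hg₀ v.2.1, ?_, fun g' hg' hB' => ?_⟩
  · have h0 : linL A (v : Quad T) = 0 := v.2.2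
    rw [map_sub, h0, sub_zero, hB]
  · have hd : g₀ - g' ∈ V := ⟨(nullSpace T).sub_mem hg₀ hg', by
      change linL A (g₀ - g') = 0
      rw [map_sub, hB, hB', sub_self]⟩
    have h1 : ‖costL g₀ - Φ v‖ ≤ ‖costL g₀ - Φ ⟨g₀ - g', hd⟩‖ := by
      refine hmin.trans_le ?_
      exact ciInf_le (f := fun w : (Φ.range : Set (WithLp 2 (TimeL2 T L2 × TimeL2 T ℝ))) =>
        ‖costL g₀ - w‖) ⟨0, by rintro _ ⟨w, rfl⟩; exact norm_nonneg _⟩ ⟨Φ ⟨g₀ - g', hd⟩, ⟨_, rfl⟩⟩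
    have e1 : costL (g₀ - (v : Quad T)) = costL g₀ - Φ v := map_sub _ _ _
    have e2 : costL g₀ - Φ ⟨g₀ - g', hd⟩ = costL g' := by
      change costL g₀ - costL (g₀ - g') = _
      rw [map_sub, sub_sub_cancel]
    rw [e1, ← e2]
    exact h1

theorem one_add_le_exp_two_sqrt {m : ℝ} (hm : 0 ≤ m) : 1 + m ≤ Real.exp (2 * √m) := by
  have h := Real.quadratic_le_exp_of_nonneg (x := 2 * √m) (by positivity)
  have h2 : (2 * √m) ^ 2 = 4 * m := by rw [mul_pow, Real.sq_sqrt hm]; ring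
  rw [h2] at h
  linarith [Real.sqrt_nonneg m]

/-- Controls of minimal cost exist, with a bound in terms of the potential. -/
theorem exists_minimal_control_bound (T : ℝ) [hF : Fact (0 < T)] (hT : 2 < T) :
    ∃ C : ℝ, 1 ≤ C ∧ ∀ (A : Field T) (m : ℝ), 0 < m → ‖A‖ ≤ m → ∀ B : TimeL2 T L2,
      (∃ g ∈ nullSpace T, linL A g = B ∧
        ∀ g' ∈ nullSpace T, linL A g' = B → ‖costL g‖ ≤ ‖costL g'‖) ∧
      ∀ g ∈ nullSpace T, linL A g = B →
        (∀ g' ∈ nullSpace T, linL A g' = B → ‖costL g‖ ≤ ‖costL g'‖) →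
        ‖g‖ ≤ C * Real.exp (10 * √m) * ‖B‖ := by
  obtain ⟨C₁, hC₁, h₁⟩ := exists_nullControl T hT
  obtain ⟨C₂, hC₂, h₂⟩ := exists_linearized_bound T
  refine ⟨C₂ * (1 + √(T + 1) * C₁), ?_, fun A m hm hA B => ?_⟩
  · have : 0 ≤ √(T + 1) * C₁ := by positivity
    nlinarith
  obtain ⟨g₀, hg₀, hB₀, hn₀⟩ := h₁ A m hm hA B
  refine ⟨exists_minimal_control A hg₀ hB₀, fun g hg hB hmin => ?_⟩
  have hb := h₂ A m hA g hg
  rw [hB] at hb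
  have hc : ‖costL g‖ ≤ √(T + 1) * (C₁ * (1 + m * Real.exp (6 * √m)) * ‖B‖) :=
    (hmin g₀ hg₀ hB₀).trans ((norm_costL_le g₀).trans
      (mul_le_mul_of_nonneg_left hn₀ (Real.sqrt_nonneg _)))
  set E := Real.exp (10 * √m) with hE
  have hs := Real.sqrt_nonneg m
  have hE1 : 1 ≤ E := Real.one_le_exp (by positivity)
  have hm1 := one_add_le_exp_two_sqrt hm.le
  have hprod : (1 + m) * (1 + m * Real.exp (6 * √m)) ≤ E := by
    have h6 : 1 ≤ Real.exp (6 * √m) := Real.one_le_exp (by positivity)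
    have h3 : 1 + m * Real.exp (6 * √m) ≤ Real.exp (2 * √m) * Real.exp (6 * √m) := by nlinarith
    calc (1 + m) * (1 + m * Real.exp (6 * √m))
        ≤ Real.exp (2 * √m) * (Real.exp (2 * √m) * Real.exp (6 * √m)) :=
          mul_le_mul hm1 h3 (by positivity) (Real.exp_pos _).le
      _ = E := by rw [← Real.exp_add, ← Real.exp_add, hE]; ring_nf
  have hB0 := norm_nonneg B
  set S := √(T + 1) * C₁ with hS
  have hS0 : 0 ≤ S := by positivity
  calc ‖g‖ ≤ C₂ * (‖B‖ + (1 + m) * ‖costL g‖) := hb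
    _ ≤ C₂ * (E * ‖B‖ + S * (E * ‖B‖)) := by
        refine mul_le_mul_of_nonneg_left (add_le_add ?_ ?_) (by linarith)
        · nlinarith
        · calc (1 + m) * ‖costL g‖
              ≤ (1 + m) * (√(T + 1) * (C₁ * (1 + m * Real.exp (6 * √m)) * ‖B‖)) :=
                mul_le_mul_of_nonneg_left hc (by linarith)
            _ = S * (((1 + m) * (1 + m * Real.exp (6 * √m))) * ‖B‖) := by rw [hS]; ring
            _ ≤ S * (E * ‖B‖) :=
                mul_le_mul_of_nonneg_left (mul_le_mul_of_nonneg_right hprod hB0) hS0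
    _ = C₂ * (1 + S) * E * ‖B‖ := by ring

end Minimal

section Remainder

theorem abs_taylor_le {f : ℝ → ℝ} (hf : ContDiff ℝ 1 f) {a s c : ℝ}
    (h : ∀ θ ∈ Icc (0 : ℝ) 1, |deriv f (a - θ * s) - deriv f a| ≤ c) :
    |f (a - s) - f a + deriv f a * s| ≤ c * |s| := by
  have hd : ∀ θ : ℝ, HasDerivAt (fun θ => f (a - θ * s) + θ * (deriv f a * s))
      (deriv f (a - θ * s) * (-s) + deriv f a * s) θ := by
    intro θ
    have h1 : HasDerivAt f (deriv f (a - θ * s)) (a - θ * s) :=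
      (hf.differentiable one_ne_zero _).hasDerivAt
    have h2 : HasDerivAt (fun θ => a - θ * s) (-s) θ := by
      refine (((hasDerivAt_id θ).mul_const s).const_sub a).congr_deriv ?_
      ring
    have h3 : HasDerivAt (fun θ : ℝ => θ * (deriv f a * s)) (deriv f a * s) θ := by
      refine ((hasDerivAt_id θ).mul_const (deriv f a * s)).congr_deriv ?_
      ring
    exact (h1.comp θ h2).add h3
  have key := norm_image_sub_le_of_norm_deriv_le_segment_01' (C := c * |s|)
    (fun θ _ => (hd θ).hasDerivWithinAt) fun θ hθ => by
      have e : deriv f (a - θ * s) * (-s) + deriv f a * s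
          = -((deriv f (a - θ * s) - deriv f a) * s) := by ring
      rw [e, norm_neg, norm_mul]
      exact mul_le_mul_of_nonneg_right (h θ (Ico_subset_Icc_self hθ)) (abs_nonneg _)
  simp only [one_mul, zero_mul, sub_zero, add_zero] at key
  rw [Real.norm_eq_abs] at key
  convert key using 2
  ring

variable {T : ℝ} [hF : Fact (0 < T)] {f : ℝ → ℝ}

theorem continuous_nem {T : ℝ} (hf : Continuous f) : Continuous (nem (T := T) hf) := by
  have h : Continuous fun c : C(I, ℝ) => (⟨f, hf⟩ : C(ℝ, ℝ)).comp c :=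
    ContinuousMap.continuous_postcomp _
  exact ContinuousMap.continuous_postcomp (⟨_, h⟩ : C(C(I, ℝ), C(I, ℝ)))

theorem continuous_residual (hf : Continuous f) : Continuous (residual (T := T) hf) :=
  (boxL (T := T)).continuous.add
    (srcL.continuous.comp ((continuous_nem hf).comp fieldL.continuous))

/-- The error of the linearization of the superposition operator. -/
def remainder (hf : Continuous f) (hf' : Continuous (deriv f)) (y Y : Field T) : Field T :=
  nem hf (y - Y) - nem hf y + nem hf' y * Y

theorem norm_remainder_le {T : ℝ} (hC : ContDiff ℝ 1 f) (hf : Continuous f) (hf' : Continuous (deriv f))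
    {y Y : Field T} {c N : ℝ} (hc : 0 ≤ c) (hY : ‖Y‖ ≤ N)
    (h : ∀ a b, |a| ≤ ‖y‖ → |a - b| ≤ N → |deriv f b - deriv f a| ≤ c) :
    ‖remainder hf hf' y Y‖ ≤ c * N := by
  have hN : 0 ≤ N := (norm_nonneg Y).trans hY
  rw [Field.norm_le_iff (by positivity)]
  intro t x
  change |f (y t x - Y t x) - f (y t x) + deriv f (y t x) * Y t x| ≤ _
  have hYx : |Y t x| ≤ N := (Field.abs_apply_le Y t x).trans hY
  refine (abs_taylor_le hC fun θ hθ => h _ _ (Field.abs_apply_le y t x) ?_).trans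
    (mul_le_mul_of_nonneg_left hYx hc)
  rw [sub_sub_cancel, abs_mul, abs_of_nonneg hθ.1]
  exact (mul_le_of_le_one_left (abs_nonneg _) hθ.2).trans hYx

theorem residual_sub (hf : Continuous f) (hf' : Continuous (deriv f)) {g h : Quad T}
    (hl : linL (nem hf' (fieldL g)) h = residual hf g) (l : ℝ) :
    residual hf (g - l • h) - (1 - l) • residual hf g
      = srcL (remainder hf hf' (fieldL g) (l • fieldL h)) := by
  have e : h.2.2.1 = residual hf g - srcL (nem hf' (fieldL g) * fieldL h) := by
    rw [← hl, linL_apply, add_sub_cancel_right]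
  have e1 : residual hf (g - l • h)
      = g.2.2.1 - l • h.2.2.1 + srcL (nem hf (fieldL g - l • fieldL h)) := by
    rw [← map_smul, ← map_sub]; rfl
  have e2 : residual hf g = g.2.2.1 + srcL (nem hf (fieldL g)) := rfl
  rw [e1, e, remainder, map_add, map_sub, mul_smul_comm, map_smul, e2]
  module

theorem norm_residual_sub_le (hC : ContDiff ℝ 1 f) (hf : Continuous f)
    (hf' : Continuous (deriv f)) {g h : Quad T}
    (hl : linL (nem hf' (fieldL g)) h = residual hf g) {l c : ℝ} (hl0 : 0 ≤ l) (hc : 0 ≤ c)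
    (hm : ∀ a b, |a| ≤ ‖fieldL g‖ → |a - b| ≤ l * ‖h‖ → |deriv f b - deriv f a| ≤ c) :
    ‖residual hf (g - l • h) - (1 - l) • residual hf g‖ ≤ √T * (c * (l * ‖h‖)) := by
  rw [residual_sub hf hf' hl]
  refine (norm_srcL_le _).trans (mul_le_mul_of_nonneg_left ?_ (Real.sqrt_nonneg _))
  refine norm_remainder_le hC hf hf' hc ?_ hm
  rw [← map_smul]
  refine (norm_fieldL_le (l • h)).trans (le_of_eq ?_)
  rw [norm_smul, Real.norm_eq_abs, abs_of_nonneg hl0]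

theorem norm_residual_sub_le_of_bounded (hC : ContDiff ℝ 1 f) (hf : Continuous f) {g h : Quad T}
    {L R : ℝ} (hL : ∀ r, |r| ≤ R → |deriv f r| ≤ L) (hg : ‖g‖ ≤ R) (hh : ‖h‖ ≤ R) :
    ‖residual hf g - residual hf h‖ ≤ (1 + √T * L) * ‖g - h‖ := by
  have hL0 : 0 ≤ L := (abs_nonneg _).trans (hL 0 (by
    rw [abs_zero]; exact (norm_nonneg _).trans hg))
  have e : residual hf g - residual hf h
      = (g - h).2.2.1 + srcL (nem hf (fieldL g) - nem hf (fieldL h)) := by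
    rw [map_sub]
    change g.2.2.1 + _ - (h.2.2.1 + _) = g.2.2.1 - h.2.2.1 + _
    abel
  have h1 : ‖nem hf (fieldL g) - nem hf (fieldL h)‖ ≤ L * ‖g - h‖ := by
    rw [Field.norm_le_iff (by positivity)]
    intro t x
    change |f (fieldL g t x) - f (fieldL h t x)| ≤ _
    have ha : |fieldL g t x| ≤ R := (Field.abs_apply_le _ t x).trans ((norm_fieldL_le g).trans hg)
    have hb : |fieldL h t x| ≤ R := (Field.abs_apply_le _ t x).trans ((norm_fieldL_le h).trans hh)
    have key := (convex_Icc (-R) R).norm_image_sub_le_of_norm_deriv_le (f := f) (C := L)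
      (fun r _ => hC.differentiable one_ne_zero r) (fun r hr => hL r (abs_le.2 hr))
      (abs_le.1 hb) (abs_le.1 ha)
    refine key.trans (mul_le_mul_of_nonneg_left ?_ hL0)
    have : |fieldL (g - h) t x| ≤ ‖g - h‖ :=
      (Field.abs_apply_le _ t x).trans (norm_fieldL_le (g - h))
    rw [map_sub] at this
    exact this
  rw [e]
  refine (norm_add_le _ _).trans ?_
  have h2 : ‖(g - h).2.2.1‖ ≤ ‖g - h‖ :=
    (norm_fst_le (g - h).2.2).trans ((norm_snd_le (g - h).2).trans (norm_snd_le (g - h)))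
  have h3 := (norm_srcL_le (nem hf (fieldL g) - nem hf (fieldL h))).trans
    (mul_le_mul_of_nonneg_left h1 (Real.sqrt_nonneg _))
  linarith

end Remainder

section RealSequences

/-- A damped descent with a direction whose size grows slowly with the iterate stays bounded and
contracts. -/
theorem exists_uniform_contraction {α K c b : ℝ} (hα : 0 < α) (hK : 0 < K) (hc : 1 ≤ c)
    (hb : 0 ≤ b) (hbα : b * (2 + 1 / α) ≤ 1 / 2) {e M N : ℕ → ℝ} (he : ∀ k, 0 ≤ e k)
    (hM0 : ∀ k, 0 ≤ M k) (hN0 : ∀ k, 0 ≤ N k) (hM : ∀ k, M (k + 1) ≤ M k + N k)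
    (hN : ∀ k, N k ≤ c * (1 + M k) ^ b * e k)
    (hstep : ∀ k, ∀ l ∈ Icc (0 : ℝ) 1, e (k + 1) ≤ (1 - l) * e k + K * (l * N k) ^ α * (l * N k)) :
    ∃ κ : ℝ, 0 < κ ∧ ∃ ρ : ℝ, 0 < ρ ∧ ρ < 1 ∧ ∀ k, N k ≤ κ * e k ∧ e (k + 1) ≤ ρ * e k := by
  set s : ℝ := (1 / (2 * K)) ^ (1 / α) with hs
  have hs0 : 0 < s := by positivity
  have hsα : s ^ α = 1 / (2 * K) := by
    rw [hs, ← Real.rpow_mul (by positivity), one_div_mul_cancel hα.ne', Real.rpow_one]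
  set Q := e 0 / s with hQ
  have hQ0 : 0 ≤ Q := div_nonneg (he 0) hs0.le
  set D := 2 * e 0 * (1 + Q) * c ^ (2 + 1 / α) with hD
  have hD0 : 0 ≤ D := by have := he 0; positivity
  set R := (1 + M 0 + D) ^ 2 - 1 with hR
  have hM00 := hM0 0
  have hR1 : 1 + R = (1 + M 0 + D) ^ 2 := by rw [hR]; ring
  have hR0 : 1 ≤ 1 + R := by rw [hR1]; nlinarith
  set κ := c * (1 + R) ^ b with hκ
  have hκ1 : 1 ≤ κ := by
    have := Real.one_le_rpow hR0 hb
    nlinarith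
  have hκ0 : 0 < κ := by linarith
  set L := 1 / ((1 + Q) * κ ^ (1 + 1 / α)) with hL
  have hκp : 1 ≤ κ ^ (1 + 1 / α) := Real.one_le_rpow hκ1 (by positivity)
  have hL0 : 0 < L := by positivity
  have hL1 : L ≤ 1 := by
    rw [hL, div_le_one (by positivity)]
    nlinarith
  have hstart : M 0 + 2 * κ / L * e 0 ≤ R := by
    have e1 : 2 * κ / L * e 0 = 2 * e 0 * (1 + Q) * κ ^ (2 + 1 / α) := by
      have hp : κ ^ (2 + 1 / α) = κ * κ ^ (1 + 1 / α) := by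
        rw [show 2 + 1 / α = 1 + (1 + 1 / α) by ring, Real.rpow_add hκ0, Real.rpow_one]
      rw [hp, hL, div_div_eq_mul_div, div_one]
      ring
    have e2 : κ ^ (2 + 1 / α) ≤ c ^ (2 + 1 / α) * (1 + M 0 + D) := by
      rw [hκ, Real.mul_rpow (by linarith) (by positivity), ← Real.rpow_mul (by linarith)]
      refine mul_le_mul_of_nonneg_left ?_ (by positivity)
      refine (Real.rpow_le_rpow_of_exponent_le hR0 hbα).trans (le_of_eq ?_)
      rw [← Real.sqrt_eq_rpow, hR1, Real.sqrt_sq (by linarith)]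
    have e3 : 2 * e 0 * (1 + Q) * κ ^ (2 + 1 / α) ≤ D * (1 + M 0 + D) := by
      rw [hD, mul_assoc (2 * e 0 * (1 + Q))]
      refine mul_le_mul_of_nonneg_left e2 ?_
      have := he 0
      positivity
    rw [e1, hR]
    nlinarith
  have hcontr : ∀ k, M k ≤ R → e k ≤ e 0 → N k ≤ κ * e k ∧ e (k + 1) ≤ (1 - L / 2) * e k := by
    intro k hMk hek
    have hNk : N k ≤ κ * e k := by
      refine (hN k).trans (mul_le_mul_of_nonneg_right ?_ (he k))
      refine mul_le_mul_of_nonneg_left ?_ (by linarith)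
      exact Real.rpow_le_rpow (by linarith [hM0 k]) (by linarith) hb
    refine ⟨hNk, (hstep k L ⟨hL0.le, hL1⟩).trans ?_⟩
    have hLN : L * N k ≤ L * κ * e k := by
      rw [mul_assoc]; exact mul_le_mul_of_nonneg_left hNk hL0.le
    have hLNs : L * N k ≤ s * κ ^ (-(1 / α)) := by
      have h1 : L * κ = κ ^ (-(1 / α)) / (1 + Q) := by
        rw [hL, Real.rpow_add hκ0, Real.rpow_one, Real.rpow_neg hκ0.le]
        field_simp
      have h2 : e k ≤ s * (1 + Q) := by
        have : s * Q = e 0 := by rw [hQ]; field_simp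
        nlinarith
      refine hLN.trans ?_
      rw [h1, div_mul_eq_mul_div, div_le_iff₀ (by positivity)]
      have := mul_le_mul_of_nonneg_left h2 (Real.rpow_nonneg hκ0.le (-(1 / α)))
      linarith
    have hpow : (L * N k) ^ α ≤ 1 / (2 * K) * κ⁻¹ := by
      refine (Real.rpow_le_rpow (mul_nonneg hL0.le (hN0 k)) hLNs hα.le).trans (le_of_eq ?_)
      rw [Real.mul_rpow hs0.le (by positivity), hsα, ← Real.rpow_mul hκ0.le]
      rw [show -(1 / α) * α = -1 by field_simp, Real.rpow_neg_one]
    have hfin : K * (L * N k) ^ α * (L * N k) ≤ L / 2 * e k := by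
      calc K * (L * N k) ^ α * (L * N k)
          ≤ K * (1 / (2 * K) * κ⁻¹) * (L * κ * e k) := by
            refine mul_le_mul (mul_le_mul_of_nonneg_left hpow hK.le) hLN
              (mul_nonneg hL0.le (hN0 k)) (by positivity)
        _ = L / 2 * e k := by field_simp
    linarith
  have hinv : ∀ k, M k + 2 * κ / L * e k ≤ R ∧ e k ≤ e 0 := by
    intro k
    induction k with
    | zero => exact ⟨hstart, le_rfl⟩
    | succ k ih =>
      have hq : 0 ≤ 2 * κ / L := by positivity
      have hMk : M k ≤ R := by
        have := mul_nonneg hq (he k)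
        linarith [ih.1]
      obtain ⟨h1, h2⟩ := hcontr k hMk ih.2
      have h3 : 2 * κ / L * e (k + 1) ≤ 2 * κ / L * e k - κ * e k := by
        refine (mul_le_mul_of_nonneg_left h2 hq).trans (le_of_eq ?_)
        field_simp
      refine ⟨by linarith [ih.1, hM k], ?_⟩
      have := mul_nonneg hL0.le (he k)
      linarith [ih.2]
  refine ⟨κ, hκ0, 1 - L / 2, by linarith, by linarith, fun k => ?_⟩
  have hq : 0 ≤ 2 * κ / L * e k := mul_nonneg (by positivity) (he k)
  exact hcontr k (by linarith [(hinv k).1]) (hinv k).2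

theorem le_geometric {e : ℕ → ℝ} {ρ : ℝ} (hρ : 0 ≤ ρ) (h : ∀ k, e (k + 1) ≤ ρ * e k) (k j : ℕ) :
    e (k + j) ≤ e k * ρ ^ j := by
  induction j with
  | zero => simp
  | succ j ih =>
    refine (h (k + j)).trans ((mul_le_mul_of_nonneg_left ih hρ).trans (le_of_eq ?_))
    ring

theorem tendsto_zero_of_contraction {e : ℕ → ℝ} {ρ : ℝ} (he : ∀ k, 0 ≤ e k) (hρ : 0 ≤ ρ)
    (hρ1 : ρ < 1) (h : ∀ k, e (k + 1) ≤ ρ * e k) : Tendsto e atTop (𝓝 0) := by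
  refine squeeze_zero he (fun k => ?_)
    (by simpa using (tendsto_pow_atTop_nhds_zero_of_lt_one hρ hρ1).const_mul (e 0))
  simpa using le_geometric hρ h 0 k

theorem exists_hasOrderFrom {α C : ℝ} (hα : 0 < α) (hC : 0 < C) {e : ℕ → ℝ}
    (he0 : Tendsto e atTop (𝓝 0)) (h : ∀ k, e (k + 1) ≤ C * e k ^ (1 + α)) (k₁ : ℕ) :
    ∃ k₀, k₁ ≤ k₀ ∧ HasOrderFrom (1 + α) k₀ e := by
  have ht : Tendsto (fun k => C * e k ^ α) atTop (𝓝 0) := by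
    have := ((Real.continuousAt_rpow_const 0 α (.inr hα.le)).tendsto.comp he0).const_mul C
    simpa [Real.zero_rpow hα.ne', Function.comp_def] using this
  obtain ⟨k₀, h1, h2⟩ := ((ht.eventually_lt_const one_pos).and (eventually_ge_atTop k₁)).exists
  refine ⟨k₀, h2, C, hC, ?_, fun k _ => h k⟩
  rwa [add_sub_cancel_left]

end RealSequences

section Algorithm

variable {T : ℝ} [hF : Fact (0 < T)] {f : ℝ → ℝ}

/-- The least-squares algorithm in terms of quadruples. -/
structure QuadLS (hf : Continuous f) (hf' : Continuous (deriv f)) (g h : ℕ → Quad T)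
    (lam : ℕ → ℝ) : Prop where
  null : ∀ k, h k ∈ nullSpace T
  lin : ∀ k, linL (nem hf' (fieldL (g k))) (h k) = residual hf (g k)
  minimal : ∀ k, ∀ h' ∈ nullSpace T, linL (nem hf' (fieldL (g k))) h' = residual hf (g k) →
    ‖costL (h k)‖ ≤ ‖costL h'‖
  lam_mem : ∀ k, lam k ∈ Icc (0 : ℝ) 1
  opt : ∀ k, ∀ l ∈ Icc (0 : ℝ) 1,
    ‖residual hf (g k - lam k • h k)‖ ≤ ‖residual hf (g k - l • h k)‖
  next : ∀ k, g (k + 1) = g k - lam k • h k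

variable {hf : Continuous f} {hf' : Continuous (deriv f)} {g h : ℕ → Quad T} {lam : ℕ → ℝ}

theorem QuadLS.norm_residual_succ_le (hs : QuadLS hf hf' g h lam) (k : ℕ) {l : ℝ}
    (hl : l ∈ Icc (0 : ℝ) 1) : ‖residual hf (g (k + 1))‖ ≤ (1 - l) * ‖residual hf (g k)‖
      + ‖residual hf (g k - l • h k) - (1 - l) • residual hf (g k)‖ := by
  rw [hs.next k]
  refine (hs.opt k l hl).trans ?_
  calc ‖residual hf (g k - l • h k)‖
      = ‖(1 - l) • residual hf (g k)
          + (residual hf (g k - l • h k) - (1 - l) • residual hf (g k))‖ := by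
        rw [add_sub_cancel]
    _ ≤ _ := by
        refine (norm_add_le _ _).trans (le_of_eq ?_)
        rw [norm_smul, Real.norm_eq_abs, abs_of_nonneg (by linarith [hl.2])]

theorem QuadLS.norm_fieldL_succ_le (hs : QuadLS hf hf' g h lam) (k : ℕ) :
    ‖fieldL (g (k + 1))‖ ≤ ‖fieldL (g k)‖ + ‖h k‖ := by
  rw [hs.next k, map_sub]
  refine (norm_sub_le (fieldL (g k)) (fieldL (lam k • h k))).trans
    (add_le_add le_rfl ((norm_fieldL_le (lam k • h k)).trans ?_))
  rw [norm_smul, Real.norm_eq_abs, abs_of_nonneg (hs.lam_mem k).1]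
  exact mul_le_of_le_one_left (norm_nonneg _) (hs.lam_mem k).2

theorem holder_modulus {α K : ℝ} (hα : 0 ≤ α) (hK : 0 ≤ K)
    (hH : ∀ a b : ℝ, a ≠ b → |deriv f a - deriv f b| ≤ K * |a - b| ^ α) {a b N : ℝ}
    (hab : |a - b| ≤ N) : |deriv f b - deriv f a| ≤ K * N ^ α := by
  have hN : 0 ≤ N := (abs_nonneg _).trans hab
  rcases eq_or_ne a b with rfl | hne
  · rw [sub_self, abs_zero]; positivity
  · rw [abs_sub_comm]
    exact (hH a b hne).trans
      (mul_le_mul_of_nonneg_left (Real.rpow_le_rpow (abs_nonneg _) hab hα) hK)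

theorem norm_nem_le {T : ℝ} {u : ℝ → ℝ} (hu : Continuous u) {y : Field T} {m : ℝ} (hm : 0 ≤ m)
    (h : ∀ r, |r| ≤ ‖y‖ → |u r| ≤ m) : ‖nem hu y‖ ≤ m :=
  (Field.norm_le_iff hm).2 fun t x => h _ (Field.abs_apply_le y t x)

theorem exp_sqrt_le {A β M : ℝ} (hA : 0 ≤ A) (hβ : 0 ≤ β) (hM : 0 ≤ M) :
    Real.exp (10 * √(A + β * Real.log (1 + M) ^ 2))
      ≤ Real.exp (10 * √A) * (1 + M) ^ (10 * √β) := by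
  have hlog : 0 ≤ Real.log (1 + M) := Real.log_nonneg (by linarith)
  rw [Real.rpow_def_of_pos (by linarith), ← Real.exp_add]
  refine Real.exp_le_exp.2 ?_
  have h1 : √(A + β * Real.log (1 + M) ^ 2) ≤ √A + √β * Real.log (1 + M) := by
    refine Real.sqrt_le_iff.2 ⟨by positivity, ?_⟩
    have e : (√A + √β * Real.log (1 + M)) ^ 2
        = √A ^ 2 + √β ^ 2 * Real.log (1 + M) ^ 2 + 2 * (√A * (√β * Real.log (1 + M))) := by ring
    rw [e, Real.sq_sqrt hA, Real.sq_sqrt hβ]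
    have : 0 ≤ √A * (√β * Real.log (1 + M)) := by positivity
    linarith
  linarith

/-- Bound of the directions of minimal cost. -/
def DirectionBound (T C : ℝ) [Fact (0 < T)] : Prop :=
  ∀ (A : Field T) (m : ℝ), 0 < m → ‖A‖ ≤ m → ∀ B : TimeL2 T L2, ∀ g ∈ nullSpace T, linL A g = B →
    (∀ g' ∈ nullSpace T, linL A g' = B → ‖costL g‖ ≤ ‖costL g'‖) →
    ‖g‖ ≤ C * Real.exp (10 * √m) * ‖B‖

/-- The directions are controlled by the residuals, which contract. -/
def Contracts (hf : Continuous f) (g h : ℕ → Quad T) (κ ρ : ℝ) : Prop :=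
  0 < κ ∧ 0 < ρ ∧ ρ < 1 ∧
    ∀ k, ‖h k‖ ≤ κ * ‖residual hf (g k)‖ ∧ ‖residual hf (g (k + 1))‖ ≤ ρ * ‖residual hf (g k)‖

theorem QuadLS.contracts_of_holder (hs : QuadLS hf hf' g h lam) (hC1 : ContDiff ℝ 1 f)
    {C α K A β : ℝ} (hC : 1 ≤ C) (hdir : DirectionBound T C) (hα : 0 < α) (hK : 0 ≤ K)
    (hH : ∀ a b : ℝ, a ≠ b → |deriv f a - deriv f b| ≤ K * |a - b| ^ α) (hA : 0 < A) (hβ : 0 ≤ β)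
    (hgrow : ∀ r, |deriv f r| ≤ A + β * Real.log (1 + |r|) ^ 2)
    (hβα : 10 * √β * (2 + 1 / α) ≤ 1 / 2) : ∃ κ ρ, Contracts hf g h κ ρ := by
  have hT := hF.out
  have h1 := exists_uniform_contraction (α := α) (K := √T * K + 1) (c := C * Real.exp (10 * √A))
    (b := 10 * √β) hα (by positivity) (one_le_mul_of_one_le_of_one_le hC
      (Real.one_le_exp (by positivity))) (by positivity) hβα
    (e := fun k => ‖residual hf (g k)‖) (M := fun k => ‖fieldL (g k)‖) (N := fun k => ‖h k‖)
    (fun k => norm_nonneg _) (fun k => norm_nonneg (fieldL (g k))) (fun k => norm_nonneg _)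
    hs.norm_fieldL_succ_le ?_ ?_
  · obtain ⟨κ, hκ, ρ, hρ, hρ1, hall⟩ := h1
    exact ⟨κ, ρ, hκ, hρ, hρ1, hall⟩
  · intro k
    have hM := norm_nonneg (fieldL (g k))
    set M := ‖fieldL (g k)‖ with hMdef
    have hm : 0 < A + β * Real.log (1 + M) ^ 2 := by positivity
    have hn : ‖nem hf' (fieldL (g k))‖ ≤ A + β * Real.log (1 + M) ^ 2 := by
      refine norm_nem_le hf' hm.le fun r hr => (hgrow r).trans ?_
      have hlog0 : 0 ≤ Real.log (1 + |r|) := Real.log_nonneg (by linarith [abs_nonneg r])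
      have hlog : Real.log (1 + |r|) ≤ Real.log (1 + M) :=
        Real.log_le_log (by linarith [abs_nonneg r]) (by linarith)
      have := mul_le_mul_of_nonneg_left (pow_le_pow_left₀ hlog0 hlog 2) hβ
      linarith
    refine (hdir _ _ hm hn _ (h k) (hs.null k) (hs.lin k) (hs.minimal k)).trans ?_
    refine mul_le_mul_of_nonneg_right ?_ (norm_nonneg _)
    rw [mul_assoc]
    exact mul_le_mul_of_nonneg_left (exp_sqrt_le hA.le hβ hM) (by linarith)
  · intro k l hl
    have hlN : 0 ≤ l * ‖h k‖ := mul_nonneg hl.1 (norm_nonneg _)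
    refine (hs.norm_residual_succ_le k hl).trans (add_le_add le_rfl ?_)
    refine (norm_residual_sub_le hC1 hf hf' (hs.lin k) hl.1 (c := K * (l * ‖h k‖) ^ α)
      (by positivity) fun a b _ hab => holder_modulus hα.le hK hH hab).trans ?_
    have : 0 ≤ (l * ‖h k‖) ^ α * (l * ‖h k‖) := by positivity
    nlinarith

theorem QuadLS.contracts_of_small (hs : QuadLS hf hf' g h lam) (hC1 : ContDiff ℝ 1 f)
    {C δ : ℝ} (hC : 1 ≤ C) (hdir : DirectionBound T C) (hδ : 0 < δ)
    (hsmall : √T * (2 * δ * (C * Real.exp (10 * √δ))) ≤ 1 / 2)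
    (hbd : ∀ r, |deriv f r| ≤ δ) : ∃ κ ρ, Contracts hf g h κ ρ := by
  have hκ : ∀ k, ‖h k‖ ≤ C * Real.exp (10 * √δ) * ‖residual hf (g k)‖ := fun k =>
    hdir _ δ hδ (norm_nem_le hf' hδ.le fun r _ => hbd r) _ (h k) (hs.null k) (hs.lin k) (hs.minimal k)
  refine ⟨C * Real.exp (10 * √δ), 1 / 2, by positivity, by norm_num, by norm_num, fun k => ⟨hκ k, ?_⟩⟩
  refine (hs.norm_residual_succ_le k (l := 1) ⟨zero_le_one, le_rfl⟩).trans ?_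
  have h1 := norm_residual_sub_le hC1 hf hf' (hs.lin k) zero_le_one (c := 2 * δ) (by positivity)
    fun a b _ _ => (abs_sub _ _).trans (by linarith [hbd a, hbd b])
  rw [one_mul] at h1
  have h2 : √T * (2 * δ * ‖h k‖)
      ≤ √T * (2 * δ * (C * Real.exp (10 * √δ) * ‖residual hf (g k)‖)) :=
    mul_le_mul_of_nonneg_left (mul_le_mul_of_nonneg_left (hκ k) (by positivity)) (Real.sqrt_nonneg _)
  have h3 := mul_le_mul_of_nonneg_right hsmall (norm_nonneg (residual hf (g k)))
  rw [sub_self, zero_mul, zero_add]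
  rw [sub_self] at h1
  refine h1.trans (h2.trans (le_trans (le_of_eq ?_) h3))
  ring

end Algorithm

section Convergence

variable {T : ℝ} [hF : Fact (0 < T)] {f : ℝ → ℝ} {hf : Continuous f} {hf' : Continuous (deriv f)}
  {g h : ℕ → Quad T} {lam : ℕ → ℝ} {κ ρ : ℝ}

theorem Contracts.tendsto_residual (hc : Contracts hf g h κ ρ) :
    Tendsto (fun k => ‖residual hf (g k)‖) atTop (𝓝 0) :=
  tendsto_zero_of_contraction (fun _ => norm_nonneg _) hc.2.1.le hc.2.2.1 fun k => (hc.2.2.2 k).2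

theorem QuadLS.exists_limit (hs : QuadLS hf hf' g h lam) (hc : Contracts hf g h κ ρ) :
    ∃ gbar : Quad T, Tendsto g atTop (𝓝 gbar) ∧ residual hf gbar = 0 ∧
      ∀ k, ‖g k - gbar‖ ≤ κ / (1 - ρ) * ‖residual hf (g k)‖ := by
  have htend := hc.tendsto_residual
  obtain ⟨hκ, hρ, hρ1, hall⟩ := hc
  have hgeo := fun k j => le_geometric (e := fun k => ‖residual hf (g k)‖) hρ.le
    (fun k => (hall k).2) k j
  have hdist : ∀ k j, dist (g (k + j)) (g (k + (j + 1))) ≤ κ * ‖residual hf (g k)‖ * ρ ^ j := by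
    intro k j
    rw [dist_eq_norm, ← add_assoc, hs.next, sub_sub_cancel, norm_smul, Real.norm_eq_abs,
      abs_of_nonneg (hs.lam_mem _).1]
    refine (mul_le_of_le_one_left (norm_nonneg _) (hs.lam_mem _).2).trans ((hall _).1.trans ?_)
    rw [mul_assoc]
    exact mul_le_mul_of_nonneg_left (hgeo k j) hκ.le
  have hcauchy : CauchySeq g := by
    refine cauchySeq_of_le_geometric ρ (κ * ‖residual hf (g 0)‖) hρ1 fun j => ?_
    simpa using hdist 0 j
  obtain ⟨gbar, hlim⟩ := cauchySeq_tendsto_of_complete hcauchy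
  refine ⟨gbar, hlim, ?_, fun k => ?_⟩
  · have h1 := ((continuous_residual hf).tendsto gbar).comp hlim
    have h2 := h1.norm
    exact norm_eq_zero.1 (tendsto_nhds_unique h2 htend)
  · have hlim' : Tendsto (fun j => g (k + j)) atTop (𝓝 gbar) := by
      have := hlim.comp (tendsto_add_atTop_nat k)
      refine this.congr fun j => ?_
      rw [Function.comp_apply, add_comm]
    have := dist_le_of_le_geometric_of_tendsto₀ ρ (κ * ‖residual hf (g k)‖) hρ1 (hdist k) hlim'
    rw [dist_eq_norm, add_zero] at this
    refine this.trans (le_of_eq ?_)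
    ring

theorem exists_norm_bound_of_tendsto {T : ℝ} {g : ℕ → Quad T} (hlim : ∃ gbar, Tendsto g atTop (𝓝 gbar)) :
    ∃ R : ℝ, ∀ k, ‖g k‖ ≤ R := by
  obtain ⟨gbar, hlim⟩ := hlim
  obtain ⟨R, hR⟩ := (Metric.isBounded_range_of_tendsto g hlim).exists_norm_le
  exact ⟨R, fun k => hR _ ⟨k, rfl⟩⟩

/-- The linearization error is negligible with respect to the residual. -/
theorem QuadLS.linearization_error (hs : QuadLS hf hf' g h lam) (hC1 : ContDiff ℝ 1 f)
    (hc : Contracts hf g h κ ρ) {ε : ℝ} (hε : 0 < ε) :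
    ∃ k₀, ∀ k, k₀ ≤ k → ∀ l ∈ Icc (0 : ℝ) 1,
      ‖residual hf (g k - l • h k) - (1 - l) • residual hf (g k)‖ ≤ ε * ‖residual hf (g k)‖ := by
  have htend := hc.tendsto_residual
  obtain ⟨gbar, hlim, -, -⟩ := hs.exists_limit hc
  obtain ⟨R, hR⟩ := exists_norm_bound_of_tendsto ⟨gbar, hlim⟩
  obtain ⟨hκ, hρ, hρ1, hall⟩ := hc
  have hT := hF.out
  set ε' := ε / (√T * κ) with hε'
  have hε'0 : 0 < ε' := by positivity
  have huc := (isCompact_Icc (a := -(R + 1)) (b := R + 1)).uniformContinuousOn_of_continuous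
    hf'.continuousOn
  obtain ⟨η, hη, hmod⟩ := Metric.uniformContinuousOn_iff.1 huc ε' hε'0
  have hsmall : ∀ᶠ k in atTop, κ * ‖residual hf (g k)‖ < min η 1 := by
    have := htend.const_mul κ
    rw [mul_zero] at this
    exact this.eventually_lt_const (by positivity)
  obtain ⟨k₀, hk₀⟩ := eventually_atTop.1 hsmall
  refine ⟨k₀, fun k hk l hl => ?_⟩
  have hhk : ‖h k‖ < min η 1 := (hall k).1.trans_lt (hk₀ k hk)
  have hlh : l * ‖h k‖ ≤ ‖h k‖ := mul_le_of_le_one_left (norm_nonneg _) hl.2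
  have hlh0 : 0 ≤ l * ‖h k‖ := mul_nonneg hl.1 (norm_nonneg _)
  refine (norm_residual_sub_le hC1 hf hf' (hs.lin k) hl.1 hε'0.le fun a b ha hab => ?_).trans ?_
  · have haR : |a| ≤ R := ha.trans ((norm_fieldL_le _).trans (hR k))
    have hab' : |a - b| < min η 1 := (hab.trans hlh).trans_lt hhk
    have hb : |b| ≤ R + 1 := by
      have h1 := abs_sub_abs_le_abs_sub b a
      rw [abs_sub_comm b a] at h1
      have := hab'.trans_le (min_le_right _ _)
      linarith
    have := hmod b (abs_le.1 hb) a (abs_le.1 (by linarith)) (by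
      rw [dist_comm, Real.dist_eq]; exact hab'.trans_le (min_le_left _ _))
    rw [Real.dist_eq] at this
    exact this.le
  · calc √T * (ε' * (l * ‖h k‖)) ≤ √T * (ε' * (κ * ‖residual hf (g k)‖)) := by
          refine mul_le_mul_of_nonneg_left (mul_le_mul_of_nonneg_left
            (hlh.trans (hall k).1) hε'0.le) (Real.sqrt_nonneg _)
      _ = ε * ‖residual hf (g k)‖ := by rw [hε']; field_simp

theorem QuadLS.linearization_error_holder (hs : QuadLS hf hf' g h lam) (hC1 : ContDiff ℝ 1 f)
    (hc : Contracts hf g h κ ρ) {α K : ℝ} (hα : 0 < α) (hK : 0 ≤ K)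
    (hH : ∀ a b : ℝ, a ≠ b → |deriv f a - deriv f b| ≤ K * |a - b| ^ α) (k : ℕ) {l : ℝ}
    (hl : l ∈ Icc (0 : ℝ) 1) :
    ‖residual hf (g k - l • h k) - (1 - l) • residual hf (g k)‖
      ≤ √T * (K * κ ^ α * κ) * ‖residual hf (g k)‖ ^ α * ‖residual hf (g k)‖ := by
  obtain ⟨hκ, hρ, hρ1, hall⟩ := hc
  have hlh : l * ‖h k‖ ≤ κ * ‖residual hf (g k)‖ :=
    (mul_le_of_le_one_left (norm_nonneg _) hl.2).trans (hall k).1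
  have hlh0 : 0 ≤ l * ‖h k‖ := mul_nonneg hl.1 (norm_nonneg _)
  refine (norm_residual_sub_le hC1 hf hf' (hs.lin k) hl.1
    (c := K * (κ * ‖residual hf (g k)‖) ^ α) (by positivity)
    fun a b _ hab => holder_modulus hα.le hK hH (hab.trans hlh)).trans ?_
  rw [Real.mul_rpow hκ.le (norm_nonneg _)]
  calc √T * (K * (κ ^ α * ‖residual hf (g k)‖ ^ α) * (l * ‖h k‖))
      ≤ √T * (K * (κ ^ α * ‖residual hf (g k)‖ ^ α) * (κ * ‖residual hf (g k)‖)) := by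
        gcongr
    _ = _ := by ring

theorem QuadLS.norm_residual_succ_le_of_error (hs : QuadLS hf hf' g h lam) {k : ℕ} {τ : ℝ}
    (hτ : ∀ l ∈ Icc (0 : ℝ) 1, ‖residual hf (g k - l • h k) - (1 - l) • residual hf (g k)‖
      ≤ τ * ‖residual hf (g k)‖) : ‖residual hf (g (k + 1))‖ ≤ τ * ‖residual hf (g k)‖ := by
  have h1 := hs.norm_residual_succ_le k (l := 1) ⟨zero_le_one, le_rfl⟩
  have h2 := hτ 1 ⟨zero_le_one, le_rfl⟩
  linarith

theorem QuadLS.abs_one_sub_lam_le (hs : QuadLS hf hf' g h lam) {k : ℕ} {τ : ℝ}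
    (hne : residual hf (g k) ≠ 0)
    (hτ : ∀ l ∈ Icc (0 : ℝ) 1, ‖residual hf (g k - l • h k) - (1 - l) • residual hf (g k)‖
      ≤ τ * ‖residual hf (g k)‖) : |1 - lam k| ≤ 2 * τ := by
  have hpos : 0 < ‖residual hf (g k)‖ := norm_pos_iff.2 hne
  have h1 := hs.norm_residual_succ_le_of_error hτ
  have h2 := hτ (lam k) (hs.lam_mem k)
  rw [← hs.next k] at h2
  have h3 : (1 - lam k) * ‖residual hf (g k)‖ ≤ 2 * τ * ‖residual hf (g k)‖ := by
    have h4 : ‖(1 - lam k) • residual hf (g k)‖ = (1 - lam k) * ‖residual hf (g k)‖ := by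
      rw [norm_smul, Real.norm_eq_abs, abs_of_nonneg (by linarith [(hs.lam_mem k).2])]
    have h5 := norm_sub_norm_le ((1 - lam k) • residual hf (g k)) (residual hf (g (k + 1)))
    rw [norm_sub_rev] at h5
    linarith
  rw [abs_of_nonneg (by linarith [(hs.lam_mem k).2])]
  exact le_of_mul_le_mul_right h3 hpos

end Convergence

section Growth

theorem exists_growth_bound {u : ℝ → ℝ} (hu : Continuous u) {β : ℝ} (hβ : 0 < β)
    (h : limsup (fun r : ℝ => ((|u r| / Real.log |r| ^ 2 : ℝ) : EReal)) (cocompact ℝ)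
      < (β : EReal)) : ∃ A : ℝ, 0 < A ∧ ∀ r, |u r| ≤ A + β * Real.log (1 + |r|) ^ 2 := by
  have h1 := eventually_lt_of_limsup_lt h
  have h2 : ∀ᶠ r : ℝ in cocompact ℝ, 2 ≤ ‖r‖ :=
    (tendsto_norm_cocompact_atTop (E := ℝ)).eventually_ge_atTop 2
  obtain ⟨t, ht, hsub⟩ := mem_cocompact.1 (h1.and h2)
  obtain ⟨A, hA⟩ := ht.exists_bound_of_continuousOn hu.continuousOn
  refine ⟨max A 1, by positivity, fun r => ?_⟩
  have hlog1 : 0 ≤ β * Real.log (1 + |r|) ^ 2 := by positivity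
  by_cases hr : r ∈ t
  · have := hA r hr
    rw [Real.norm_eq_abs] at this
    linarith [le_max_left A 1]
  · obtain ⟨a1, a2⟩ := hsub hr
    have a3 := EReal.coe_lt_coe_iff.1 a1
    rw [Real.norm_eq_abs] at a2
    have hpos : 0 < Real.log |r| := Real.log_pos (by linarith)
    rw [div_lt_iff₀ (by positivity)] at a3
    have hlog : Real.log |r| ≤ Real.log (1 + |r|) := Real.log_le_log (by linarith) (by linarith)
    have := mul_le_mul_of_nonneg_left (pow_le_pow_left₀ hpos.le hlog 2) hβ.le
    linarith [le_max_right A 1]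

end Growth

section Translate

variable {T : ℝ} [hF : Fact (0 < T)] {f : ℝ → ℝ} {u₀ : H10} {u₁ : L2} {z₀ : H10} {z₁ : L2}

theorem Represents.unique {T : ℝ} {g g' : Quad T} {p : Pair} (h : Represents g p) (h' : Represents g' p) :
    g = g' :=
  Prod.ext (ContinuousMap.ext fun t => (h.state t).symm.trans (h'.state t))
    (Prod.ext (ContinuousMap.ext fun t => (h.vel t).symm.trans (h'.vel t))
      (Prod.ext (Lp.ext (h.box.symm.trans h'.box)) (Lp.ext (h.ctrl.symm.trans h'.ctrl))))

theorem Represents.cost_eq_costL {g : Quad T} {p : Pair} (hr : Represents g p) :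
    cost T p = ‖costL g‖ ^ 2 := by
  rw [hr.cost_eq, norm_costL_sq]

/-- `g` belongs to `𝒜`. -/
def Steers (u₀ : H10) (u₁ : L2) (z₀ : H10) (z₁ : L2) (g : Quad T) : Prop :=
  g ∈ solSpace T ∧ (g.1 (t0 T) = u₀ ∧ g.2.1 (t0 T) = u₁) ∧ g.1 (t1 T) = z₀ ∧ g.2.1 (t1 T) = z₁

theorem Steers.sub_smul {g h : Quad T} (hg : Steers u₀ u₁ z₀ z₁ g) (hh : h ∈ nullSpace T) (c : ℝ) :
    Steers u₀ u₁ z₀ z₁ (g - c • h) := by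
  obtain ⟨hs, ⟨h1, h2⟩, h3, h4⟩ := mem_nullSpace_iff.1 hh
  obtain ⟨gs, ⟨g1, g2⟩, g3, g4⟩ := hg
  have key : ∀ {E : Type} [NormedAddCommGroup E] [NormedSpace ℝ E] {a b w : E}, a = w → b = 0 →
      a - c • b = w := fun ha hb => by rw [ha, hb, smul_zero, sub_zero]
  exact ⟨(solSpace T).sub_mem gs ((solSpace T).smul_mem c hs), ⟨key g1 h1, key g2 h2⟩,
    key g3 h3, key g4 h4⟩

theorem Steers.sub_mem_nullSpace {g g' : Quad T} (hg : Steers u₀ u₁ z₀ z₁ g)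
    (hg' : Steers u₀ u₁ z₀ z₁ g') : g - g' ∈ nullSpace T := by
  obtain ⟨gs, ⟨g1, g2⟩, g3, g4⟩ := hg
  obtain ⟨gs', ⟨g1', g2'⟩, g3', g4'⟩ := hg'
  exact mem_nullSpace_iff.2 ⟨(solSpace T).sub_mem gs gs',
    ⟨sub_eq_zero.2 (g1.trans g1'.symm), sub_eq_zero.2 (g2.trans g2'.symm)⟩,
    sub_eq_zero.2 (g3.trans g3'.symm), sub_eq_zero.2 (g4.trans g4'.symm)⟩

theorem steers_of_tendsto {g : ℕ → Quad T} {gbar : Quad T} (h : ∀ k, Steers u₀ u₁ z₀ z₁ (g k))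
    (hlim : Tendsto g atTop (𝓝 gbar)) : Steers u₀ u₁ z₀ z₁ gbar := by
  have hd : ∀ k, g 0 - g k ∈ nullSpace T := fun k => (h 0).sub_mem_nullSpace (h k)
  have hm : g 0 - gbar ∈ nullSpace T :=
    isClosed_nullSpace.mem_of_tendsto (hlim.const_sub (g 0)) (Eventually.of_forall hd)
  have := (h 0).sub_smul hm 1
  rwa [one_smul, sub_sub_cancel] at this

theorem IsLeastSquares.exists_quadLS {p q : ℕ → Pair} {lam : ℕ → ℝ}
    (hls : IsLeastSquares T f u₀ u₁ z₀ z₁ p q lam) (hf : Continuous f)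
    (hf' : Continuous (deriv f)) : ∃ g h : ℕ → Quad T, QuadLS hf hf' g h lam ∧
      (∀ k, Represents (g k) (p k)) ∧ ∀ k, Steers u₀ u₁ z₀ z₁ (g k) := by
  have hex : ∀ k, ∃ g : Quad T, Represents g (p k) ∧ Steers u₀ u₁ z₀ z₁ g := by
    intro k
    induction k with
    | zero =>
      obtain ⟨g, h1, h2, h3⟩ := hls.start.exists_represents
      exact ⟨g, h2, h1, h3⟩
    | succ k ih =>
      obtain ⟨g, hr, hst⟩ := ih
      obtain ⟨h, hn, hq, -⟩ := (hls.direction k).exists_represents hr hf hf'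
      rw [hls.next k]
      exact ⟨_, hr.sub (hq.smul (lam k)), hst.sub_smul hn _⟩
  choose g hr hst using hex
  choose h hn hq hl using fun k => (hls.direction k).exists_represents (hr k) hf hf'
  refine ⟨g, h, ⟨hn, hl, fun k h' hh' hl' => ?_, hls.step_mem, fun k l hl => ?_, fun k => ?_⟩, hr, hst⟩
  · have := hls.minimal k _ ((hr k).isDirection (represents_pairOf h') hf hf' hh' hl')
    rw [(hq k).cost_eq_costL, (represents_pairOf h').cost_eq_costL] at this
    exact abs_le_of_sq_le_sq' this (norm_nonneg _) |>.2
  · have : energy T f (p k - lam k • q k) ≤ energy T f (p k - l • q k) := hls.step_opt k hl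
    rw [((hr k).sub ((hq k).smul (lam k))).energy_eq hf,
      ((hr k).sub ((hq k).smul l)).energy_eq hf] at this
    exact abs_le_of_sq_le_sq' (by linarith) (norm_nonneg _) |>.2
  · have h1 := (hr k).sub ((hq k).smul (lam k))
    rw [← hls.next k] at h1
    exact (hr (k + 1)).unique h1

theorem exists_leastSquares_step (hT : 2 < T) (hf : Continuous f) (hf' : Continuous (deriv f))
    {p : Pair} (hp : MemA T u₀ u₁ z₀ z₁ p) :
    ∃ (q : Pair) (l : ℝ), (IsDirection T f p q ∧
      (∀ q' : Pair, IsDirection T f p q' → cost T q ≤ cost T q') ∧ l ∈ Icc (0 : ℝ) 1 ∧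
      IsMinOn (fun l : ℝ => energy T f (p - l • q)) (Icc 0 1) l) ∧
      MemA T u₀ u₁ z₀ z₁ (p - l • q) := by
  obtain ⟨g, hg, hr, hend⟩ := hp.exists_represents
  obtain ⟨C, -, hmin⟩ := exists_minimal_control_bound T hT
  obtain ⟨⟨h, hn, hl, hm⟩, -⟩ := hmin (nem hf' (fieldL g)) (‖nem hf' (fieldL g)‖ + 1)
    (by have := norm_nonneg (nem hf' (fieldL g)); linarith) (by linarith) (residual hf g)
  have hq := represents_pairOf h
  have hcont : Continuous fun l : ℝ => energy T f (p - l • pairOf h) := by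
    have e : (fun l : ℝ => energy T f (p - l • pairOf h))
        = fun l : ℝ => 1 / 2 * ‖residual hf (g - l • h)‖ ^ 2 := by
      ext l
      exact (hr.sub (hq.smul l)).energy_eq hf
    rw [e]
    exact continuous_const.mul ((((continuous_residual hf).comp
      (continuous_const.sub (continuous_id.smul continuous_const))).norm).pow 2)
  obtain ⟨l, hl1, hl2⟩ := isCompact_Icc.exists_isMinOn (nonempty_Icc.2 zero_le_one)
    hcont.continuousOn (f := fun l : ℝ => energy T f (p - l • pairOf h)) (s := Icc (0 : ℝ) 1)
  refine ⟨pairOf h, l, ⟨hr.isDirection hq hf hf' hn hl, fun q' hq' => ?_, hl1, hl2⟩, ?_⟩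
  · obtain ⟨h', hn', hr', hl'⟩ := hq'.exists_represents hr hf hf'
    rw [hq.cost_eq_costL, hr'.cost_eq_costL]
    exact pow_le_pow_left₀ (norm_nonneg _) (hm h' hn' hl') 2
  · have hs : Steers u₀ u₁ z₀ z₁ (g - l • h) := Steers.sub_smul ⟨hg, hend⟩ hn l
    exact (hr.sub (hq.smul l)).memA hs.1 hs.2

theorem exists_leastSquares (hT : 2 < T) (hf : Continuous f) (hf' : Continuous (deriv f))
    {p₀ : Pair} (hp : MemA T u₀ u₁ z₀ z₁ p₀) : ∃ (p q : ℕ → Pair) (lam : ℕ → ℝ),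
      IsLeastSquares T f u₀ u₁ z₀ z₁ p q lam ∧ p 0 = p₀ := by
  choose q l hstep hnext using fun p : {p : Pair // MemA T u₀ u₁ z₀ z₁ p} =>
    exists_leastSquares_step hT hf hf' p.2
  let P : ℕ → {p : Pair // MemA T u₀ u₁ z₀ z₁ p} := fun n =>
    Nat.rec ⟨p₀, hp⟩ (fun _ p => ⟨p - l p • q p, hnext p⟩) n
  have hsucc : ∀ k, (P (k + 1)).1 = (P k).1 - l (P k) • q (P k) := fun k => rfl
  have hzero : (P 0).1 = p₀ := rfl
  clear_value P
  refine ⟨fun k => (P k).1, fun k => q (P k), fun k => l (P k), ?_, hzero⟩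
  exact
    { start := (P 0).2
      direction := fun k => (hstep (P k)).1
      minimal := fun k => (hstep (P k)).2.1
      step_mem := fun k => (hstep (P k)).2.2.1
      step_opt := fun k => (hstep (P k)).2.2.2
      next := hsucc }

/-- On null-controlled pairs the norm of `ℋ` is equivalent to the norm of quadruples. -/
theorem exists_normH_equiv (T : ℝ) [hF : Fact (0 < T)] : ∃ C : ℝ, 0 < C ∧ ∀ g ∈ nullSpace T,
    ∀ p : Pair, Represents g p → normH T p ≤ C * ‖g‖ ∧ ‖g‖ ≤ C * normH T p := by
  obtain ⟨C, hC, h⟩ := exists_null_bound T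
  have hT := hF.out
  refine ⟨max (√(T + 2)) (2 * C), by positivity, fun g hg p hr => ?_⟩
  obtain ⟨hs, ⟨h1, h2⟩, -⟩ := mem_nullSpace_iff.1 hg
  have e : normH T p = √(‖g.2.2.1‖ ^ 2 + ‖costL g‖ ^ 2) := by
    rw [hr.normH_eq, h1, h2, norm_costL_sq, norm_zero, norm_zero]
    ring_nf
  have hn : 0 ≤ normH T p := Real.sqrt_nonneg _
  have hbox : ‖g.2.2.1‖ ≤ ‖g‖ := (norm_fst_le g.2.2).trans ((norm_snd_le g.2).trans (norm_snd_le g))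
  constructor
  · refine le_trans ?_ (mul_le_mul_of_nonneg_right (le_max_left _ _) (norm_nonneg _))
    rw [e]
    refine Real.sqrt_le_iff.2 ⟨by positivity, ?_⟩
    have h3 := pow_le_pow_left₀ (norm_nonneg _) hbox 2
    have h4 := pow_le_pow_left₀ (norm_nonneg _) (norm_costL_le g) 2
    rw [mul_pow, Real.sq_sqrt (by linarith)] at h4
    rw [mul_pow, Real.sq_sqrt (by linarith)]
    linarith
  · refine le_trans ?_ (mul_le_mul_of_nonneg_right (le_max_right _ _) hn)
    have h3 : ‖g.2.2.1‖ ≤ normH T p := by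
      rw [e]
      exact Real.le_sqrt_of_sq_le (by linarith [sq_nonneg ‖costL g‖])
    have h4 : ‖g.2.2.2‖ ≤ normH T p := by
      refine (norm_ctrl_le_costL g).trans ?_
      rw [e]
      exact Real.le_sqrt_of_sq_le (by linarith [sq_nonneg ‖g.2.2.1‖])
    refine (h g hg).trans ?_
    rw [mul_assoc, mul_left_comm]
    exact mul_le_mul_of_nonneg_left (by linarith) (by linarith)

end Translate

section Conclusion

variable {T : ℝ} [hF : Fact (0 < T)] {f : ℝ → ℝ} {u₀ : H10} {u₁ : L2} {z₀ : H10} {z₁ : L2}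
  {p q : ℕ → Pair} {lam : ℕ → ℝ} {hf : Continuous f} {hf' : Continuous (deriv f)}
  {g h : ℕ → Quad T} {κ ρ : ℝ}

/-- The constant in the superlinear decay of the residuals. -/
theorem QuadLS.exists_holder_decay (hs : QuadLS hf hf' g h lam) (hC1 : ContDiff ℝ 1 f)
    (hc : Contracts hf g h κ ρ) {α K : ℝ} (hα : 0 < α) (hK : 0 ≤ K)
    (hH : ∀ a b : ℝ, a ≠ b → |deriv f a - deriv f b| ≤ K * |a - b| ^ α) :
    ∃ L : ℝ, 0 < L ∧
      (∀ k, ‖residual hf (g (k + 1))‖ ≤ L * ‖residual hf (g k)‖ ^ (1 + α)) ∧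
      ∀ k, residual hf (g k) ≠ 0 → |1 - lam k| ≤ 2 * L * ‖residual hf (g k)‖ ^ α := by
  have hκ := hc.1
  set L := √T * (K * κ ^ α * κ) + 1 with hL
  have hL0 : 0 < L := by positivity
  have herr : ∀ k, ∀ l ∈ Icc (0 : ℝ) 1,
      ‖residual hf (g k - l • h k) - (1 - l) • residual hf (g k)‖
        ≤ L * ‖residual hf (g k)‖ ^ α * ‖residual hf (g k)‖ := by
    intro k l hl
    refine (hs.linearization_error_holder hC1 hc hα hK hH k hl).trans ?_
    refine mul_le_mul_of_nonneg_right (mul_le_mul_of_nonneg_right ?_ (by positivity)) (norm_nonneg _)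
    linarith
  refine ⟨L, hL0, fun k => ?_, fun k hne => ?_⟩
  · refine (hs.norm_residual_succ_le_of_error (herr k)).trans (le_of_eq ?_)
    rw [add_comm 1 α, Real.rpow_add_one' (norm_nonneg _) (by linarith), mul_assoc]
  · refine (hs.abs_one_sub_lam_le hne (herr k)).trans (le_of_eq ?_)
    ring

theorem energy_conclusion (hr : ∀ k, Represents (g k) (p k)) (hs : QuadLS hf hf' g h lam)
    (hC1 : ContDiff ℝ 1 f) (hc : Contracts hf g h κ ρ) {α K : ℝ} (hα : 0 ≤ α) (hK : 0 ≤ K)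
    (hH : ∀ a b : ℝ, a ≠ b → |deriv f a - deriv f b| ≤ K * |a - b| ^ α) :
    Tendsto (fun k => energy T f (p k)) atTop (𝓝 0) ∧
      (∃ c : ℝ, 0 < c ∧ c < 1 ∧ ∀ k, energy T f (p (k + 1)) ≤ c * energy T f (p k)) ∧
      ∃ k₀ : ℕ, HasOrderFrom (1 + α) k₀ (fun k => energy T f (p k)) := by
  obtain ⟨hκ, hρ, hρ1, hall⟩ := id hc
  have hE : ∀ k, energy T f (p k) = 1 / 2 * ‖residual hf (g k)‖ ^ 2 := fun k => (hr k).energy_eq hf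
  have hE0 : ∀ k, 0 ≤ energy T f (p k) := fun k => by rw [hE]; positivity
  have hstep : ∀ k, energy T f (p (k + 1)) ≤ ρ ^ 2 * energy T f (p k) := fun k => by
    rw [hE, hE]
    have := pow_le_pow_left₀ (norm_nonneg _) (hall k).2 2
    rw [mul_pow] at this
    linarith
  have hρ2 : ρ ^ 2 < 1 := by nlinarith
  have htend := tendsto_zero_of_contraction hE0 (by positivity) hρ2 hstep
  refine ⟨htend, ⟨ρ ^ 2, by positivity, hρ2, hstep⟩, ?_⟩
  rcases hα.eq_or_lt with rfl | hα
  · refine ⟨0, ρ ^ 2, by positivity, ?_, fun k _ => ?_⟩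
    · simpa using hρ2
    · simpa using hstep k
  · obtain ⟨L, hL, hdec, -⟩ := hs.exists_holder_decay hC1 hc hα hK hH
    obtain ⟨k₀, -, h0⟩ := exists_hasOrderFrom (e := fun k => energy T f (p k))
      (C := 1 / 2 * L ^ 2 * 2 ^ (1 + α)) hα (by positivity) htend (fun k => by
        have h1 := pow_le_pow_left₀ (norm_nonneg _) (hdec k) 2
        simp only [hE]
        have h2 : (1 / 2 * ‖residual hf (g k)‖ ^ 2 : ℝ) ^ (1 + α)
            = (2 ^ (1 + α))⁻¹ * (‖residual hf (g k)‖ ^ (1 + α)) ^ 2 := by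
          rw [Real.mul_rpow (by norm_num) (by positivity), one_div, Real.inv_rpow (by norm_num)]
          congr 1
          rw [← Real.rpow_natCast, ← Real.rpow_natCast, ← Real.rpow_mul (norm_nonneg _),
            ← Real.rpow_mul (norm_nonneg _), mul_comm]
        have h3 : (0 : ℝ) < 2 ^ (1 + α) := by positivity
        rw [h2]
        calc 1 / 2 * ‖residual hf (g (k + 1))‖ ^ 2
            ≤ 1 / 2 * (L * ‖residual hf (g k)‖ ^ (1 + α)) ^ 2 := by linarith
          _ = _ := by field_simp) 0
    exact ⟨k₀, h0⟩

theorem step_conclusion (hr : ∀ k, Represents (g k) (p k)) (hs : QuadLS hf hf' g h lam)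
    (hC1 : ContDiff ℝ 1 f) (hc : Contracts hf g h κ ρ) {α K : ℝ} (hK : 0 ≤ K)
    (hH : ∀ a b : ℝ, a ≠ b → |deriv f a - deriv f b| ≤ K * |a - b| ^ α)
    (hne : ∀ k, energy T f (p k) ≠ 0) :
    Tendsto lam atTop (𝓝 1) ∧
      (0 < α →
        (∃ C c : ℝ, 0 < c ∧ c < 1 ∧ ∀ k, |1 - lam k| ≤ C * c ^ k) ∧
        ∃ (k₀ : ℕ) (e : ℕ → ℝ), HasOrderFrom (1 + α) k₀ e ∧
          ∀ k, k₀ ≤ k → |1 - lam k| ≤ e k) := by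
  have hne' : ∀ k, residual hf (g k) ≠ 0 := fun k h0 => hne k (by
    rw [(hr k).energy_eq hf, h0, norm_zero]; norm_num)
  refine ⟨?_, fun hα => ?_⟩
  · rw [Metric.tendsto_atTop]
    intro ε hε
    obtain ⟨k₀, hk₀⟩ := hs.linearization_error hC1 hc (ε := ε / 4) (by positivity)
    refine ⟨k₀, fun k hk => ?_⟩
    rw [dist_comm, Real.dist_eq]
    have := hs.abs_one_sub_lam_le (hne' k) (hk₀ k hk)
    linarith
  · obtain ⟨L, hL, hdec, hlam⟩ := hs.exists_holder_decay hC1 hc hα hK hH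
    have htend := hc.tendsto_residual
    obtain ⟨hκ, hρ, hρ1, hall⟩ := hc
    have hgeo : ∀ k, ‖residual hf (g k)‖ ≤ ‖residual hf (g 0)‖ * ρ ^ k := fun k => by
      simpa using le_geometric (e := fun k => ‖residual hf (g k)‖) hρ.le (fun k => (hall k).2) 0 k
    refine ⟨⟨2 * L * ‖residual hf (g 0)‖ ^ α, ρ ^ α, by positivity,
      Real.rpow_lt_one hρ.le hρ1 hα, fun k => (hlam k (hne' k)).trans ?_⟩, ?_⟩
    · have h1 := Real.rpow_le_rpow (norm_nonneg _) (hgeo k) hα.le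
      rw [Real.mul_rpow (norm_nonneg _) (by positivity), ← Real.rpow_pow_comm hρ.le] at h1
      refine (mul_le_mul_of_nonneg_left h1 (by positivity : 0 ≤ 2 * L)).trans (le_of_eq ?_)
      ring
    · have ht : Tendsto (fun k => 2 * L * ‖residual hf (g k)‖ ^ α) atTop (𝓝 0) := by
        have := ((Real.continuousAt_rpow_const 0 α (.inr hα.le)).tendsto.comp htend).const_mul (2 * L)
        simpa [Real.zero_rpow hα.ne', Function.comp_def] using this
      obtain ⟨k₀, -, h0⟩ := exists_hasOrderFrom
        (C := 2 * L * L ^ α * ((2 * L) ^ (1 + α))⁻¹) hα (by positivity) ht (fun k => by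
          have h1 := Real.rpow_le_rpow (norm_nonneg _) (hdec k) hα.le
          have h2 : (2 * L * ‖residual hf (g k)‖ ^ α) ^ (1 + α)
              = (2 * L) ^ (1 + α) * (‖residual hf (g k)‖ ^ (1 + α)) ^ α := by
            rw [Real.mul_rpow (by positivity) (by positivity), ← Real.rpow_mul (norm_nonneg _),
              ← Real.rpow_mul (norm_nonneg _), mul_comm α]
          rw [Real.mul_rpow hL.le (by positivity)] at h1
          rw [h2]
          have h3 : (0 : ℝ) < (2 * L) ^ (1 + α) := by positivity
          calc 2 * L * ‖residual hf (g (k + 1))‖ ^ α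
              ≤ 2 * L * (L ^ α * (‖residual hf (g k)‖ ^ (1 + α)) ^ α) :=
                mul_le_mul_of_nonneg_left h1 (by positivity)
            _ = _ := by field_simp) 0
      exact ⟨k₀, _, h0, fun k _ => hlam k (hne' k)⟩

theorem pair_conclusion (hr : ∀ k, Represents (g k) (p k)) (hs : QuadLS hf hf' g h lam)
    (hst : ∀ k, Steers u₀ u₁ z₀ z₁ (g k)) (hC1 : ContDiff ℝ 1 f) (hc : Contracts hf g h κ ρ)
    {α K : ℝ} (hα : 0 ≤ α) (hK : 0 ≤ K)
    (hH : ∀ a b : ℝ, a ≠ b → |deriv f a - deriv f b| ≤ K * |a - b| ^ α) :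
    ∃ pbar : Pair, MemA T u₀ u₁ z₀ z₁ pbar ∧ IsStateControlPair T f u₀ u₁ z₀ z₁ pbar ∧
      Tendsto (fun k => normH T (p k - pbar)) atTop (𝓝 0) ∧
      (∃ C c : ℝ, 0 < c ∧ c < 1 ∧ ∀ k, normH T (p k - pbar) ≤ C * c ^ k) ∧
      ∃ k₀ : ℕ, HasOrderFrom (1 + α) k₀ (fun k => normH T (p k - pbar)) := by
  obtain ⟨gbar, hlim, hres, hdist⟩ := hs.exists_limit hc
  obtain ⟨R, hR⟩ := exists_norm_bound_of_tendsto ⟨gbar, hlim⟩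
  have hRbar : ‖gbar‖ ≤ R := le_of_tendsto hlim.norm (Eventually.of_forall hR)
  have hsbar := steers_of_tendsto hst hlim
  have hrbar := represents_pairOf gbar
  obtain ⟨B, hB, hequiv⟩ := exists_normH_equiv T
  obtain ⟨S, hS⟩ := (isCompact_Icc (a := -R) (b := R)).exists_bound_of_continuousOn hf'.continuousOn
  have hrd : ∀ k, Represents (g k - gbar) (p k - pairOf gbar) := fun k => (hr k).sub hrbar
  have heq := fun k => hequiv _ ((hst k).sub_mem_nullSpace hsbar) _ (hrd k)
  obtain ⟨hκ, hρ, hρ1, hall⟩ := id hc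
  set e : ℕ → ℝ := fun k => ‖residual hf (g k)‖ with he
  set n : ℕ → ℝ := fun k => normH T (p k - pairOf gbar) with hn
  have hn0 : ∀ k, 0 ≤ n k := fun k => Real.sqrt_nonneg _
  have he0 : ∀ k, 0 ≤ e k := fun k => norm_nonneg _
  have h1ρ : 0 < 1 - ρ := by linarith
  set a := B * (κ / (1 - ρ)) with ha
  have ha0 : 0 < a := by positivity
  have hna : ∀ k, n k ≤ a * e k := fun k => by
    refine (heq k).1.trans ?_
    rw [ha, mul_assoc]
    exact mul_le_mul_of_nonneg_left (hdist k) hB.le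
  set b := (1 + √T * |S|) * B with hb
  have hb0 : 0 < b := by positivity
  have heb : ∀ k, e k ≤ b * n k := fun k => by
    have h1 := norm_residual_sub_le_of_bounded hC1 hf (L := |S|) (R := R)
      (fun r hr' => (hS r (abs_le.1 hr')).trans (le_abs_self S)) (hR k) hRbar
    rw [hres, sub_zero] at h1
    refine h1.trans ?_
    rw [hb, mul_assoc]
    exact mul_le_mul_of_nonneg_left (heq k).2 (by positivity)
  have htend : Tendsto e atTop (𝓝 0) := hc.tendsto_residual
  have hntend : Tendsto n atTop (𝓝 0) :=
    squeeze_zero hn0 hna (by simpa using htend.const_mul a)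
  refine ⟨pairOf gbar, hrbar.memA hsbar.1 hsbar.2, hrbar.isStateControlPair hf hsbar.1 hres hsbar.2,
    hntend, ⟨a * e 0, ρ, hρ, hρ1, fun k => ?_⟩, ?_⟩
  · have := le_geometric (e := e) hρ.le (fun k => (hall k).2) 0 k
    rw [zero_add] at this
    refine (hna k).trans ((mul_le_mul_of_nonneg_left this ha0.le).trans (le_of_eq ?_))
    ring
  rcases hα.eq_or_lt with rfl | hα
  · obtain ⟨k₀, hk₀⟩ := hs.linearization_error hC1 hc (ε := 1 / (2 * (a * b))) (by positivity)
    refine ⟨k₀, 1 / 2, by norm_num, ?_, fun k hk => ?_⟩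
    · simp only [add_zero, sub_self, Real.rpow_zero]
      norm_num
    · have h1 : e (k + 1) ≤ 1 / (2 * (a * b)) * e k := hs.norm_residual_succ_le_of_error (hk₀ k hk)
      rw [add_zero, Real.rpow_one]
      calc n (k + 1) ≤ a * e (k + 1) := hna _
        _ ≤ a * (1 / (2 * (a * b)) * (b * n k)) :=
            mul_le_mul_of_nonneg_left (h1.trans (mul_le_mul_of_nonneg_left (heb k) (by positivity)))
              ha0.le
        _ = 1 / 2 * n k := by field_simp
  · obtain ⟨L, hL, hdec, -⟩ := hs.exists_holder_decay hC1 hc hα hK hH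
    obtain ⟨k₀, -, h0⟩ := exists_hasOrderFrom (C := a * (L * b ^ (1 + α))) hα (by positivity) hntend
      (fun k => by
        have h1 := Real.rpow_le_rpow (he0 k) (heb k) (by linarith : 0 ≤ 1 + α)
        rw [Real.mul_rpow hb0.le (hn0 k)] at h1
        calc n (k + 1) ≤ a * e (k + 1) := hna _
          _ ≤ a * (L * (b ^ (1 + α) * n k ^ (1 + α))) :=
              mul_le_mul_of_nonneg_left ((hdec k).trans (mul_le_mul_of_nonneg_left h1 hL.le)) ha0.le
          _ = _ := by ring) 0
    exact ⟨k₀, h0⟩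

end Conclusion

end NeumannWave

end

open NeumannWave

theorem theorem7 (T : ℝ) (hT : 2 < T) (α : ℝ) (hα : α ∈ Set.Icc (0 : ℝ) 1) :
    ∃ β : ℝ, 0 < β ∧ ∃ δ : ℝ, 0 < δ ∧
      ∀ f : ℝ → ℝ, MemW α f →
        limsup (fun r : ℝ => ((|deriv f r| / Real.log |r| ^ 2 : ℝ) : EReal)) (cocompact ℝ)
          < (β : EReal) →
        (α = 0 → ∀ r : ℝ, |deriv f r| ≤ δ) →
        ∀ (u₀ : H10) (u₁ : L2) (z₀ : H10) (z₁ : L2),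
          -- the algorithm is well defined
          (∃ p₀ : Pair, MemA T u₀ u₁ z₀ z₁ p₀) ∧
          (∀ p₀ : Pair, MemA T u₀ u₁ z₀ z₁ p₀ →
            ∃ (p q : ℕ → Pair) (lam : ℕ → ℝ),
              IsLeastSquares T f u₀ u₁ z₀ z₁ p q lam ∧ p 0 = p₀) ∧
          ∀ (p q : ℕ → Pair) (lam : ℕ → ℝ), IsLeastSquares T f u₀ u₁ z₀ z₁ p q lam →
            -- the energies
            (Tendsto (fun k => energy T f (p k)) atTop (𝓝 0) ∧
              (∃ c : ℝ, 0 < c ∧ c < 1 ∧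
                ∀ k, energy T f (p (k + 1)) ≤ c * energy T f (p k)) ∧
              ∃ k₀ : ℕ, HasOrderFrom (1 + α) k₀ (fun k => energy T f (p k))) ∧
            -- the steps, when the algorithm does not stop at an exact zero of the energy
            ((∀ k, energy T f (p k) ≠ 0) →
              Tendsto lam atTop (𝓝 1) ∧
              (0 < α →
                (∃ C c : ℝ, 0 < c ∧ c < 1 ∧ ∀ k, |1 - lam k| ≤ C * c ^ k) ∧
                ∃ (k₀ : ℕ) (e : ℕ → ℝ), HasOrderFrom (1 + α) k₀ e ∧
                  ∀ k, k₀ ≤ k → |1 - lam k| ≤ e k)) ∧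
            -- the pairs
            ∃ pbar : Pair, MemA T u₀ u₁ z₀ z₁ pbar ∧
              IsStateControlPair T f u₀ u₁ z₀ z₁ pbar ∧
              Tendsto (fun k => normH T (p k - pbar)) atTop (𝓝 0) ∧
              (∃ C c : ℝ, 0 < c ∧ c < 1 ∧ ∀ k, normH T (p k - pbar) ≤ C * c ^ k) ∧
              ∃ k₀ : ℕ, HasOrderFrom (1 + α) k₀ (fun k => normH T (p k - pbar)) := by
  have hF : Fact (0 < T) := ⟨by linarith⟩
  have hTpos : 0 < T := hF.out
  obtain ⟨C, hC, hmin⟩ := exists_minimal_control_bound T hT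
  have hdir : DirectionBound T C := fun A m hm hA B => (hmin A m hm hA B).2
  have hα2 : 0 < 2 + 1 / α := by have := hα.1; positivity
  have hs0 := Real.sqrt_nonneg T
  have hX : 0 ≤ 4 * √T * C * Real.exp 10 := by positivity
  set δ := 1 / (4 * √T * C * Real.exp 10 + 1) with hδ
  have hδ0 : 0 < δ := by positivity
  have hδ1 : δ ≤ 1 := by
    rw [hδ, div_le_one (by positivity)]
    linarith
  have hsmall : √T * (2 * δ * (C * Real.exp (10 * √δ))) ≤ 1 / 2 := by
    have h1 : Real.exp (10 * √δ) ≤ Real.exp 10 :=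
      Real.exp_le_exp.2 (by linarith [Real.sqrt_le_one.2 hδ1])
    have h2 : (4 * √T * C * Real.exp 10) * δ ≤ 1 := by
      rw [hδ, mul_one_div, div_le_one (by positivity)]
      linarith
    calc √T * (2 * δ * (C * Real.exp (10 * √δ))) ≤ √T * (2 * δ * (C * Real.exp 10)) := by gcongr
      _ ≤ 1 / 2 := by linarith
  refine ⟨(1 / (20 * (2 + 1 / α))) ^ 2, by positivity, δ, hδ0,
    fun f hW hlimsup hfδ u₀ u₁ z₀ z₁ => ?_⟩
  obtain ⟨hC1, K, hK⟩ := hW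
  have hf : Continuous f := hC1.continuous
  have hf' : Continuous (deriv f) := hC1.continuous_deriv le_rfl
  have hH : ∀ a b : ℝ, a ≠ b → |deriv f a - deriv f b| ≤ max K 0 * |a - b| ^ α := fun a b hab =>
    (hK a b hab).trans (mul_le_mul_of_nonneg_right (le_max_left _ _) (by positivity))
  refine ⟨?_, fun p₀ hp₀ => exists_leastSquares hT hf hf' hp₀, fun p q lam hls => ?_⟩
  · obtain ⟨g, hg, hend⟩ := exists_steering T hT u₀ u₁ z₀ z₁
    exact ⟨pairOf g, (represents_pairOf g).memA hg hend⟩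
  obtain ⟨g, h, hs, hr, hst⟩ := hls.exists_quadLS hf hf'
  have hcontr : ∃ κ ρ, Contracts hf g h κ ρ := by
    rcases hα.1.eq_or_lt with hα0 | hα0
    · exact hs.contracts_of_small hC1 hC hdir hδ0 hsmall (hfδ hα0.symm)
    · obtain ⟨A, hA, hgrow⟩ := exists_growth_bound hf' (by positivity) hlimsup
      refine hs.contracts_of_holder hC1 hC hdir hα0 (le_max_right K 0) hH hA (by positivity) hgrow ?_
      rw [Real.sqrt_sq (by positivity)]
      refine le_of_eq ?_
      field_simp
      norm_num
  obtain ⟨κ, ρ, hc⟩ := hcontr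
  exact ⟨energy_conclusion hr hs hC1 hc hα.1 (le_max_right K 0) hH,
    fun hne => step_conclusion hr hs hC1 hc (le_max_right K 0) hH hne,
    pair_conclusion hr hs hst hC1 hc hα.1 (le_max_right K 0) hH⟩
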